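/- **Setting.** For a locally compact Hausdorff space $S$ with countable base let $\Omega_S$ be the space of càdlàg paths $\mathbb{R}_+\to S$, $X_t(\omega)=\omega(t)$, $\mathcal F=\sigma(X_t,t\ge 0)$, $\mathcal F_t=\bigcap_{s>t}\sigma(X_r,r\le s)$, $\theta_t\omega(s)=\omega(t+s)$. Let $D\subseteq C(S)$, let $\mathcal L$ map $D$ into the Borel functions on $S$ with $\int_0^t|\mathcal Lf(X_s(\omega))|ds<\infty$ for all $t\ge0$, $\omega\in\Omega_S$, $f\in D$, let $\Sigma\in\mathcal F$ and $x\in S$. A probability measure $P$ on $(\Omega_S,\mathcal F)$ solves the martingale problem (MP) $(D,\mathcal L,\Sigma,x)$ if $P(\Sigma)=1$, $P(X_0=x)=1$ and for all $f\in D$ the process $f(X_t)-f(X_0)-\int_0^t\mathcal Lf(X_s)\,ds$ is a local $P$-martingale for $(\mathcal F_t)$. A family $(P_x)_{x\in S}$ of probability measures on $(\Omega_S,\mathcal F)$ is *Markov* if $x\mapsto P_x(A)$ is Borel for all $A\in\mathcal F$ and $P_x(\theta_t^{-1}G\mid\mathcal F_t)=P_{X_t}(G)$ $P_x$-a.s.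 for all $x\in S$, $t\ge 0$, $G\in\mathcal F$; it is *$C_b$-Feller* if it is Markov and $T_t(C_b(S))\subseteq C_b(S)$ for all $t\ge0$, where $T_tf(x)=E_x[f(X_t)]$; it is *Feller-Dynkin* if it is $C_b$-Feller and $T_t(C_0(S))\subseteq C_0(S)$ for all $t\ge0$, where $C_0(S)$ is the set of continuous real functions vanishing at infinity. A *conservative $Q$-matrix* on a countable set $I$ is a matrix $(q_{ij})_{i,j\in I}$ with $q_{ij}\ge0$ for $i\ne j$ and $-q_{ii}=\sum_{j\ne i}q_{ij}<\infty$. **Data.** Let $d\in\mathbb N$, let $S_d$ be a countable discrete space and $S=\mathbb R^d\times S_d$. Let $b\colon S\to\mathbb R^d$ and $a\colon S\to\mathbb S^d$ (symmetric non-negative definite $d\times d$ matrices) be Borel and locally bounded, and for each $x\in\mathbb R^d$ let $Q(x)=(q_{ij}(x))_{i,j\in S_d}$ be a conservative $Q$-matrix, Borel in $x$. Put $\overline q_{ij}=\sup_xq_{ij}(x)$ for $i\neq j$ and $\overline q_{ii}=-\sum_{k\ne i}\overline q_{ik}$, and assume $|\overline q_{ii}|<\infty$ for all $i$ and $\sup_{j}\sup_x|q_{jj}(x)-\overline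 q_{jj}|<\infty$. With $\overline Q f(i)=\sum_j\overline q_{ij}f(j)$ let $C=\{f\in C_0(S_d):\overline Qf\in C_0(S_d)\}$ and assume that for every $i\in S_d$ the MP $(C,\overline Q,\Omega_{S_d},i)$ on the state space $S_d$ has a unique solution $P^d_i$, and that the family $(P^d_i)_{i\in S_d}$ is Feller-Dynkin. For $(x,i)\in S$ set $$\mathcal Lf(x,i)=\langle\nabla_xf(x,i),b(x,i)\rangle+\tfrac12\operatorname{trace}\big(\nabla_x^2f(x,i)\,a(x,i)\big)+\sum_{j\in S_d}q_{ij}(x)f(x,j).$$ Let $D\subseteq C(S)$ be a set of functions, twice differentiable in $x$, for which $\mathcal Lf$ is well defined, Borel and satisfies $\int_0^t|\mathcal Lf(X_s(\omega))|ds<\infty$ for all $t\ge 0$, $\omega\in\Omega_S$, and suppose that $D$ contains all functions $f(x)$, $f(x)g(i)$, $g(i)$ with $g\in C$ and $f\in C_b^2(\mathbb R^d)$ (twice continuously differentiable, bounded with bounded first and second derivatives). Let $\Sigma$ be the set of $(\omega^1,\omega^2)\in\Omega_S$ with $\omega^1\colon\mathbb R_+\to\mathbb R^d$ continuous, and for every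 $x\in S$ let $P_x$ be a solution to the MP $(D,\mathcal L,\Sigma,x)$. **Condition 1.** There are locally Hölder continuous functions $a_d\colon[\frac12,\infty)\to(0,\infty)$ and $b_d\colon[\frac12,\infty)\to\mathbb R$ such that for all $i\in S_d$ and $\|x\|\ge1$ $$\langle x,a(x,i)x\rangle\le a_d\big(\tfrac{\|x\|^2}2\big),\qquad \operatorname{trace}a(x,i)+2\langle x,b(x,i)\rangle\ge b_d\big(\tfrac{\|x\|^2}2\big)\langle x,a(x,i)x\rangle,$$ and, with $p(r)=\int_1^r\exp\big(-\int_1^yb_d(z)dz\big)dy$, either $\lim_{r\to\infty}p(r)<\infty$, or $\lim_{r\to\infty}p(r)=\infty$ and $\int_1^\infty p'(y)\int_y^\infty\frac{dz}{a_d(z)p'(z)}\,dy=\infty$. Furthermore, $\sup_{j}\sup_{\|x\|\le1}\big(\|b(x,j)\|+\operatorname{trace}a(x,j)\big)<\infty$. **Condition 2.** There is a constant $\beta>0$ with $\|b(x,i)\|\le\beta(1+\|x\|)$ and $\operatorname{trace}a(x,i)\le\beta(1+\|x\|^2)$ for all $(x,i)\in S$. **Proposition.** If the family $(P_x)_{x\in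 S}$ is $C_b$-Feller and Condition 1 or Condition 2 holds, then $(P_x)_{x\in S}$ is Feller-Dynkin. -/

import Mathlib

open MeasureTheory ProbabilityTheory Filter Topology
open scoped NNReal ENNReal BoundedContinuousFunction ZeroAtInfty

noncomputable section

namespace SwitchingDiffusion

/-! ### Càdlàg paths, the coordinate process and its filtration -/

/-- A path `ℝ₊ → S` is càdlàg: right-continuous with left limits in `S`. -/
def IsCadlag {S : Type*} [TopologicalSpace S] (ω : ℝ≥0 → S) : Prop :=
  ∀ t : ℝ≥0, ContinuousWithinAt ω (Set.Ici t) t ∧ ∃ l : S, Tendsto ω (𝓝[<] t) (𝓝 l)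

/-- The space `Ω` of all càdlàg paths `ℝ₊ → S`. -/
def Path (S : Type*) [TopologicalSpace S] : Type _ :=
  {ω : ℝ≥0 → S // IsCadlag ω}

/-- The coordinate process `X_t(ω) = ω(t)`. -/
def coord {S : Type*} [TopologicalSpace S] (t : ℝ≥0) (ω : Path S) : S := ω.1 t

/-- The `σ`-field `σ(X_t, t ≥ 0)` on the path space. -/
instance instMeasurableSpacePath (S : Type*) [TopologicalSpace S] [mS : MeasurableSpace S] :
    MeasurableSpace (Path S) :=
  ⨆ t : ℝ≥0, MeasurableSpace.comap (coord t) mS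

/-- The filtration `σ(X_s, s ≤ t)`, `t ≥ 0`. -/
def rawFiltration (S : Type*) [TopologicalSpace S] [mS : MeasurableSpace S] :
    Filtration ℝ≥0 (instMeasurableSpacePath S) where
  seq t := ⨆ s : ℝ≥0, ⨆ _ : s ≤ t, MeasurableSpace.comap (coord s) mS
  mono' _ _ h := iSup_mono fun _ => iSup_mono' fun hs => ⟨hs.trans h, le_rfl⟩
  le' _ := iSup_le fun s => iSup_le fun _ =>
    le_iSup (fun s : ℝ≥0 => MeasurableSpace.comap (coord (S := S) s) mS) s

/-- The right-continuous filtration `𝓕_t = ⋂_{s > t} σ(X_r, r ≤ s)`. -/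
def pathFiltration (S : Type*) [TopologicalSpace S] [MeasurableSpace S] :
    Filtration ℝ≥0 (instMeasurableSpacePath S) :=
  (rawFiltration S).rightCont

theorem pathFiltration_apply (S : Type*) [TopologicalSpace S] [MeasurableSpace S] (t : ℝ≥0) :
    (pathFiltration S) t = ⨅ s > t, (rawFiltration S) s :=
  Filtration.rightCont_eq _ t

theorem IsCadlag.shift {S : Type*} [TopologicalSpace S] {ω : ℝ≥0 → S} (h : IsCadlag ω)
    (t : ℝ≥0) : IsCadlag fun s => ω (t + s) := by
  intro s
  have hc : Tendsto (fun r : ℝ≥0 => t + r) (𝓝 s) (𝓝 (t + s)) :=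
    (continuous_const.add continuous_id).tendsto s
  refine ⟨?_, ?_⟩
  · refine Tendsto.comp (h (t + s)).1 (tendsto_nhdsWithin_iff.2
      ⟨hc.mono_left nhdsWithin_le_nhds, ?_⟩)
    filter_upwards [self_mem_nhdsWithin] with r hr
    exact add_le_add_right (Set.mem_Ici.1 hr) t
  · obtain ⟨l, hl⟩ := (h (t + s)).2
    refine ⟨l, hl.comp (tendsto_nhdsWithin_iff.2 ⟨hc.mono_left nhdsWithin_le_nhds, ?_⟩)⟩
    filter_upwards [self_mem_nhdsWithin] with r hr
    exact add_lt_add_right (Set.mem_Iio.1 hr) t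

/-- The shift operator `(θ_t ω)(s) = ω(t + s)`. -/
def shift {S : Type*} [TopologicalSpace S] (t : ℝ≥0) (ω : Path S) : Path S :=
  ⟨fun s => ω.1 (t + s), ω.2.shift t⟩

/-! ### Martingale problems -/

/-- The process `f(X_t) - f(X_0) - ∫₀ᵗ 𝓛 f(X_s) ds`. -/
def mpProcess {S : Type*} [TopologicalSpace S] (L : (S → ℝ) → S → ℝ) (f : S → ℝ)
    (t : ℝ≥0) (ω : Path S) : ℝ :=
  f (coord t ω) - f (coord 0 ω) - ∫ s in (0 : ℝ)..t, L f (coord s.toNNReal ω)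

/-- `(D, 𝓛)` is admissible as input of a martingale problem on `S`: `D ⊆ C(S)`, the operator `𝓛`
maps `D` into the Borel functions, and `∫₀ᵗ |𝓛 f(X_s(ω))| ds < ∞` for all `t`, `ω` and `f ∈ D`.
(Only the values of `L` on `D` matter.) -/
structure IsInputData {S : Type*} [TopologicalSpace S] [MeasurableSpace S]
    (D : Set (S → ℝ)) (L : (S → ℝ) → S → ℝ) : Prop where
  continuous : ∀ f ∈ D, Continuous f
  measurable : ∀ f ∈ D, Measurable (L f)
  integrable : ∀ f ∈ D, ∀ (t : ℝ≥0) (ω : Path S),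
    IntervalIntegrable (fun s : ℝ => L f (coord s.toNNReal ω)) volume 0 t

/-- `P` solves the martingale problem `(D, 𝓛, Σ, η)`. -/
structure IsSolution {S : Type*} [TopologicalSpace S] [MeasurableSpace S]
    (D : Set (S → ℝ)) (L : (S → ℝ) → S → ℝ) (Sig : Set (Path S)) (η : Measure S)
    (P : Measure (Path S)) : Prop where
  isProbabilityMeasure : IsProbabilityMeasure P
  ae_mem : ∀ᵐ ω ∂P, ω ∈ Sig
  initial : P.map (coord 0) = η
  localMartingale : ∀ f ∈ D,
    Locally (fun M : ℝ≥0 → Path S → ℝ => Martingale M (pathFiltration S) P)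
      (pathFiltration S) (mpProcess L f) P

/-! ### Markov, `C_b`-Feller and Feller-Dynkin families -/

/-- `(P_x)` is a Markov family. -/
structure IsMarkov {S : Type*} [TopologicalSpace S] [MeasurableSpace S]
    (P : S → Measure (Path S)) : Prop where
  measurable : ∀ A : Set (Path S), MeasurableSet A → Measurable fun x => P x A
  markov : ∀ (x : S) (t : ℝ≥0) (G : Set (Path S)), MeasurableSet G →
    (P x)[(shift t ⁻¹' G).indicator (fun _ => (1 : ℝ)) | (pathFiltration S) t]
      =ᵐ[P x] fun ω => (P (coord t ω)).real G

/-- The semigroup `T_t f(x) = E_x[f(X_t)]`. -/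
def semigroup {S : Type*} [TopologicalSpace S] [MeasurableSpace S]
    (P : S → Measure (Path S)) (t : ℝ≥0) (f : S → ℝ) (x : S) : ℝ :=
  ∫ ω, f (coord t ω) ∂(P x)

/-- `(P_x)` is a `C_b`-Feller family: it is Markov and `T_t (C_b(S)) ⊆ C_b(S)`. -/
structure IsCbFeller {S : Type*} [TopologicalSpace S] [MeasurableSpace S]
    (P : S → Measure (Path S)) : Prop where
  isMarkov : IsMarkov P
  map_Cb : ∀ (t : ℝ≥0) (f : S →ᵇ ℝ), ∃ g : S →ᵇ ℝ, ∀ x, g x = semigroup P t f x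

/-- `(P_x)` is a Feller-Dynkin family: it is `C_b`-Feller and `T_t (C_0(S)) ⊆ C_0(S)`. -/
structure IsFellerDynkin {S : Type*} [TopologicalSpace S] [MeasurableSpace S]
    (P : S → Measure (Path S)) : Prop where
  isCbFeller : IsCbFeller P
  map_C0 : ∀ (t : ℝ≥0) (f : C₀(S, ℝ)), ∃ g : C₀(S, ℝ), ∀ x, g x = semigroup P t f x

/-! ### `Q`-matrices -/

open scoped Classical in
/-- `q` is a conservative `Q`-matrix: `q_{ij} ≥ 0` for `i ≠ j` and
`-q_{ii} = ∑_{j ≠ i} q_{ij} < ∞`. -/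
structure IsConservativeQMatrix {I : Type*} (q : I → I → ℝ) : Prop where
  nonneg : ∀ i j, i ≠ j → 0 ≤ q i j
  hasSum : ∀ i, HasSum (fun j => if j = i then 0 else q i j) (-q i i)

/-- `(q f)(i) = ∑_j q_{ij} f(j)`. -/
def matrixOp {I : Type*} (q : I → I → ℝ) (f : I → ℝ) (i : I) : ℝ :=
  ∑' j, q i j * f j

/-- `C = {f ∈ C_0(I) : q f ∈ C_0(I)}`. -/
def chainDomain {I : Type*} [TopologicalSpace I] (q : I → I → ℝ) : Set (I → ℝ) :=
  {f | (∃ u : C₀(I, ℝ), ⇑u = f) ∧ ∃ v : C₀(I, ℝ), ⇑v = matrixOp q f}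

open scoped Classical in
/-- The matrix `Q̄`: `q̄_{ij} = sup_x q_{ij}(x)` for `i ≠ j` and `q̄_{ii} = -∑_{k ≠ i} q̄_{ik}`. -/
def qbar {E I : Type*} (Q : E → I → I → ℝ) (i j : I) : ℝ :=
  if i = j then -∑' k, (if k = i then 0 else ⨆ x, Q x i k) else ⨆ x, Q x i j

open scoped Classical in
/-- `|q̄_{ii}| < ∞` for all `i` (that is, the suprema `sup_x q_{ij}(x)`, `j ≠ i`, are finite and
summable over `j`), and `sup_j sup_x |q_{jj}(x) - q̄_{jj}| < ∞`. -/
structure IsDominated {E I : Type*} (Q : E → I → I → ℝ) : Prop where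
  bddAbove : ∀ i j, i ≠ j → BddAbove (Set.range fun x => Q x i j)
  summable : ∀ i, Summable fun k => if k = i then 0 else ⨆ x, Q x i k
  diag : ∃ M : ℝ, ∀ j x, |Q x j j - qbar Q j j| ≤ M

/-- For every `i` the martingale problem `(C, Q̄, all càdlàg paths, i)` on the discrete state space
has a unique solution `P_i`, and the family `(P_i)` is Feller-Dynkin. -/
def HasUniqueFellerDynkinChain {I : Type*} [TopologicalSpace I] [MeasurableSpace I]
    (q : I → I → ℝ) : Prop :=
  ∃ Pd : I → Measure (Path I),
    (∀ i, IsSolution (chainDomain q) (matrixOp q) Set.univ (Measure.dirac i) (Pd i) ∧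
      ∀ P', IsSolution (chainDomain q) (matrixOp q) Set.univ (Measure.dirac i) P' → P' = Pd i) ∧
    IsFellerDynkin Pd

/-! ### Switching diffusions -/

/-- The state space `ℝ^d × S_d`. -/
abbrev State (d : ℕ) (Sd : Type*) : Type _ := EuclideanSpace ℝ (Fin d) × Sd

/-- Standing hypotheses on the coefficients: `b` and `a` are Borel and locally bounded, `a` takes
values in the symmetric non-negative definite matrices, `x ↦ Q(x)` is Borel, and every `Q(x)` is a
conservative `Q`-matrix. -/
structure IsCoefficients {d : ℕ} {Sd : Type*} [TopologicalSpace Sd] [MeasurableSpace Sd]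
    (b : State d Sd → EuclideanSpace ℝ (Fin d)) (a : State d Sd → Matrix (Fin d) (Fin d) ℝ)
    (Q : EuclideanSpace ℝ (Fin d) → Sd → Sd → ℝ) : Prop where
  measurable_b : Measurable b
  locallyBounded_b : ∀ K : Set (State d Sd), IsCompact K → ∃ M : ℝ, ∀ z ∈ K, ‖b z‖ ≤ M
  posSemidef_a : ∀ z, (a z).PosSemidef
  measurable_a : ∀ k l, Measurable fun z => a z k l
  locallyBounded_a : ∀ K : Set (State d Sd), IsCompact K →
    ∃ M : ℝ, ∀ z ∈ K, ∀ k l, |a z k l| ≤ M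
  isQMatrix : ∀ x, IsConservativeQMatrix (Q x)
  measurable_Q : ∀ i j, Measurable fun x => Q x i j

/-- The Hessian matrix `∇² f(x)`. -/
def hessian {d : ℕ} (f : EuclideanSpace ℝ (Fin d) → ℝ) (x : EuclideanSpace ℝ (Fin d)) :
    Matrix (Fin d) (Fin d) ℝ :=
  Matrix.of fun k l =>
    fderiv ℝ (fderiv ℝ f) x (EuclideanSpace.single k 1) (EuclideanSpace.single l 1)

/-- `𝓚 f(x,i) = ⟨∇_x f(x,i), b(x,i)⟩ + ½ trace(∇²_x f(x,i) a(x,i))`. -/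
def diffusionOp {d : ℕ} {Sd : Type*} (b : State d Sd → EuclideanSpace ℝ (Fin d))
    (a : State d Sd → Matrix (Fin d) (Fin d) ℝ) (f : State d Sd → ℝ) (z : State d Sd) : ℝ :=
  inner ℝ (gradient (fun x => f (x, z.2)) z.1) (b z)
    + 1 / 2 * (hessian (fun x => f (x, z.2)) z.1 * a z).trace

/-- `𝓛 f(x,i) = 𝓚 f(x,i) + ∑_j q_{ij}(x) f(x,j)`. -/
def switchingOp {d : ℕ} {Sd : Type*} (b : State d Sd → EuclideanSpace ℝ (Fin d))
    (a : State d Sd → Matrix (Fin d) (Fin d) ℝ) (Q : EuclideanSpace ℝ (Fin d) → Sd → Sd → ℝ)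
    (f : State d Sd → ℝ) (z : State d Sd) : ℝ :=
  diffusionOp b a f z + ∑' j, Q z.1 z.2 j * f (z.1, j)

/-- `C_b^2(ℝ^d)`: twice continuously differentiable functions which are bounded together with
their derivatives of first and second order. -/
def Cb2 (d : ℕ) : Set (EuclideanSpace ℝ (Fin d) → ℝ) :=
  {f | ContDiff ℝ 2 f ∧ ∃ M : ℝ, ∀ x,
    |f x| ≤ M ∧ ‖fderiv ℝ f x‖ ≤ M ∧ ‖fderiv ℝ (fderiv ℝ f) x‖ ≤ M}

/-- `D` is a set of test functions for the switching diffusion: it contains all `f`, `f g`, `g` with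
`f ∈ C_b^2(ℝ^d)` and `g ∈ C`, it is admissible for `𝓛`, and the derivatives and the series in
the definition of `𝓛 f` exist for all `f ∈ D`. -/
structure IsTestSet {d : ℕ} {Sd : Type*} [TopologicalSpace Sd] [MeasurableSpace Sd]
    (b : State d Sd → EuclideanSpace ℝ (Fin d)) (a : State d Sd → Matrix (Fin d) (Fin d) ℝ)
    (Q : EuclideanSpace ℝ (Fin d) → Sd → Sd → ℝ) (D : Set (State d Sd → ℝ)) : Prop where
  isInputData : IsInputData D (switchingOp b a Q)
  differentiable : ∀ f ∈ D, ∀ i, Differentiable ℝ (fun x => f (x, i)) ∧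
    Differentiable ℝ (fderiv ℝ fun x => f (x, i))
  summable : ∀ f ∈ D, ∀ x i, Summable fun j => Q x i j * f (x, j)
  left_mem : ∀ f ∈ Cb2 d, (fun z : State d Sd => f z.1) ∈ D
  right_mem : ∀ g ∈ chainDomain (qbar Q), (fun z : State d Sd => g z.2) ∈ D
  mul_mem : ∀ f ∈ Cb2 d, ∀ g ∈ chainDomain (qbar Q), (fun z : State d Sd => f z.1 * g z.2) ∈ D

/-- The paths in `ℝ^d × S_d` whose first component is continuous. -/
def continuousFst (d : ℕ) (Sd : Type*) [TopologicalSpace Sd] : Set (Path (State d Sd)) :=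
  {ω | Continuous fun t => (coord t ω).1}

/-! ### The two growth conditions -/

/-- `f` is locally Hölder continuous on `s`. -/
def LocallyHolderOn (f : ℝ → ℝ) (s : Set ℝ) : Prop :=
  ∀ x ∈ s, ∃ U ∈ 𝓝[s] x, ∃ C r : ℝ≥0, 0 < r ∧ r ≤ 1 ∧ HolderOnWith C r f U

/-- `p'(y) = exp(-∫₁^y b_d(z) dz)`. -/
def scaleDensity (bd : ℝ → ℝ) (y : ℝ) : ℝ := Real.exp (-∫ z in (1 : ℝ)..y, bd z)

/-- `p(r) = ∫₁^r exp(-∫₁^y b_d(z) dz) dy`. -/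
def scale (bd : ℝ → ℝ) (r : ℝ) : ℝ := ∫ y in (1 : ℝ)..r, scaleDensity bd y

/-- The radial integral test. -/
def RadialCondition {d : ℕ} {Sd : Type*} (b : State d Sd → EuclideanSpace ℝ (Fin d))
    (a : State d Sd → Matrix (Fin d) (Fin d) ℝ) : Prop :=
  (∃ ad bd : ℝ → ℝ,
    LocallyHolderOn ad (Set.Ici (1 / 2)) ∧ LocallyHolderOn bd (Set.Ici (1 / 2)) ∧
    (∀ r ∈ Set.Ici (1 / 2 : ℝ), 0 < ad r) ∧
    (∀ (x : EuclideanSpace ℝ (Fin d)) (i : Sd), 1 ≤ ‖x‖ →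
      x.ofLp ⬝ᵥ (a (x, i)).mulVec x.ofLp ≤ ad (‖x‖ ^ 2 / 2) ∧
      bd (‖x‖ ^ 2 / 2) * (x.ofLp ⬝ᵥ (a (x, i)).mulVec x.ofLp)
        ≤ (a (x, i)).trace + 2 * inner ℝ x (b (x, i))) ∧
    ((∃ l : ℝ, Tendsto (scale bd) atTop (𝓝 l)) ∨
      (Tendsto (scale bd) atTop atTop ∧
        ∫⁻ y in Set.Ioi (1 : ℝ), ENNReal.ofReal (scaleDensity bd y) *
          ∫⁻ z in Set.Ioi y, ENNReal.ofReal (1 / (ad z * scaleDensity bd z)) = ⊤))) ∧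
  ∃ M : ℝ, ∀ (x : EuclideanSpace ℝ (Fin d)) (j : Sd), ‖x‖ ≤ 1 →
    ‖b (x, j)‖ + (a (x, j)).trace ≤ M

/-- The linear growth condition. -/
def LinearGrowthCondition {d : ℕ} {Sd : Type*} (b : State d Sd → EuclideanSpace ℝ (Fin d))
    (a : State d Sd → Matrix (Fin d) (Fin d) ℝ) : Prop :=
  ∃ β : ℝ, 0 < β ∧ ∀ (x : EuclideanSpace ℝ (Fin d)) (i : Sd),
    ‖b (x, i)‖ ≤ β * (1 + ‖x‖) ∧ (a (x, i)).trace ≤ β * (1 + ‖x‖ ^ 2)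

end SwitchingDiffusion

end

/-! Since the family is `C_b`-Feller, only one thing is at stake: for f in C_0, the function T_t f
must vanish at infinity. This follows from Lyapunov functions. Let g ≥ 0 be bounded and continuous,
positive on the compact set outside which |f| < ε/2, with E_z[g(X_t)] ≤ C g(z). Then |f| ≤ ε/2 +
const * g, so |T_t f(z)| ≤ ε/2 + const * C * g(z), which is below ε wherever g is small
(`tendsto_semigroup`). A point of ℝ^d × S_d goes to infinity through its first or its second
coordinate, and each direction has its own g.

First coordinate: g(x,i) = φ(‖x‖²/2) with φ positive, decreasing to 0, and 𝓚g ≤ c g. Under linear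
growth φ(r) = 1/(1+r) works. Under the radial condition it suffices, for ‖x‖ ≥ 1, that φ'' + b_d φ'
≤ φ/a_d. If p has a finite limit l, take φ = l - p. Otherwise build an increasing u with u'' + b_d
u' ≤ u/a_d and take φ(r) = u(r) ∫_r^∞ p'/u². The divergent double integral is what makes this φ
vanish at infinity (`exists_isRadialProfile_of_tendsto_speedFrom`).

Second coordinate: g is the 1-resolvent of the dominating chain applied to the indicator h of a
finite set. It lies in C_0 because the chain is Feller-Dynkin, and Q̄g = g - h ≤ g. The latter
identity is the delicate point, since only well-posedness of the martingale problem is given. The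
law "wait in i for an exponential time, jump, then run the chain from there" also solves the
martingale problem started in i, hence equals P_i by uniqueness, and the resolvent equation can be
read off (`matrixOp_resolvent`). Off the diagonal Q(x) ≤ Q̄, and the diagonals differ by a bounded
amount, so 𝓛g ≤ (1 + |M|) g.

To pass from 𝓛g ≤ c g to E_z[g(X_t)] ≤ g(z) e^{ct}, the function is replaced by test functions
agreeing with it on large closed sets U. The process is observed on a time grid until it is first
seen outside U, the mesh is sent to 0, then U exhausts the space, and Grönwall concludes
(`integral_le_exp_mul`). Grid times make hitting times unnecessary. -/

noncomputable section

namespace SwitchingDiffusion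

/-! ### Measurability on path space; stopping and concatenating paths. -/

section PathSpace

variable {S : Type*} [TopologicalSpace S]

theorem IsCadlag.comp_min {ω : ℝ≥0 → S} (h : IsCadlag ω) (t : ℝ≥0) :
    IsCadlag fun s => ω (min s t) := by
  intro s
  have hc : Tendsto (fun r : ℝ≥0 => min r t) (𝓝 s) (𝓝 (min s t)) :=
    (continuous_id.min continuous_const).tendsto s
  refine ⟨?_, ?_⟩
  · refine Tendsto.comp (h (min s t)).1 (tendsto_nhdsWithin_iff.2
      ⟨hc.mono_left nhdsWithin_le_nhds, ?_⟩)
    filter_upwards [self_mem_nhdsWithin] with r hr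
    exact min_le_min_right t hr
  · rcases le_or_gt s t with hs | hs
    · obtain ⟨l, hl⟩ := (h s).2
      refine ⟨l, hl.congr' ?_⟩
      filter_upwards [self_mem_nhdsWithin] with r hr
      rw [min_eq_left ((le_of_lt hr).trans hs)]
    · refine ⟨ω t, tendsto_const_nhds.congr' ?_⟩
      filter_upwards [nhdsWithin_le_nhds (Ioi_mem_nhds hs)] with r hr
      rw [min_eq_right (le_of_lt hr)]

theorem IsCadlag.concat {ω : ℝ≥0 → S} (h : IsCadlag ω) (i : S) (τ : ℝ≥0) :
    IsCadlag fun s => if s < τ then i else ω (s - τ) := by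
  intro s
  have hc : Tendsto (fun r : ℝ≥0 => r - τ) (𝓝 s) (𝓝 (s - τ)) :=
    (continuous_id.sub continuous_const).tendsto s
  refine ⟨?_, ?_⟩
  · rw [ContinuousWithinAt]
    rcases lt_or_ge s τ with hs | hs
    · rw [if_pos hs]
      refine Tendsto.congr' ?_ (tendsto_const_nhds (x := i))
      filter_upwards [nhdsWithin_le_nhds (Iio_mem_nhds hs)] with r hr
      rw [if_pos (Set.mem_Iio.1 hr)]
    · rw [if_neg hs.not_gt]
      have h1 : Tendsto (fun r : ℝ≥0 => r - τ) (𝓝[Set.Ici s] s) (𝓝[Set.Ici (s - τ)] (s - τ)) := by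
        refine tendsto_nhdsWithin_iff.2 ⟨hc.mono_left nhdsWithin_le_nhds, ?_⟩
        filter_upwards [self_mem_nhdsWithin] with r hr
        exact tsub_le_tsub_right (Set.mem_Ici.1 hr) τ
      refine Tendsto.congr' ?_ (Tendsto.comp (h (s - τ)).1 h1)
      filter_upwards [self_mem_nhdsWithin] with r hr
      rw [if_neg (hs.trans hr).not_gt]
      rfl
  · rcases le_or_gt s τ with hs | hs
    · refine ⟨i, tendsto_const_nhds.congr' ?_⟩
      filter_upwards [self_mem_nhdsWithin] with r hr
      rw [if_pos (lt_of_lt_of_le (Set.mem_Iio.1 hr) hs)]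
    · obtain ⟨l, hl⟩ := (h (s - τ)).2
      have h1 : Tendsto (fun r : ℝ≥0 => r - τ) (𝓝[<] s) (𝓝[<] (s - τ)) := by
        refine tendsto_nhdsWithin_iff.2 ⟨hc.mono_left nhdsWithin_le_nhds, ?_⟩
        filter_upwards [self_mem_nhdsWithin, nhdsWithin_le_nhds (Ioi_mem_nhds hs)] with r hr hr'
        exact tsub_lt_tsub_right_of_le (le_of_lt (Set.mem_Ioi.1 hr')) (Set.mem_Iio.1 hr)
      refine ⟨l, (hl.comp h1).congr' ?_⟩
      filter_upwards [nhdsWithin_le_nhds (Ioi_mem_nhds hs)] with r hr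
      rw [if_neg (not_lt.2 (le_of_lt (Set.mem_Ioi.1 hr)))]
      rfl

/-- The path `ω` frozen at time `t`. -/
def stopPath (t : ℝ≥0) (ω : Path S) : Path S := ⟨fun s => ω.1 (min s t), ω.2.comp_min t⟩

/-- The path which stays in `i` up to time `τ` and then follows `η`. -/
def concatPath (i : S) (τ : ℝ≥0) (η : Path S) : Path S :=
  ⟨fun s => if s < τ then i else η.1 (s - τ), η.2.concat i τ⟩

theorem coord_stopPath (s t : ℝ≥0) (ω : Path S) :
    coord s (stopPath t ω) = coord (min s t) ω := rfl

theorem coord_concatPath_of_lt {s τ : ℝ≥0} (h : s < τ) (i : S) (η : Path S) :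
    coord s (concatPath i τ η) = i := if_pos h

theorem coord_concatPath_of_le {s τ : ℝ≥0} (h : τ ≤ s) (i : S) (η : Path S) :
    coord s (concatPath i τ η) = coord (s - τ) η := if_neg h.not_gt

theorem Path.ext_coord {ω η : Path S} (h : ∀ t, coord t ω = coord t η) : ω = η :=
  Subtype.ext (funext h)

/-- Approximation of the time `s` from the right by a point of the grid of mesh `1 / (n + 1)`. -/
def gridAbove (n : ℕ) (s : ℝ≥0) : ℝ≥0 := (⌊s * (n + 1)⌋₊ + 1) / (n + 1)

theorem le_gridAbove (n : ℕ) (s : ℝ≥0) : s ≤ gridAbove n s := by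
  have h : (0 : ℝ≥0) < n + 1 := by positivity
  rw [gridAbove, le_div_iff₀ h]
  exact (Nat.lt_floor_add_one _).le

theorem gridAbove_le (n : ℕ) (s : ℝ≥0) : gridAbove n s ≤ s + 1 / (n + 1) := by
  have h : (0 : ℝ≥0) < n + 1 := by positivity
  rw [gridAbove, add_div]
  gcongr
  rw [div_le_iff₀ h]
  exact Nat.floor_le (by positivity)

theorem tendsto_gridAbove (s : ℝ≥0) :
    Tendsto (fun n => gridAbove n s) atTop (𝓝[≥] s) := by
  refine tendsto_nhdsWithin_iff.2 ⟨?_, Eventually.of_forall fun n => le_gridAbove n s⟩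
  refine tendsto_of_tendsto_of_tendsto_of_le_of_le tendsto_const_nhds ?_
    (fun n => le_gridAbove n s) (fun n => gridAbove_le n s)
  have : Tendsto (fun n : ℕ => 1 / ((n : ℝ≥0) + 1)) atTop (𝓝 0) :=
    tendsto_one_div_add_atTop_nhds_zero_nat
  simpa using tendsto_const_nhds.add this

theorem tendsto_coord_gridAbove (s : ℝ≥0) (ω : Path S) :
    Tendsto (fun n => coord (gridAbove n s) ω) atTop (𝓝 (coord s ω)) :=
  Tendsto.comp (ω.2 s).1 (tendsto_gridAbove s)

variable [MeasurableSpace S]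

theorem measurable_coord (t : ℝ≥0) : Measurable (coord (S := S) t) :=
  measurable_iff_comap_le.2 (le_iSup (fun t : ℝ≥0 => MeasurableSpace.comap (coord (S := S) t) _) t)

theorem measurable_path {α : Type*} {mα : MeasurableSpace α} {F : α → Path S}
    (h : ∀ t, Measurable fun a => coord t (F a)) : Measurable F := by
  refine measurable_iff_comap_le.2 ?_
  rw [instMeasurableSpacePath, MeasurableSpace.comap_iSup]
  refine iSup_le fun t => ?_
  rw [MeasurableSpace.comap_comp]
  exact measurable_iff_comap_le.1 (h t)

theorem measurable_coord_rawFiltration {s t : ℝ≥0} (h : s ≤ t) :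
    Measurable[rawFiltration S t] (coord (S := S) s) :=
  measurable_iff_comap_le.2
    (le_iSup₂ (f := fun (s : ℝ≥0) (_ : s ≤ t) => MeasurableSpace.comap (coord (S := S) s) _) s h)

/-- An event known at time t is a condition on the path frozen at t. In this form events can be
pulled back through concatenation. -/
theorem rawFiltration_eq_comap (t : ℝ≥0) :
    (rawFiltration S) t = MeasurableSpace.comap (stopPath t) inferInstance := by
  refine le_antisymm (iSup₂_le fun s hs => ?_) ?_
  · have : coord (S := S) s = coord s ∘ stopPath t := by
      ext ω; simp [coord_stopPath, hs]
    rw [this, ← MeasurableSpace.comap_comp]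
    exact MeasurableSpace.comap_mono (measurable_iff_comap_le.1 (measurable_coord s))
  · refine measurable_iff_comap_le.1 ?_
    exact measurable_path (mα := rawFiltration S t)
      fun s => measurable_coord_rawFiltration (min_le_right s t)

theorem measurable_stopPath_rawFiltration (t : ℝ≥0) :
    Measurable[rawFiltration S t] (stopPath (S := S) t) := by
  rw [rawFiltration_eq_comap]
  exact comap_measurable _

theorem rawFiltration_le_pathFiltration (t : ℝ≥0) : (rawFiltration S) t ≤ (pathFiltration S) t :=
  (rawFiltration S).le_rightCont t

theorem pathFiltration_le_rawFiltration {s t : ℝ≥0} (h : s < t) :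
    (pathFiltration S) s ≤ (rawFiltration S) t := by
  rw [pathFiltration_apply]
  exact iInf₂_le t h

variable [TopologicalSpace.PseudoMetrizableSpace S] [BorelSpace S]

/-- By right-continuity the evaluation is the limit of its values at grid times above s, and those
involve only countably many coordinates for each mesh. -/
theorem measurable_coord_uncurry :
    Measurable fun p : ℝ≥0 × Path S => coord p.1 p.2 := by
  have hlim : Tendsto (fun (n : ℕ) (p : ℝ≥0 × Path S) => coord (gridAbove n p.1) p.2) atTop
      (𝓝 fun p : ℝ≥0 × Path S => coord p.1 p.2) := by
    rw [tendsto_pi_nhds]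
    intro p
    exact tendsto_coord_gridAbove p.1 p.2
  refine measurable_of_tendsto_metrizable (fun n => ?_) hlim
  have h1 : Measurable fun p : ℕ × Path S => coord (((p.1 : ℝ≥0) + 1) / (n + 1)) p.2 :=
    measurable_from_prod_countable_right fun k =>
      measurable_coord (((k : ℝ≥0) + 1) / (n + 1))
  have h2 : Measurable fun p : ℝ≥0 × Path S => (⌊p.1 * (n + 1)⌋₊, p.2) :=
    (Nat.measurable_floor.comp (measurable_fst.mul_const _)).prodMk measurable_snd
  exact h1.comp h2

theorem measurable_concatPath (i : S) :
    Measurable fun p : ℝ≥0 × Path S => concatPath i p.1 p.2 := by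
  refine measurable_path fun t => ?_
  have : (fun p : ℝ≥0 × Path S => coord t (concatPath i p.1 p.2)) =
      fun p => if t < p.1 then i else coord (t - p.1) p.2 := rfl
  rw [this]
  refine Measurable.ite (measurableSet_lt measurable_const measurable_fst) measurable_const ?_
  exact measurable_coord_uncurry.comp
    ((measurable_const.sub measurable_fst).prodMk measurable_snd)

theorem measurable_coord_toNNReal :
    Measurable fun p : ℝ × Path S => coord p.1.toNNReal p.2 :=
  measurable_coord_uncurry.comp
    ((measurable_real_toNNReal.comp measurable_fst).prodMk measurable_snd)

theorem measurable_coord_toNNReal_swap :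
    Measurable fun p : Path S × ℝ => coord p.2.toNNReal p.1 :=
  measurable_coord_toNNReal.comp measurable_swap

end PathSpace

/-! ### From local martingales to martingales for bounded test functions. -/

section MartingaleProblem

variable {S : Type*} [TopologicalSpace S]

theorem mpProcess_zero (L : (S → ℝ) → S → ℝ) (f : S → ℝ) (ω : Path S) :
    mpProcess L f 0 ω = 0 := by
  simp [mpProcess]

theorem mpProcess_stopPath (L : (S → ℝ) → S → ℝ) (f : S → ℝ) (t : ℝ≥0) (ω : Path S) :
    mpProcess L f t (stopPath t ω) = mpProcess L f t ω := by
  unfold mpProcess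
  rw [coord_stopPath, coord_stopPath, min_self, min_eq_left zero_le]
  congr 1
  refine intervalIntegral.integral_congr fun s hs => ?_
  rw [Set.uIcc_of_le t.coe_nonneg] at hs
  have : s.toNNReal ≤ t := Real.toNNReal_le_iff_le_coe.2 hs.2
  simp only [coord_stopPath, min_eq_left this]

/-- Stopping only changes the time at which the process is read. The indicator of `⊥ < τ` is
harmless because the process is 0 at time 0. -/
theorem exists_stoppedProcess_mp (L : (S → ℝ) → S → ℝ) (f : S → ℝ)
    (τ : Path S → WithTop ℝ≥0) (ω : Path S) :
    ∃ u : ℝ≥0 → ℝ≥0, (∀ t, u t ≤ t) ∧ (∀ t : ℝ≥0, (t : WithTop ℝ≥0) ≤ τ ω → u t = t) ∧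
      u 0 = 0 ∧
      ∀ t, stoppedProcess (fun i => {ω | ⊥ < τ ω}.indicator (mpProcess L f i)) τ t ω =
        mpProcess L f (u t) ω := by
  have key : ∀ t : ℝ≥0, (((min (t : WithTop ℝ≥0) (τ ω)).untopA : ℝ≥0) : WithTop ℝ≥0) =
      min (t : WithTop ℝ≥0) (τ ω) := fun t => by
    obtain ⟨x, hx⟩ := WithTop.ne_top_iff_exists.1
      (ne_top_of_le_ne_top WithTop.coe_ne_top (min_le_left (t : WithTop ℝ≥0) (τ ω)))
    rw [← hx]
    rfl
  refine ⟨fun t => (min (t : WithTop ℝ≥0) (τ ω)).untopA, fun t => ?_, fun t ht => ?_, ?_,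
    fun t => ?_⟩
  · rw [← WithTop.coe_le_coe, key]
    exact min_le_left _ _
  · rw [← WithTop.coe_inj, key]
    exact min_eq_left ht
  · rw [← WithTop.coe_inj, key]
    exact min_eq_left (bot_le (a := τ ω))
  · rw [stoppedProcess]
    by_cases h : ⊥ < τ ω
    · rw [Set.indicator_of_mem (by exact h)]
    · rw [Set.indicator_of_notMem (by exact h)]
      have h0 : τ ω = ⊥ := not_bot_lt_iff.1 h
      have : (min (t : WithTop ℝ≥0) (τ ω)).untopA = 0 := by
        rw [← WithTop.coe_inj, key, h0]
        exact min_eq_right bot_le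
      change (0 : ℝ) = mpProcess L f (min (t : WithTop ℝ≥0) (τ ω)).untopA ω
      rw [this, mpProcess_zero]

variable [MeasurableSpace S] [TopologicalSpace.PseudoMetrizableSpace S] [BorelSpace S]

theorem measurable_integral_coord {G : S → ℝ} (hG : Measurable G) {t : ℝ} (ht : 0 ≤ t) :
    Measurable fun ω : Path S => ∫ s in (0 : ℝ)..t, G (coord s.toNNReal ω) := by
  simp_rw [intervalIntegral.integral_of_le ht]
  have h : StronglyMeasurable fun p : Path S × ℝ => G (coord p.2.toNNReal p.1) :=
    (hG.comp measurable_coord_toNNReal_swap).stronglyMeasurable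
  exact h.integral_prod_right'.measurable

theorem measurable_mp {L : (S → ℝ) → S → ℝ} {f : S → ℝ} (hf : Measurable f)
    (hG : Measurable (L f)) (t : ℝ≥0) : Measurable (mpProcess L f t) :=
  ((hf.comp (measurable_coord t)).sub (hf.comp (measurable_coord 0))).sub
    (measurable_integral_coord hG t.2)

theorem measurable_mpProcess_rawFiltration {L : (S → ℝ) → S → ℝ} {f : S → ℝ} (hf : Measurable f)
    (hG : Measurable (L f)) (t : ℝ≥0) : Measurable[rawFiltration S t] (mpProcess L f t) := by
  have : mpProcess L f t = mpProcess L f t ∘ stopPath t :=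
    funext fun ω => (mpProcess_stopPath L f t ω).symm
  rw [this]
  exact (measurable_mp hf hG t).comp (measurable_stopPath_rawFiltration t)

/-- `f` is continuous, `L f` is measurable, and both are bounded by `K`. -/
structure IsBoundedPair (L : (S → ℝ) → S → ℝ) (f : S → ℝ) (K : ℝ) : Prop where
  continuous : Continuous f
  measurable : Measurable (L f)
  abs_le : ∀ x, |f x| ≤ K
  abs_map_le : ∀ x, |L f x| ≤ K

variable {L : (S → ℝ) → S → ℝ} {f : S → ℝ} {K : ℝ}

theorem IsBoundedPair.measurable_mp (h : IsBoundedPair L f K) (t : ℝ≥0) :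
    Measurable (mpProcess L f t) :=
  SwitchingDiffusion.measurable_mp h.continuous.measurable h.measurable t

theorem measurable_comp_coord {G : S → ℝ} (hG : Measurable G) (ω : Path S) :
    Measurable fun s : ℝ => G (coord s.toNNReal ω) :=
  hG.comp (measurable_coord_toNNReal.comp (measurable_id.prodMk measurable_const))

theorem IsBoundedPair.intervalIntegrable (h : IsBoundedPair L f K) (ω : Path S) (a b : ℝ) :
    IntervalIntegrable (fun s : ℝ => L f (coord s.toNNReal ω)) volume a b := by
  refine (intervalIntegrable_const (c := K)).mono_fun
    (measurable_comp_coord h.measurable ω).aestronglyMeasurable ?_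
  refine Eventually.of_forall fun s => ?_
  exact (h.abs_map_le _).trans (le_abs_self K)

omit [TopologicalSpace.PseudoMetrizableSpace S] [BorelSpace S] in
theorem IsBoundedPair.abs_mpProcess_le (h : IsBoundedPair L f K) (t : ℝ≥0) (ω : Path S) :
    abs (mpProcess L f t ω) ≤ 2 * K + K * t := by
  have h1 := h.abs_le (coord t ω)
  have h2 := h.abs_le (coord 0 ω)
  have h3 : |∫ s in (0 : ℝ)..t, L f (coord s.toNNReal ω)| ≤ K * |(t : ℝ) - 0| :=
    intervalIntegral.norm_integral_le_of_norm_le_const (f := fun s : ℝ => L f (coord s.toNNReal ω))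
      fun s _ => h.abs_map_le _
  rw [sub_zero, abs_of_nonneg t.coe_nonneg] at h3
  unfold mpProcess
  rw [_root_.abs_le] at h1 h2 h3 ⊢
  constructor <;> linarith [h1.1, h1.2, h2.1, h2.2, h3.1, h3.2]

theorem IsBoundedPair.integrable_mp (h : IsBoundedPair L f K) (P : Measure (Path S))
    [IsFiniteMeasure P] (t : ℝ≥0) : Integrable (mpProcess L f t) P :=
  Integrable.of_bound (h.measurable_mp t).aestronglyMeasurable (2 * K + K * t)
    (Eventually.of_forall fun ω => h.abs_mpProcess_le t ω)

theorem IsBoundedPair.tendsto_mp (h : IsBoundedPair L f K) (t : ℝ≥0) (ω : Path S) :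
    Tendsto (fun u => mpProcess L f u ω) (𝓝[≥] t) (𝓝 (mpProcess L f t ω)) := by
  have h1 : Tendsto (fun u => f (coord u ω)) (𝓝[≥] t) (𝓝 (f (coord t ω))) :=
    (h.continuous.tendsto _).comp (ω.2 t).1
  have h2 : Continuous fun u : ℝ≥0 => ∫ s in (0 : ℝ)..u, L f (coord s.toNNReal ω) :=
    (intervalIntegral.continuous_primitive (fun a b => h.intervalIntegrable ω a b) 0).comp
      NNReal.continuous_coe
  exact (h1.sub tendsto_const_nhds).sub ((h2.tendsto t).mono_left nhdsWithin_le_nhds)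

-- On a bounded time interval the process is bounded, so dominated convergence removes the
-- localizing sequence.
omit [TopologicalSpace.PseudoMetrizableSpace S] [BorelSpace S] in
theorem IsBoundedPair.setIntegral_mpProcess_eq (h : IsBoundedPair L f K) {P : Measure (Path S)}
    [IsProbabilityMeasure P]
    (hL : Locally (fun M : ℝ≥0 → Path S → ℝ => Martingale M (pathFiltration S) P)
      (pathFiltration S) (mpProcess L f) P)
    {s t : ℝ≥0} (hst : s ≤ t) {A : Set (Path S)} (hA : MeasurableSet[pathFiltration S s] A) :
    ∫ ω in A, mpProcess L f s ω ∂P = ∫ ω in A, mpProcess L f t ω ∂P := by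
  obtain ⟨τ, hτ, hM⟩ := hL
  have hK : 0 ≤ K := by
    obtain ⟨ω⟩ : Nonempty (Path S) := P.nonempty_of_neZero
    exact (abs_nonneg _).trans (h.abs_le (coord 0 ω))
  have key : ∀ r : ℝ≥0, Tendsto (fun n => ∫ ω in A, stoppedProcess
      (fun i => {ω | ⊥ < τ n ω}.indicator (mpProcess L f i)) (τ n) r ω ∂P) atTop
      (𝓝 (∫ ω in A, mpProcess L f r ω ∂P)) := by
    intro r
    refine tendsto_integral_of_dominated_convergence (fun _ => 2 * K + K * r)
      (fun n => ((hM n).integrable r).1.restrict) (integrable_const _) (fun n => ?_) ?_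
    · refine Eventually.of_forall fun ω => ?_
      obtain ⟨u, hu, -, -, he⟩ := exists_stoppedProcess_mp L f (τ n) ω
      rw [he r]
      refine (h.abs_mpProcess_le _ ω).trans ?_
      have : (u r : ℝ) ≤ r := NNReal.coe_le_coe.2 (hu r)
      gcongr
    · refine ae_restrict_of_ae ?_
      filter_upwards [hτ.tendsto_top] with ω hω
      refine tendsto_const_nhds.congr' ?_
      have : ∀ᶠ n in atTop, (r : WithTop ℝ≥0) < τ n ω :=
        Tendsto.eventually_const_lt (WithTop.coe_lt_top r) hω
      filter_upwards [this] with n hn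
      obtain ⟨u, -, hu, -, he⟩ := exists_stoppedProcess_mp L f (τ n) ω
      rw [he r, hu r hn.le]
  refine tendsto_nhds_unique (key s) ((key t).congr fun n => ?_)
  exact ((hM n).setIntegral_eq hst hA).symm

/-- The martingale identity need only be tested on events of the raw filtration: an event of the
right-continuous filtration at s is a raw event at every u > s, and u can decrease to s by
right-continuity. -/
theorem IsBoundedPair.martingale_mp (h : IsBoundedPair L f K) {P : Measure (Path S)}
    [IsProbabilityMeasure P]
    (hP : ∀ s t : ℝ≥0, s ≤ t → ∀ A, MeasurableSet[rawFiltration S s] A →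
      ∫ ω in A, mpProcess L f s ω ∂P = ∫ ω in A, mpProcess L f t ω ∂P) :
    Martingale (mpProcess L f) (pathFiltration S) P := by
  have hmeas : ∀ t, Measurable[pathFiltration S t] (mpProcess L f t) := fun t =>
    (measurable_mpProcess_rawFiltration h.continuous.measurable h.measurable t).mono
      (rawFiltration_le_pathFiltration t) le_rfl
  refine ⟨fun t => (hmeas t).stronglyMeasurable, fun s t hst => ?_⟩
  refine (ae_eq_condExp_of_forall_setIntegral_eq ((pathFiltration S).le s)
    (h.integrable_mp P t) (fun A _ _ => (h.integrable_mp P s).integrableOn)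
    (fun A hA _ => ?_) (hmeas s).stronglyMeasurable.aestronglyMeasurable).symm
  rcases hst.eq_or_lt with rfl | hlt
  · rfl
  have hK : 0 ≤ K := by
    obtain ⟨ω⟩ : Nonempty (Path S) := P.nonempty_of_neZero
    exact (abs_nonneg _).trans (h.abs_le (coord 0 ω))
  have hu : Tendsto (fun u : ℝ≥0 => ∫ ω in A, mpProcess L f u ω ∂P) (𝓝[>] s)
      (𝓝 (∫ ω in A, mpProcess L f s ω ∂P)) := by
    refine tendsto_integral_filter_of_dominated_convergence (fun _ => 2 * K + K * t)
      (Eventually.of_forall fun u => (h.measurable_mp u).aestronglyMeasurable) ?_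
      (integrable_const _) ?_
    · filter_upwards [nhdsWithin_le_nhds (Iio_mem_nhds hlt)] with u hu
      refine Eventually.of_forall fun ω => (h.abs_mpProcess_le u ω).trans ?_
      have : (u : ℝ) ≤ t := NNReal.coe_le_coe.2 (le_of_lt (Set.mem_Iio.1 hu))
      gcongr
    · exact Eventually.of_forall fun ω =>
        (h.tendsto_mp s ω).mono_left (nhdsWithin_mono _ Set.Ioi_subset_Ici_self)
  refine tendsto_nhds_unique hu (tendsto_const_nhds.congr' ?_)
  filter_upwards [self_mem_nhdsWithin, nhdsWithin_le_nhds (Iio_mem_nhds hlt)] with u hu1 hu2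
  exact (hP u t (le_of_lt (Set.mem_Iio.1 hu2)) A
    (pathFiltration_le_rawFiltration (Set.mem_Ioi.1 hu1) A hA)).symm

end MartingaleProblem

/-! ### The exponential holding time. -/

section HoldingTime

/-- The exponential law with rate `c`. -/
def holdingLaw (c : ℝ) : Measure ℝ :=
  (volume.restrict (Set.Ioi 0)).withDensity fun x => ENNReal.ofReal (c * Real.exp (-(c * x)))

theorem hasDerivAt_exp_neg_mul (c x : ℝ) :
    HasDerivAt (fun x : ℝ => Real.exp (-(c * x))) (-(c * Real.exp (-(c * x)))) x := by
  have h : HasDerivAt (fun x : ℝ => -(c * x)) (-c) x := by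
    simpa using ((hasDerivAt_id x).const_mul c).fun_neg
  convert h.exp using 1
  ring

theorem tendsto_exp_neg_mul {c : ℝ} (hc : 0 < c) :
    Tendsto (fun x : ℝ => Real.exp (-(c * x))) atTop (𝓝 0) :=
  Real.tendsto_exp_neg_atTop_nhds_zero.comp (tendsto_id.const_mul_atTop hc)

theorem integrableOn_mul_exp_neg_mul {c : ℝ} (hc : 0 < c) (a : ℝ) :
    IntegrableOn (fun x : ℝ => c * Real.exp (-(c * x))) (Set.Ioi a) := by
  have := (integrableOn_Ioi_deriv_of_nonpos' (a := a) (l := 0)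
    (fun x _ => hasDerivAt_exp_neg_mul c x)
    (fun x _ => neg_nonpos.2 (mul_nonneg hc.le (Real.exp_pos _).le)) (tendsto_exp_neg_mul hc)).neg
  simpa using this

theorem integral_mul_exp_neg_mul {c : ℝ} (hc : 0 < c) (a : ℝ) :
    ∫ x in Set.Ioi a, c * Real.exp (-(c * x)) = Real.exp (-(c * a)) := by
  have h := integral_Ioi_of_hasDerivAt_of_tendsto' (a := a) (m := 0)
    (fun x _ => hasDerivAt_exp_neg_mul c x) (by simpa using (integrableOn_mul_exp_neg_mul hc a).neg)
    (tendsto_exp_neg_mul hc)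
  rw [integral_neg] at h
  linarith

theorem isProbabilityMeasure_holdingLaw {c : ℝ} (hc : 0 < c) :
    IsProbabilityMeasure (holdingLaw c) := by
  refine ⟨?_⟩
  rw [holdingLaw, withDensity_apply _ MeasurableSet.univ, Measure.restrict_univ,
    ← ofReal_integral_eq_lintegral_ofReal (integrableOn_mul_exp_neg_mul hc 0)
      (Eventually.of_forall fun x => mul_nonneg hc.le (Real.exp_pos _).le),
    integral_mul_exp_neg_mul hc]
  simp

theorem integral_holdingLaw {c : ℝ} (hc : 0 < c) (g : ℝ → ℝ) :
    ∫ x, g x ∂(holdingLaw c) = ∫ x in Set.Ioi 0, c * Real.exp (-(c * x)) * g x := by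
  rw [holdingLaw, integral_withDensity_eq_integral_toReal_smul (by fun_prop)
    (Eventually.of_forall fun _ => ENNReal.ofReal_lt_top)]
  refine integral_congr_ae (Eventually.of_forall fun x => ?_)
  simp only [smul_eq_mul]
  rw [ENNReal.toReal_ofReal (mul_nonneg hc.le (Real.exp_pos _).le)]

/-- This is the martingale property of the compensated single jump at an exponential time: the
bracket is, up to a factor, the mean increment between s and t when the jump occurs at x. -/
theorem integral_mul_exp_neg_mul_compensator {c : ℝ} (hc : 0 < c) {s t : ℝ} (hs : 0 ≤ s)
    (hst : s ≤ t) :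
    ∫ x in Set.Ioi 0, c * Real.exp (-(c * x)) *
      (if x ≤ s then 0 else if x ≤ t then 1 / c + s - x else s - t) = 0 := by
  set Ψ : ℝ → ℝ := fun x => c * Real.exp (-(c * x)) *
      (if x ≤ s then 0 else if x ≤ t then 1 / c + s - x else s - t) with hΨ
  have h1 : Set.EqOn Ψ (fun _ => 0) (Set.Ioc 0 s) := fun x hx => by simp [hΨ, hx.2]
  have h2 : Set.EqOn Ψ (fun x => c * Real.exp (-(c * x)) * (1 / c + s - x)) (Set.Ioc s t) :=
    fun x hx => by simp [hΨ, hx.1.not_ge, hx.2]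
  have h3 : Set.EqOn Ψ (fun x => c * Real.exp (-(c * x)) * (s - t)) (Set.Ioi t) :=
    fun x hx => by
      have h : t < x := hx
      simp [hΨ, h.not_ge, (hst.trans_lt h).not_ge]
  have i1 : IntegrableOn Ψ (Set.Ioc 0 s) :=
    (integrableOn_congr_fun h1 measurableSet_Ioc).2 integrableOn_zero
  have hcont : Continuous fun x => c * Real.exp (-(c * x)) * (1 / c + s - x) := by fun_prop
  have i2 : IntegrableOn Ψ (Set.Ioc s t) :=
    (integrableOn_congr_fun h2 measurableSet_Ioc).2
      ((hcont.integrableOn_Icc).mono_set Set.Ioc_subset_Icc_self)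
  have i3 : IntegrableOn Ψ (Set.Ioi t) :=
    (integrableOn_congr_fun h3 measurableSet_Ioi).2
      ((integrableOn_mul_exp_neg_mul hc t).mul_const _)
  have e1 : ∫ x in Set.Ioc 0 s, Ψ x = 0 := by
    rw [setIntegral_congr_fun measurableSet_Ioc h1]; simp
  have e2 : ∫ x in Set.Ioc s t, Ψ x = Real.exp (-(c * t)) * (t - s) := by
    rw [setIntegral_congr_fun measurableSet_Ioc h2, ← intervalIntegral.integral_of_le hst]
    -- The antiderivative exp(-cx)(x - s) vanishes at s, so only the boundary term at t remains; it
    -- cancels the contribution of x > t.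
    rw [intervalIntegral.integral_eq_sub_of_hasDerivAt
      (f := fun x => Real.exp (-(c * x)) * (x - s)) (fun x _ => ?_)
      (hcont.intervalIntegrable _ _)]
    · simp
    · refine ((hasDerivAt_exp_neg_mul c x).mul ((hasDerivAt_id x).sub_const s)).congr_deriv ?_
      have h1 : c * (1 / c) = 1 := mul_one_div_cancel hc.ne'
      change -(c * Real.exp (-(c * x))) * (x - s) + Real.exp (-(c * x)) * 1 = _
      linear_combination -Real.exp (-(c * x)) * h1
  have e3 : ∫ x in Set.Ioi t, Ψ x = Real.exp (-(c * t)) * (s - t) := by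
    rw [setIntegral_congr_fun measurableSet_Ioi h3, integral_mul_const, integral_mul_exp_neg_mul hc]
  rw [← Set.Ioc_union_Ioi_eq_Ioi (hs.trans hst), setIntegral_union (Set.Ioc_disjoint_Ioi le_rfl)
    measurableSet_Ioi _ i3, ← Set.Ioc_union_Ioc_eq_Ioc hs hst,
    setIntegral_union (Set.Ioc_disjoint_Ioc_of_le le_rfl) measurableSet_Ioc i1 i2, e1, e2, e3]
  · ring
  · rw [← Set.Ioc_union_Ioc_eq_Ioc hs hst]
    exact i1.union i2

end HoldingTime

/-! ### Waiting an exponential time, then continuing with another law. -/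

section Concatenation

variable {S : Type*} [TopologicalSpace S]

/-- The constant path. -/
def constPath (i : S) : Path S := ⟨fun _ => i, fun _ => ⟨tendsto_const_nhds, i, tendsto_const_nhds⟩⟩

theorem stopPath_concatPath_of_lt {s τ : ℝ≥0} (h : s < τ) (i : S) (η : Path S) :
    stopPath s (concatPath i τ η) = constPath i :=
  Path.ext_coord fun t => by
    rw [coord_stopPath, coord_concatPath_of_lt ((min_le_right t s).trans_lt h)]
    rfl

theorem mpProcess_concatPath_of_lt (L : (S → ℝ) → S → ℝ) (f : S → ℝ) {t τ : ℝ≥0} (h : t < τ)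
    (i : S) (η : Path S) : mpProcess L f t (concatPath i τ η) = -(t * L f i) := by
  rw [← mpProcess_stopPath, stopPath_concatPath_of_lt h]
  simp [mpProcess, constPath, coord]

variable [MeasurableSpace S] [TopologicalSpace.PseudoMetrizableSpace S] [BorelSpace S]
  {L : (S → ℝ) → S → ℝ} {f : S → ℝ} {K : ℝ}

theorem IsBoundedPair.mpProcess_concatPath_of_le (h : IsBoundedPair L f K) {t τ : ℝ≥0}
    (h0 : 0 < τ) (hτ : τ ≤ t) (i : S) (η : Path S) :
    mpProcess L f t (concatPath i τ η) =
      mpProcess L f (t - τ) η + f (coord 0 η) - f i - τ * L f i := by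
  have e1 : ∫ s in (0 : ℝ)..τ, L f (coord s.toNNReal (concatPath i τ η)) = τ * L f i := by
    rw [intervalIntegral.integral_congr_ae (g := fun _ => L f i)]
    · simp
    · have : ∀ᵐ s : ℝ, s ≠ τ := by simp [ae_iff]
      filter_upwards [this] with s hs hs'
      rw [Set.uIoc_of_le τ.coe_nonneg] at hs'
      rw [coord_concatPath_of_lt]
      rw [Real.toNNReal_lt_iff_lt_coe hs'.1.le]
      exact lt_of_le_of_ne hs'.2 hs
  have e2 : ∫ s in (τ : ℝ)..t, L f (coord s.toNNReal (concatPath i τ η)) =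
      ∫ s in (0 : ℝ)..((t - τ : ℝ≥0) : ℝ), L f (coord s.toNNReal η) := by
    rw [intervalIntegral.integral_congr
      (g := fun s : ℝ => (fun s : ℝ => L f (coord s.toNNReal η)) (s - τ)),
      intervalIntegral.integral_comp_sub_right (fun s : ℝ => L f (coord s.toNNReal η)) (τ : ℝ),
      sub_self, NNReal.coe_sub hτ]
    intro s hs
    rw [Set.uIcc_of_le (NNReal.coe_le_coe.2 hτ)] at hs
    have h1 : 0 ≤ s := τ.coe_nonneg.trans hs.1
    have h2 : τ ≤ s.toNNReal := NNReal.le_toNNReal_of_coe_le hs.1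
    simp only
    rw [coord_concatPath_of_le h2, NNReal.sub_def, Real.coe_toNNReal s h1]
  have e3 := intervalIntegral.integral_add_adjacent_intervals
    (h.intervalIntegrable (concatPath i τ η) 0 τ) (h.intervalIntegrable (concatPath i τ η) τ t)
  rw [e1, e2] at e3
  unfold mpProcess
  rw [← e3, coord_concatPath_of_le hτ, coord_concatPath_of_lt h0]
  ring

/-- The law of a path which waits in `i` for an exponential time of rate `c` and then follows a path
with law `κ`. -/
def concatLaw (i : S) (c : ℝ) (κ : Measure (Path S)) : Measure (Path S) :=
  ((holdingLaw c).prod κ).map fun p => concatPath i p.1.toNNReal p.2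

theorem measurable_concatPath_toNNReal (i : S) :
    Measurable fun p : ℝ × Path S => concatPath i p.1.toNNReal p.2 :=
  (measurable_concatPath i).comp
    ((measurable_real_toNNReal.comp measurable_fst).prodMk measurable_snd)

theorem isProbabilityMeasure_concatLaw (i : S) {c : ℝ} (hc : 0 < c) (κ : Measure (Path S))
    [IsProbabilityMeasure κ] : IsProbabilityMeasure (concatLaw i c κ) := by
  have := isProbabilityMeasure_holdingLaw hc
  exact Measure.isProbabilityMeasure_map (measurable_concatPath_toNNReal i).aemeasurable

theorem integral_concatLaw (i : S) {c : ℝ} (hc : 0 < c) (κ : Measure (Path S))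
    [IsProbabilityMeasure κ] {F : Path S → ℝ} (hF : Measurable F) {B : ℝ} (hB : ∀ ω, |F ω| ≤ B) :
    ∫ ω, F ω ∂(concatLaw i c κ) = ∫ x in Set.Ioi 0, c * Real.exp (-(c * x)) *
      ∫ η, F (concatPath i x.toNNReal η) ∂κ := by
  have := isProbabilityMeasure_holdingLaw hc
  rw [concatLaw, integral_map (measurable_concatPath_toNNReal i).aemeasurable
    hF.aestronglyMeasurable, integral_prod, integral_holdingLaw hc]
  exact Integrable.of_bound (hF.comp (measurable_concatPath_toNNReal i)).aestronglyMeasurable B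
    (Eventually.of_forall fun p => hB _)

theorem map_coord_zero_concatLaw (i : S) {c : ℝ} (hc : 0 < c) (κ : Measure (Path S))
    [IsProbabilityMeasure κ] : (concatLaw i c κ).map (coord 0) = Measure.dirac i := by
  have := isProbabilityMeasure_holdingLaw hc
  rw [concatLaw, Measure.map_map (measurable_coord 0) (measurable_concatPath_toNNReal i)]
  have hpos : ∀ᵐ x ∂(holdingLaw c), 0 < x :=
    (withDensity_absolutelyContinuous _ _).ae_le (ae_restrict_mem measurableSet_Ioi)
  have : (coord 0 ∘ fun p : ℝ × Path S => concatPath i p.1.toNNReal p.2)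
      =ᵐ[(holdingLaw c).prod κ] fun _ => i := by
    have h := Measure.quasiMeasurePreserving_fst (μ := holdingLaw c) (ν := κ)
    filter_upwards [h.ae hpos] with p hp
    exact coord_concatPath_of_lt (Real.toNNReal_pos.2 hp) i p.2
  rw [Measure.map_congr this, Measure.map_const]
  simp

omit [TopologicalSpace.PseudoMetrizableSpace S] [BorelSpace S] in
theorem measurable_stopPath_concatPath (i : S) (s τ : ℝ≥0) :
    Measurable[rawFiltration S (s - τ)] fun η : Path S => stopPath s (concatPath i τ η) := by
  refine measurable_path (mα := rawFiltration S (s - τ)) fun r => ?_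
  simp_rw [coord_stopPath]
  rcases lt_or_ge (min r s) τ with hr | hr
  · simp_rw [coord_concatPath_of_lt hr]
    exact measurable_const
  · simp_rw [coord_concatPath_of_le hr]
    exact measurable_coord_rawFiltration (tsub_le_tsub_right (min_le_right r s) τ)

/-- Waiting for an exponential time in `i` and then continuing with a solution solves the martingale
problem, if the jump distribution is compatible with the operator. -/
theorem IsBoundedPair.martingale_concatLaw (h : IsBoundedPair L f K) (i : S) {c : ℝ} (hc : 0 < c)
    (κ : Measure (Path S)) [IsProbabilityMeasure κ]
    (hκ : ∀ s t : ℝ≥0, s ≤ t → ∀ A, MeasurableSet[rawFiltration S s] A →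
      ∫ ω in A, mpProcess L f s ω ∂κ = ∫ ω in A, mpProcess L f t ω ∂κ)
    (hjump : c * (∫ ω, f (coord 0 ω) ∂κ - f i) = L f i) :
    Martingale (mpProcess L f) (pathFiltration S) (concatLaw i c κ) := by
  have := isProbabilityMeasure_concatLaw i hc κ
  refine h.martingale_mp fun s t hst A hA => ?_
  have hA' : MeasurableSet A := (rawFiltration S).le s A hA
  rw [rawFiltration_eq_comap] at hA
  obtain ⟨B, hB, rfl⟩ := hA
  rw [← sub_eq_zero, ← integral_sub (h.integrable_mp _ s).integrableOn
    (h.integrable_mp _ t).integrableOn, ← integral_indicator hA']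
  have hfint : Integrable (fun ω => f (coord 0 ω)) κ :=
    Integrable.of_bound (h.continuous.measurable.comp (measurable_coord 0)).aestronglyMeasurable K
      (Eventually.of_forall fun ω => h.abs_le _)
  have hκ0 : ∀ t, ∫ ω, mpProcess L f t ω ∂κ = 0 := fun t => by
    have := hκ 0 t zero_le Set.univ MeasurableSet.univ
    simp only [Measure.restrict_univ, mpProcess_zero, integral_zero] at this
    exact this.symm
  have hK : 0 ≤ K := (abs_nonneg _).trans (h.abs_le i)
  rw [integral_concatLaw i hc κ
    (F := (stopPath s ⁻¹' B).indicator fun ω => mpProcess L f s ω - mpProcess L f t ω)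
    (B := (2 * K + K * s) + (2 * K + K * t))
    (((h.measurable_mp s).sub (h.measurable_mp t)).indicator hA') (fun ω => ?_)]
  · have hmul : ∀ b : ℝ, ∫ x in Set.Ioi (0 : ℝ), c * Real.exp (-(c * x)) * (b *
        (if x ≤ s then 0 else if x ≤ t then 1 / c + s - x else s - t)) = 0 := fun b => by
      have h0 := integral_mul_exp_neg_mul_compensator hc s.coe_nonneg (NNReal.coe_le_coe.2 hst)
      have h1 := congrArg (fun y => b * y) h0
      simp only [mul_zero] at h1
      rw [← integral_const_mul] at h1
      refine Eq.trans ?_ h1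
      congr 1 with x
      ring
    -- For each holding time x the inner integral is computed. It is 0 if x ≤ s; otherwise it is the
    -- compensator bracket times a factor not depending on x.
    refine Eq.trans ?_ (hmul (-(B.indicator (fun _ => L f i) (constPath i))))
    refine setIntegral_congr_fun measurableSet_Ioi fun x hx => ?_
    have hx0 : 0 < x := hx
    congr 1
    lift x to ℝ≥0 using hx0.le
    rw [Real.toNNReal_coe]
    have hx1 : 0 < x := hx0
    -- If the jump has occurred by s, the increment is that of the continuation between s - x and t
    -- - x, and the event is known to the continuation at time s - x.
    rcases le_or_gt x s with hxs | hxs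
    · rw [if_pos (NNReal.coe_le_coe.2 hxs), mul_zero]
      have hm := measurable_stopPath_concatPath i s x hB
      have e : ∀ η, (stopPath s ⁻¹' B).indicator
          (fun ω => mpProcess L f s ω - mpProcess L f t ω) (concatPath i x η) =
          ((fun η => stopPath s (concatPath i x η)) ⁻¹' B).indicator
            (fun η => mpProcess L f (s - x) η - mpProcess L f (t - x) η) η := by
        intro η
        by_cases hη : stopPath s (concatPath i x η) ∈ B
        · rw [Set.indicator_of_mem (by exact hη), Set.indicator_of_mem (by exact hη),
            h.mpProcess_concatPath_of_le hx1 hxs, h.mpProcess_concatPath_of_le hx1 (hxs.trans hst)]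
          ring
        · rw [Set.indicator_of_notMem (by exact hη), Set.indicator_of_notMem (by exact hη)]
      simp_rw [e]
      rw [integral_indicator ((rawFiltration S).le _ _ hm),
        integral_sub (h.integrable_mp _ _).integrableOn
          (h.integrable_mp _ _).integrableOn,
        hκ (s - x) (t - x) (tsub_le_tsub_right hst x) _ hm, sub_self]
    -- If the jump is after s, the path up to s is constant, so the event is deterministic and its
    -- indicator factors out.
    · have e : ∀ η, (stopPath s ⁻¹' B).indicator
          (fun ω => mpProcess L f s ω - mpProcess L f t ω) (concatPath i x η) =
          B.indicator (fun _ => (1 : ℝ)) (constPath i) *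
            (-(s * L f i) - mpProcess L f t (concatPath i x η)) := by
        intro η
        have hc := stopPath_concatPath_of_lt hxs i η
        by_cases hη : constPath i ∈ B
        · rw [Set.indicator_of_mem (by rw [Set.mem_preimage, hc]; exact hη),
            Set.indicator_of_mem hη, mpProcess_concatPath_of_lt L f hxs, one_mul]
        · rw [Set.indicator_of_notMem (by rw [Set.mem_preimage, hc]; exact hη),
            Set.indicator_of_notMem hη, zero_mul]
      have e' : B.indicator (fun _ => L f i) (constPath i) =
          B.indicator (fun _ => (1 : ℝ)) (constPath i) * L f i := by
        by_cases hη : constPath i ∈ B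
        · rw [Set.indicator_of_mem hη, Set.indicator_of_mem hη, one_mul]
        · rw [Set.indicator_of_notMem hη, Set.indicator_of_notMem hη, zero_mul]
      simp_rw [e, e']
      rw [if_neg (not_le.2 (NNReal.coe_lt_coe.2 hxs)), integral_const_mul, neg_mul, mul_assoc]
      suffices hI : ∫ η, (-(s * L f i) - mpProcess L f t (concatPath i x η)) ∂κ =
          -(L f i * if (x : ℝ) ≤ t then 1 / c + s - x else s - t) by rw [hI, mul_neg]
      rcases le_or_gt x t with hxt | hxt
      · rw [if_pos (NNReal.coe_le_coe.2 hxt)]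
        have hmi := h.integrable_mp κ (t - x)
        have hη : ∀ η, -(s * L f i) - mpProcess L f t (concatPath i x η) =
            (f i + x * L f i - s * L f i) - (mpProcess L f (t - x) η + f (coord 0 η)) := by
          intro η
          rw [h.mpProcess_concatPath_of_le hx1 hxt]
          ring
        simp_rw [hη]
        have hsum : Integrable (fun η => mpProcess L f (t - x) η + f (coord 0 η)) κ :=
          hmi.add hfint
        rw [integral_sub (integrable_const _) hsum, integral_add hmi hfint, hκ0]
        simp only [integral_const, probReal_univ, smul_eq_mul, one_mul]
        -- The mean jump of f balances the drift collected during the mean holding time 1/c.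
        have hj : ∫ ω, f (coord 0 ω) ∂κ - f i = L f i / c := by
          rw [← hjump]; field_simp
        linear_combination -hj
      · rw [if_neg (not_le.2 (NNReal.coe_lt_coe.2 hxt))]
        simp_rw [mpProcess_concatPath_of_lt L f hxt]
        simp only [integral_const, probReal_univ, smul_eq_mul, one_mul]
        ring
  · have h1 := h.abs_mpProcess_le s ω
    have h2 := h.abs_mpProcess_le t ω
    by_cases hω : ω ∈ stopPath s ⁻¹' B
    · rw [Set.indicator_of_mem hω]
      exact (abs_sub _ _).trans (add_le_add h1 h2)
    · rw [Set.indicator_of_notMem hω, abs_zero]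
      exact add_nonneg ((abs_nonneg _).trans h1) ((abs_nonneg _).trans h2)

end Concatenation

/-! ### The discounted occupation functional. -/

section Discounted

variable {S : Type*} [TopologicalSpace S]

/-- The discounted functional `∫₀^∞ e^{-t} h(X_t) dt`. -/
def discounted (h : S → ℝ) (ω : Path S) : ℝ :=
  ∫ t in Set.Ioi (0 : ℝ), Real.exp (-t) * h (coord t.toNNReal ω)

theorem integrableOn_exp_neg (a : ℝ) : IntegrableOn (fun t : ℝ => Real.exp (-t)) (Set.Ioi a) := by
  simpa using integrableOn_mul_exp_neg_mul one_pos a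

theorem integral_exp_neg (a : ℝ) : ∫ t in Set.Ioi a, Real.exp (-t) = Real.exp (-a) := by
  simpa using integral_mul_exp_neg_mul one_pos a

variable [MeasurableSpace S] [TopologicalSpace.PseudoMetrizableSpace S] [BorelSpace S]
  {h : S → ℝ} {B : ℝ}

theorem integrableOn_discounted (hm : Measurable h) (hB : ∀ x, |h x| ≤ B) (ω : Path S) :
    IntegrableOn (fun t : ℝ => Real.exp (-t) * h (coord t.toNNReal ω)) (Set.Ioi 0) := by
  refine ((integrableOn_exp_neg 0).mul_const B).mono'
    ((Real.measurable_exp.comp measurable_neg).mul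
      (measurable_comp_coord hm ω)).aestronglyMeasurable ?_
  refine Eventually.of_forall fun t => ?_
  rw [norm_mul, Real.norm_of_nonneg (Real.exp_pos _).le]
  exact mul_le_mul_of_nonneg_left (hB _) (Real.exp_pos _).le

omit [MeasurableSpace S] [TopologicalSpace.PseudoMetrizableSpace S] [BorelSpace S] in
theorem abs_discounted_le (hB : ∀ x, |h x| ≤ B) (ω : Path S) :
    |discounted h ω| ≤ B := by
  have h1 : ‖∫ t in Set.Ioi (0 : ℝ), Real.exp (-t) * h (coord t.toNNReal ω)‖ ≤
      ∫ t in Set.Ioi (0 : ℝ), Real.exp (-t) * B := by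
    refine norm_integral_le_of_norm_le ((integrableOn_exp_neg 0).mul_const B) ?_
    refine Eventually.of_forall fun t => ?_
    rw [norm_mul, Real.norm_of_nonneg (Real.exp_pos _).le]
    exact mul_le_mul_of_nonneg_left (hB _) (Real.exp_pos _).le
  rw [integral_mul_const, integral_exp_neg] at h1
  simpa [discounted] using h1

theorem measurable_discounted (hm : Measurable h) : Measurable (discounted (S := S) h) := by
  have h1 : StronglyMeasurable fun p : Path S × ℝ => Real.exp (-p.2) * h (coord p.2.toNNReal p.1) :=
    ((Real.measurable_exp.comp measurable_snd.neg).mul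
      (hm.comp measurable_coord_toNNReal_swap)).stronglyMeasurable
  exact h1.integral_prod_right'.measurable

theorem discounted_concatPath (hm : Measurable h) (hB : ∀ x, |h x| ≤ B) (i : S) (τ : ℝ≥0)
    (η : Path S) : discounted h (concatPath i τ η) =
      h i * (1 - Real.exp (-τ)) + Real.exp (-τ) * discounted h η := by
  have hi := integrableOn_discounted hm hB (concatPath i τ η)
  have e1 : ∫ t in Set.Ioc 0 (τ : ℝ), Real.exp (-t) * h (coord t.toNNReal (concatPath i τ η)) =
      (1 - Real.exp (-τ)) * h i := by
    have h1 : ∫ t in Set.Ioc 0 (τ : ℝ), Real.exp (-t) * h i = (1 - Real.exp (-τ)) * h i := by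
      rw [integral_mul_const]
      congr 1
      have h2 := setIntegral_union (Set.Ioc_disjoint_Ioi (le_refl (τ : ℝ))) measurableSet_Ioi
        ((integrableOn_exp_neg 0).mono_set Set.Ioc_subset_Ioi_self) (integrableOn_exp_neg (τ : ℝ))
      rw [Set.Ioc_union_Ioi_eq_Ioi τ.coe_nonneg, integral_exp_neg, integral_exp_neg] at h2
      simp only [neg_zero, Real.exp_zero] at h2
      linarith
    rw [← h1]
    have hne : ∀ᵐ s : ℝ, s ≠ τ := by simp [ae_iff]
    refine setIntegral_congr_ae measurableSet_Ioc ?_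
    filter_upwards [hne] with s hs hs'
    rw [coord_concatPath_of_lt]
    rw [Real.toNNReal_lt_iff_lt_coe hs'.1.le]
    exact lt_of_le_of_ne hs'.2 hs
  have e2 : ∫ t in Set.Ioi (τ : ℝ), Real.exp (-t) * h (coord t.toNNReal (concatPath i τ η)) =
      Real.exp (-τ) * discounted h η := by
    have hshift := (measurePreserving_sub_right volume (τ : ℝ)).setIntegral_preimage_emb
      (measurableEmbedding_subRight (τ : ℝ)) (fun t => Real.exp (-t) * h (coord t.toNNReal η))
      (Set.Ioi 0)
    rw [discounted, ← hshift, ← integral_const_mul]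
    have : (fun t : ℝ => t - τ) ⁻¹' Set.Ioi 0 = Set.Ioi (τ : ℝ) := by
      ext t; simp
    rw [this]
    refine setIntegral_congr_fun measurableSet_Ioi fun t ht => ?_
    have h1 : (τ : ℝ) ≤ t := le_of_lt ht
    have h2 : τ ≤ t.toNNReal := NNReal.le_toNNReal_of_coe_le h1
    rw [coord_concatPath_of_le h2, NNReal.sub_def, Real.coe_toNNReal t (τ.coe_nonneg.trans h1),
      ← mul_assoc, ← Real.exp_add]
    congr 2
    ring
  have h3 := setIntegral_union (Set.Ioc_disjoint_Ioi (le_refl (τ : ℝ))) measurableSet_Ioi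
    (hi.mono_set Set.Ioc_subset_Ioi_self) (hi.mono_set (Set.Ioi_subset_Ioi τ.coe_nonneg))
  rw [Set.Ioc_union_Ioi_eq_Ioi τ.coe_nonneg, e1, e2] at h3
  rw [discounted, h3, mul_comm (h i)]

/-- The functional splits at the holding time τ into h(i)(1 - e^{-τ}) and e^{-τ} times the
functional of the continuation; for rate c the mean of e^{-τ} is c/(c+1). -/
theorem integral_discounted_concatLaw (hm : Measurable h) (hB : ∀ x, |h x| ≤ B) (i : S) {c : ℝ}
    (hc : 0 < c) (κ : Measure (Path S)) [IsProbabilityMeasure κ] :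
    (c + 1) * ∫ ω, discounted h ω ∂(concatLaw i c κ) = h i + c * ∫ ω, discounted h ω ∂κ := by
  have hint : Integrable (discounted h) κ :=
    Integrable.of_bound (measurable_discounted hm).aestronglyMeasurable B
      (Eventually.of_forall (abs_discounted_le hB))
  set m := ∫ ω, discounted h ω ∂κ with hmdef
  have hc1 : 0 < c + 1 := by linarith
  rw [integral_concatLaw i hc κ (measurable_discounted hm) (abs_discounted_le hB)]
  have e : ∀ x ∈ Set.Ioi (0 : ℝ), c * Real.exp (-(c * x)) *
      ∫ η, discounted h (concatPath i x.toNNReal η) ∂κ =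
      (c * Real.exp (-(c * x))) * h i +
        ((c + 1) * Real.exp (-((c + 1) * x))) * (c / (c + 1) * (m - h i)) := by
    intro x hx
    simp_rw [discounted_concatPath hm hB, Real.coe_toNNReal x (le_of_lt hx)]
    rw [integral_add (integrable_const _) (hint.const_mul _), integral_const_mul,
      integral_const_mul, ← hmdef]
    have : Real.exp (-((c + 1) * x)) = Real.exp (-(c * x)) * Real.exp (-x) := by
      rw [← Real.exp_add]; congr 1; ring
    rw [this]
    simp only [integral_const, probReal_univ, smul_eq_mul, one_mul]
    field_simp
    ring
  rw [setIntegral_congr_fun measurableSet_Ioi e,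
    integral_add ((integrableOn_mul_exp_neg_mul hc 0).mul_const _)
      ((integrableOn_mul_exp_neg_mul hc1 0).mul_const _), integral_mul_const, integral_mul_const,
    integral_mul_exp_neg_mul hc, integral_mul_exp_neg_mul hc1]
  simp only [mul_zero, neg_zero, Real.exp_zero, one_mul]
  field_simp
  ring

/-- By right-continuity at 0 the integrand stays positive on a short initial interval. -/
theorem discounted_pos {ω : Path S} (hm : Measurable h) (hB : ∀ x, |h x| ≤ B)
    (hn : ∀ x, 0 ≤ h x) (hc : ContinuousAt h (coord 0 ω)) (hpos : 0 < h (coord 0 ω)) :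
    0 < discounted h ω := by
  have h0 : ∀ᶠ t in 𝓝[≥] (0 : ℝ≥0), 0 < h (coord t ω) :=
    (hc.tendsto.comp (ω.2 0).1).eventually_const_lt hpos
  obtain ⟨δ, hδ, hsub⟩ := (mem_nhdsGE_iff_exists_Ico_subset' zero_lt_one).1 h0
  have hδ' : (0 : ℝ≥0) < δ := hδ
  rw [discounted, setIntegral_pos_iff_support_of_nonneg_ae
    (Eventually.of_forall fun t => mul_nonneg (Real.exp_pos _).le (hn _))
    (integrableOn_discounted hm hB ω)]
  refine lt_of_lt_of_le ?_ (measure_mono (s := Set.Ioo 0 (δ : ℝ)) fun t ht => ?_)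
  · simpa using hδ'
  · refine ⟨?_, ht.1⟩
    have : t.toNNReal ∈ Set.Ico 0 δ :=
      ⟨zero_le, (Real.toNNReal_lt_iff_lt_coe ht.1.le).2 ht.2⟩
    exact (mul_pos (Real.exp_pos _) (hsub this)).ne'

end Discounted

/-! ### Countable mixtures of laws. -/

section Mixture

variable {I Ω : Type*} [MeasurableSpace Ω]

/-- The mixture `∑_j π_j P_j`. -/
def mixture (π : I → ℝ) (P : I → Measure Ω) : Measure Ω :=
  Measure.sum fun j => ENNReal.ofReal (π j) • P j

theorem isProbabilityMeasure_mixture {π : I → ℝ} (hπ : ∀ j, 0 ≤ π j) (hsum : HasSum π 1)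
    (P : I → Measure Ω) [∀ j, IsProbabilityMeasure (P j)] : IsProbabilityMeasure (mixture π P) := by
  refine ⟨?_⟩
  rw [mixture, Measure.sum_apply _ MeasurableSet.univ]
  simp only [Measure.smul_apply, measure_univ, smul_eq_mul, mul_one]
  rw [← ENNReal.ofReal_tsum_of_nonneg hπ hsum.summable, hsum.tsum_eq, ENNReal.ofReal_one]

theorem hasSum_integral_mixture {π : I → ℝ} (hπ : ∀ j, 0 ≤ π j) (hsum : HasSum π 1)
    (P : I → Measure Ω) [∀ j, IsProbabilityMeasure (P j)] {F : Ω → ℝ} (hF : Measurable F) {B : ℝ}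
    (hB : ∀ ω, |F ω| ≤ B) :
    HasSum (fun j => π j * ∫ ω, F ω ∂(P j)) (∫ ω, F ω ∂(mixture π P)) := by
  have := isProbabilityMeasure_mixture hπ hsum P
  have h := hasSum_integral_measure (μ := fun j => ENNReal.ofReal (π j) • P j) (f := F)
    (Integrable.of_bound (μ := mixture π P) hF.aestronglyMeasurable B (Eventually.of_forall hB))
  simp_rw [integral_smul_measure, ENNReal.toReal_ofReal (hπ _), smul_eq_mul] at h
  exact h

end Mixture

/-! ### The resolvent of the dominating chain as a Lyapunov function. -/

section Chain

variable {I : Type*}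

theorem IsConservativeQMatrix.hasSum_row {q : I → I → ℝ} (hq : IsConservativeQMatrix q) (i : I) :
    HasSum (q i) 0 := by
  classical
  have h1 := hq.hasSum i
  have h2 : HasSum (fun j => if j = i then q i i else 0) (q i i) := hasSum_ite_eq i (q i i)
  have h3 := h1.add h2
  rw [neg_add_cancel] at h3
  refine h3.congr_fun fun j => ?_
  by_cases hj : j = i
  · subst hj; simp
  · simp [hj]

theorem IsConservativeQMatrix.summable_mul {q : I → I → ℝ} (hq : IsConservativeQMatrix q) (i : I)
    {f : I → ℝ} {K : ℝ} (hf : ∀ j, |f j| ≤ K) : Summable fun j => q i j * f j := by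
  refine Summable.of_norm_bounded (g := fun j => |q i j| * K)
    ((hq.hasSum_row i).summable.abs.mul_right K) fun j => ?_
  rw [norm_mul]
  exact mul_le_mul_of_nonneg_left (hf j) (abs_nonneg _)

theorem IsConservativeQMatrix.diag_nonpos {q : I → I → ℝ} (hq : IsConservativeQMatrix q) (i : I) :
    q i i ≤ 0 := by
  classical
  have := (hq.hasSum i).nonneg fun j => by
    by_cases hj : j = i
    · simp [hj]
    · simpa [hj] using hq.nonneg i j (Ne.symm hj)
  linarith

variable [TopologicalSpace I]

theorem exists_abs_le_of_zeroAtInfty (u : C₀(I, ℝ)) : ∃ K, ∀ x, |u x| ≤ K :=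
  ⟨‖u.toBCF‖, fun x => u.toBCF.norm_coe_le_norm x⟩

variable [Countable I] [DiscreteTopology I] [MeasurableSpace I] [BorelSpace I]

omit [Countable I] in
theorem exists_isBoundedPair_of_mem_chainDomain {q : I → I → ℝ} {f : I → ℝ}
    (hf : f ∈ chainDomain q) : ∃ K, IsBoundedPair (matrixOp q) f K := by
  obtain ⟨⟨u, hu⟩, v, hv⟩ := hf
  obtain ⟨K, hK⟩ := exists_abs_le_of_zeroAtInfty u
  obtain ⟨K', hK'⟩ := exists_abs_le_of_zeroAtInfty v
  refine ⟨max K K', ⟨continuous_of_discreteTopology, ?_, fun x => ?_, fun x => ?_⟩⟩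
  · rw [← hv]; exact v.continuous.measurable
  · rw [← hu]; exact (hK x).trans (le_max_left _ _)
  · rw [← hv]; exact (hK' x).trans (le_max_right _ _)

/-- If the martingale problem of the chain is well posed, then the resolvent inverts `1 - q`. -/
theorem matrixOp_resolvent {q : I → I → ℝ} (hq : IsConservativeQMatrix q)
    {Pd : I → Measure (Path I)}
    (hPd : ∀ i, IsSolution (chainDomain q) (matrixOp q) Set.univ (Measure.dirac i) (Pd i) ∧
      ∀ P', IsSolution (chainDomain q) (matrixOp q) Set.univ (Measure.dirac i) P' → P' = Pd i)
    {h : I → ℝ} {B : ℝ} (hB : ∀ x, |h x| ≤ B) (i : I) :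
    matrixOp q (fun j => ∫ ω, discounted h ω ∂(Pd j)) i = ∫ ω, discounted h ω ∂(Pd i) - h i := by
  classical
  have hprob : ∀ j, IsProbabilityMeasure (Pd j) := fun j => (hPd j).1.isProbabilityMeasure
  have hm : Measurable h := (continuous_of_discreteTopology (f := h)).measurable
  -- The added 1 keeps the rate positive even when i is absorbing. The price is a fictitious jump
  -- from i to i, of probability 1/c.
  set c : ℝ := 1 - q i i with hcdef
  have hc : 0 < c := by linarith [hq.diag_nonpos i]
  set π : I → ℝ := fun j => (q i j + if j = i then c else 0) / c with hπdef
  have hπ : ∀ j, 0 ≤ π j := fun j => by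
    refine div_nonneg ?_ hc.le
    by_cases hj : j = i
    · rw [if_pos hj, hj]; linarith
    · rw [if_neg hj, add_zero]; exact hq.nonneg i j (Ne.symm hj)
  have hsum : HasSum π 1 := by
    have := ((hq.hasSum_row i).add (hasSum_ite_eq i c)).div_const c
    rwa [zero_add, div_self hc.ne'] at this
  -- Fictitious jumps do not change the operator: q = c(π - 1) on the row i.
  have hop : ∀ (f : I → ℝ) (m : ℝ), HasSum (fun j => π j * f j) m →
      matrixOp q f i = c * (m - f i) := by
    intro f m hf
    have h1 := (hf.mul_left c).sub (hasSum_ite_eq i (c * f i))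
    rw [matrixOp, mul_sub, ← h1.tsum_eq]
    congr 1 with j
    simp only [hπdef]
    by_cases hj : j = i
    · subst hj; simp only [if_true]; field_simp; ring
    · simp only [if_neg hj, add_zero, sub_zero]; field_simp
  set κ := mixture π Pd with hκdef
  have hκ : IsProbabilityMeasure κ := isProbabilityMeasure_mixture hπ hsum Pd
  have hsol : IsSolution (chainDomain q) (matrixOp q) Set.univ (Measure.dirac i)
      (concatLaw i c κ) := by
    refine ⟨isProbabilityMeasure_concatLaw i hc κ, by simp, map_coord_zero_concatLaw i hc κ,
      fun f hf => Locally.of_prop ?_⟩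
    obtain ⟨K, hK⟩ := exists_isBoundedPair_of_mem_chainDomain hf
    refine hK.martingale_concatLaw i hc κ (fun s t hst A hA => ?_) ?_
    · have hA' : MeasurableSet A := (rawFiltration I).le s A hA
      have key : ∀ r, HasSum (fun j => π j * ∫ ω in A, mpProcess (matrixOp q) f r ω ∂(Pd j))
          (∫ ω in A, mpProcess (matrixOp q) f r ω ∂κ) := by
        intro r
        simp_rw [← integral_indicator hA']
        refine hasSum_integral_mixture hπ hsum Pd ((hK.measurable_mp r).indicator hA')
          (B := 2 * K + K * r) fun ω => ?_
        have h1 := hK.abs_mpProcess_le r ω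
        by_cases hω : ω ∈ A
        · rwa [Set.indicator_of_mem hω]
        · rw [Set.indicator_of_notMem hω, abs_zero]
          exact (abs_nonneg _).trans h1
      -- The martingale identity is linear in the law, so it passes from the `Pd j` to their
      -- mixture.
      refine (key s).unique ((key t).congr_fun fun j => ?_)
      rw [hK.setIntegral_mpProcess_eq ((hPd j).1.localMartingale f hf) hst
        (rawFiltration_le_pathFiltration s A hA)]
    · have h1 := hasSum_integral_mixture hπ hsum Pd
        (hK.continuous.measurable.comp (measurable_coord 0)) (fun ω => hK.abs_le (coord 0 ω))
      refine (hop f _ ?_).symm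
      refine h1.congr_fun fun j => ?_
      have h2 : ∫ ω, f (coord 0 ω) ∂(Pd j) = ∫ x, f x ∂((Pd j).map (coord 0)) :=
        (integral_map (measurable_coord 0).aemeasurable
          hK.continuous.measurable.aestronglyMeasurable).symm
      rw [(hPd j).1.initial, integral_dirac] at h2
      simp only [Function.comp_apply]
      rw [h2]
  -- Here uniqueness enters: the chain from i must have the first-jump decomposition, so its
  -- resolvent satisfies (c + 1) g(i) = h(i) + c m with m the π-mean of g.
  have heq := (hPd i).2 _ hsol
  have h1 := integral_discounted_concatLaw hm hB i hc κ
  rw [heq] at h1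
  rw [hop _ _ (hasSum_integral_mixture hπ hsum Pd (measurable_discounted hm)
    (abs_discounted_le hB))]
  linear_combination -h1

/-- After Fubini the integrand at each time t is e^{-t} T_t h, which vanishes at infinity by the
Feller-Dynkin property; dominated convergence in t does the rest. -/
theorem tendsto_resolvent_cofinite {Pd : I → Measure (Path I)} (hPd : IsFellerDynkin Pd)
    (hprob : ∀ j, IsProbabilityMeasure (Pd j)) (h : C₀(I, ℝ)) :
    Tendsto (fun j => ∫ ω, discounted h ω ∂(Pd j)) cofinite (𝓝 0) := by
  obtain ⟨B, hB⟩ := exists_abs_le_of_zeroAtInfty h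
  have hm : Measurable h := h.continuous.measurable
  -- Dominated convergence along a filter needs a countable basis; the finite subsets of a countable
  -- set provide one.
  have hgen : (cofinite : Filter I).IsCountablyGenerated := by
    have hb : HasCountableBasis (cofinite : Filter I) Set.Finite compl :=
      ⟨hasBasis_cofinite, Set.Countable.ofPred_finite⟩
    exact hb.isCountablyGenerated
  have hmj : ∀ j, StronglyMeasurable fun t : ℝ =>
      ∫ ω, Real.exp (-t) * h (coord t.toNNReal ω) ∂(Pd j) := fun j =>
    StronglyMeasurable.integral_prod_right' (f := fun p : ℝ × Path I =>
      Real.exp (-p.1) * h (coord p.1.toNNReal p.2))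
      ((Real.measurable_exp.comp measurable_fst.neg).mul
        (hm.comp measurable_coord_toNNReal)).stronglyMeasurable
  have hbd : ∀ (t : ℝ) (x : I), ‖Real.exp (-t) * h x‖ ≤ Real.exp (-t) * B := fun t x => by
    rw [norm_mul, Real.norm_of_nonneg (Real.exp_pos _).le]
    exact mul_le_mul_of_nonneg_left (hB x) (Real.exp_pos _).le
  have e : ∀ j, ∫ ω, discounted h ω ∂(Pd j) =
      ∫ t in Set.Ioi (0 : ℝ), ∫ ω, Real.exp (-t) * h (coord t.toNNReal ω) ∂(Pd j) := by
    intro j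
    unfold discounted
    refine integral_integral_swap ?_
    refine Integrable.mono' (g := fun p : Path I × ℝ => Real.exp (-p.2) * B)
      (((integrableOn_exp_neg 0).mul_const B).comp_snd (Pd j))
      ((Real.measurable_exp.comp measurable_snd.neg).mul
        (hm.comp measurable_coord_toNNReal_swap)).aestronglyMeasurable
      (Eventually.of_forall fun p => hbd _ _)
  simp_rw [e]
  have h0 : ∫ t in Set.Ioi (0 : ℝ), (0 : ℝ) = 0 := by simp
  suffices hlim : Tendsto (fun j => ∫ t in Set.Ioi (0 : ℝ),
      ∫ ω, Real.exp (-t) * h (coord t.toNNReal ω) ∂(Pd j)) cofinite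
      (𝓝 (∫ t in Set.Ioi (0 : ℝ), (0 : ℝ))) by rwa [h0] at hlim
  refine tendsto_integral_filter_of_dominated_convergence (fun t => Real.exp (-t) * B)
    (Eventually.of_forall fun j => (hmj j).aestronglyMeasurable)
    (Eventually.of_forall fun j => Eventually.of_forall fun t => ?_)
    ((integrableOn_exp_neg 0).mul_const B) (Eventually.of_forall fun t => ?_)
  · refine (norm_integral_le_of_norm_le_const (Eventually.of_forall fun ω => hbd t _)).trans ?_
    simp
  · obtain ⟨g, hg⟩ := hPd.map_C0 t.toNNReal h
    have h1 : Tendsto g cofinite (𝓝 0) := by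
      have := g.zero_at_infty'
      rwa [cocompact_eq_cofinite] at this
    have h2 := h1.const_mul (Real.exp (-t))
    rw [mul_zero] at h2
    refine h2.congr fun j => ?_
    rw [hg, semigroup, integral_const_mul]

/-- A Lyapunov function of the chain which is positive on a given finite set. -/
theorem exists_chain_lyapunov {q : I → I → ℝ} (hq : IsConservativeQMatrix q)
    (hchain : HasUniqueFellerDynkinChain q) {F : Set I} (hF : F.Finite) :
    ∃ g ∈ chainDomain q, (∀ j, 0 ≤ g j) ∧ (∀ j ∈ F, 0 < g j) ∧ ∀ j, matrixOp q g j ≤ g j := by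
  classical
  obtain ⟨Pd, hPd, hFD⟩ := hchain
  have hprob : ∀ j, IsProbabilityMeasure (Pd j) := fun j => (hPd j).1.isProbabilityMeasure
  have htend : Tendsto (F.indicator fun _ => (1 : ℝ)) (cocompact I) (𝓝 0) := by
    rw [cocompact_eq_cofinite]
    refine tendsto_const_nhds.congr' ?_
    filter_upwards [hF.compl_mem_cofinite] with j hj
    rw [Set.indicator_of_notMem hj]
  set h : C₀(I, ℝ) := ⟨⟨F.indicator fun _ => 1, continuous_of_discreteTopology⟩, htend⟩ with hdef
  have hh : ∀ j, h j = F.indicator (fun _ => 1) j := fun j => rfl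
  obtain ⟨B, hB⟩ := exists_abs_le_of_zeroAtInfty h
  have hm : Measurable h := h.continuous.measurable
  have hn : ∀ j, 0 ≤ h j := fun j => by
    rw [hh]; exact Set.indicator_nonneg (fun _ _ => zero_le_one) j
  -- The identity q g = g - h serves twice: it puts q g into C_0, hence g into the domain, and it
  -- gives q g ≤ g because h ≥ 0.
  have hres := matrixOp_resolvent hq hPd hB
  set g : I → ℝ := fun j => ∫ ω, discounted h ω ∂(Pd j) with hg
  have hg0 : Tendsto g (cocompact I) (𝓝 0) := by
    rw [cocompact_eq_cofinite]
    exact tendsto_resolvent_cofinite hFD hprob h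
  have hdn : ∀ ω, 0 ≤ discounted h ω := fun ω =>
    integral_nonneg fun t => mul_nonneg (Real.exp_pos _).le (hn _)
  refine ⟨g, ⟨⟨⟨⟨g, continuous_of_discreteTopology⟩, hg0⟩, rfl⟩,
    ⟨⟨fun j => g j - h j, continuous_of_discreteTopology⟩, ?_⟩, ?_⟩, fun j => integral_nonneg hdn,
    fun j hj => ?_, fun j => ?_⟩
  · simpa using hg0.sub h.zero_at_infty'
  · funext j; exact (hres j).symm
  · have h0 : ∀ᵐ ω ∂(Pd j), coord 0 ω = j := by
      have : ∀ᵐ x ∂((Pd j).map (coord 0)), x = j := by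
        rw [(hPd j).1.initial, ae_dirac_eq]; rfl
      exact ae_of_ae_map (measurable_coord 0).aemeasurable this
    have hpos : ∀ᵐ ω ∂(Pd j), 0 < discounted h ω := by
      filter_upwards [h0] with ω hω
      refine discounted_pos hm hB hn h.continuous.continuousAt ?_
      rw [hω, hh, Set.indicator_of_mem hj]
      exact one_pos
    have hint : Integrable (discounted h) (Pd j) :=
      Integrable.of_bound (measurable_discounted hm).aestronglyMeasurable B
        (Eventually.of_forall (abs_discounted_le hB))
    refine (integral_nonneg hdn).lt_of_ne fun heq => ?_
    have h1 := (integral_eq_zero_iff_of_nonneg hdn hint).1 heq.symm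
    have h2 : ∀ᵐ _ω ∂(Pd j), False := by
      filter_upwards [h1, hpos] with ω h3 h4
      rw [h3] at h4
      exact lt_irrefl _ h4
    exact (hprob j).ne_zero _ (ae_eq_bot.1 (by simpa using h2))
  · rw [hres j]
    exact sub_le_self _ (hn j)

end Chain

/-! ### Grönwall's inequality. -/

section Gronwall

/-- Grönwall's inequality in integral form. -/
theorem le_mul_exp_of_le_add_integral {u : ℝ → ℝ} (hu : Measurable u) {K : ℝ}
    (hK : ∀ s, |u s| ≤ K) {A c : ℝ} (hc : 0 ≤ c)
    (h : ∀ t, 0 ≤ t → u t ≤ A + c * ∫ s in (0 : ℝ)..t, u s) {t : ℝ} (ht : 0 ≤ t) :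
    u t ≤ A * Real.exp (c * t) := by
  have hint : ∀ a b, IntervalIntegrable u volume a b := fun a b =>
    (intervalIntegrable_const (c := K)).mono_fun hu.aestronglyMeasurable
      (Eventually.of_forall fun s => (hK s).trans (le_abs_self K))
  set v : ℝ → ℝ := fun t => A + c * ∫ s in (0 : ℝ)..t, u s with hv
  have hvc : Continuous v :=
    continuous_const.add (continuous_const.mul (intervalIntegral.continuous_primitive hint 0))
  -- As u is merely measurable, v need not be differentiable. Integrating once more gives u ≤ v ≤ w
  -- on [0, ∞) with w differentiable and w' = c v ≤ c w there.
  set w : ℝ → ℝ := fun t => A + c * ∫ s in (0 : ℝ)..t, v s with hw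
  have hvw : ∀ t, 0 ≤ t → v t ≤ w t := fun t ht => by
    have := intervalIntegral.integral_mono_on ht (hint 0 t) (hvc.intervalIntegrable 0 t)
      fun s hs => h s hs.1
    simp only [hv, hw] at this ⊢
    gcongr
  have hderiv : ∀ x, HasDerivAt w (c * v x) x := fun x =>
    ((hvc.integral_hasStrictDerivAt 0 x).hasDerivAt.const_mul c).const_add A
  have hwc : Continuous w := continuous_iff_continuousAt.2 fun x => (hderiv x).continuousAt
  have hg := le_gronwallBound_of_liminf_deriv_right_le (f := w) (f' := fun x => c * v x) (δ := A)
    (K := c) (ε := 0) (a := 0) (b := t) hwc.continuousOn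
    (fun x _ r hr => ((hderiv x).hasDerivWithinAt.liminf_right_slope_le hr)) (by simp [hw])
    (fun x hx => by
      rw [add_zero]
      exact mul_le_mul_of_nonneg_left (hvw x hx.1) hc) t ⟨ht, le_rfl⟩
  rw [gronwallBound_ε0, sub_zero] at hg
  exact (h t ht).trans ((hvw t ht).trans hg)

end Gronwall

/-! ### Detecting the exit from a closed set on a time grid. -/

section Lyapunov

/-- A discrete stopping time: increments are kept until p first fails, at index J, and the increment
leading into J is still counted. -/
theorem exists_telescope (p : ℕ → Prop) [∀ j, Decidable (∀ l ≤ j, p l)] (x : ℕ → ℝ) (m : ℕ) :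
    ∃ J ≤ m, (∀ l < J, p l) ∧ (J = m ∨ ¬p J) ∧
      ∑ j ∈ Finset.range m, (if ∀ l ≤ j, p l then x (j + 1) - x j else 0) = x J - x 0 := by
  induction m with
  | zero => exact ⟨0, le_rfl, by simp, Or.inl rfl, by simp⟩
  | succ m ih =>
    obtain ⟨J, hJ, h1, h2, h3⟩ := ih
    rw [Finset.sum_range_succ, h3]
    by_cases hm : ∀ l ≤ m, p l
    · have : J = m := h2.resolve_right fun h => h (hm J hJ)
      subst this
      refine ⟨J + 1, le_rfl, fun l hl => hm l (Nat.lt_succ_iff.1 hl), Or.inl rfl, ?_⟩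
      rw [if_pos hm]
      ring
    · refine ⟨J, hJ.trans (Nat.le_succ m), h1, Or.inr fun hp => hm fun l hl => ?_, ?_⟩
      · have hJm : J = m := h2.resolve_right fun h => h hp
        rcases hl.lt_or_eq with h | h
        · exact h1 l (hJm ▸ h)
        · rw [h, ← hJm]; exact hp
      · rw [if_neg hm, add_zero]

/-- The points of the grid of mesh `1 / (n + 1)`, truncated at `t`. -/
def gridPoint (t : ℝ≥0) (n l : ℕ) : ℝ≥0 := min (l / (n + 1)) t

theorem gridPoint_mono (t : ℝ≥0) (n : ℕ) : Monotone (gridPoint t n) := fun l k h => by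
  unfold gridPoint
  gcongr

theorem gridPoint_zero (t : ℝ≥0) (n : ℕ) : gridPoint t n 0 = 0 := by
  simp [gridPoint]

theorem gridPoint_le (t : ℝ≥0) (n l : ℕ) : gridPoint t n l ≤ t := min_le_right _ _

theorem gridPoint_last (t : ℝ≥0) (n : ℕ) : gridPoint t n (⌈t⌉₊ * (n + 1)) = t := by
  unfold gridPoint
  have h : ((n : ℝ≥0) + 1) ≠ 0 := by positivity
  push_cast
  rw [mul_div_cancel_right₀ _ h, min_eq_right (Nat.le_ceil t)]

variable {S : Type*} [TopologicalSpace S] [MeasurableSpace S]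
  [TopologicalSpace.PseudoMetrizableSpace S] [BorelSpace S]

/-- The process visits `U` at all points of the grid up to time `s`, but not at time `s`. -/
def missedExit (U : Set S) (t : ℝ≥0) (n : ℕ) : Set (Path S × ℝ) :=
  {p | (∀ l, gridPoint t n l ≤ p.2.toNNReal → coord (gridPoint t n l) p.1 ∈ U) ∧
    coord p.2.toNNReal p.1 ∉ U}

theorem measurableSet_missedExit {U : Set S} (hU : IsClosed U) (t : ℝ≥0) (n : ℕ) :
    MeasurableSet (missedExit U t n) := by
  have h1 : ∀ l, MeasurableSet {p : Path S × ℝ | gridPoint t n l ≤ p.2.toNNReal →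
      coord (gridPoint t n l) p.1 ∈ U} := fun l => by
    have : {p : Path S × ℝ | gridPoint t n l ≤ p.2.toNNReal →
        coord (gridPoint t n l) p.1 ∈ U} = {p | gridPoint t n l ≤ p.2.toNNReal}ᶜ ∪
          (fun p => coord (gridPoint t n l) p.1) ⁻¹' U := by
      ext p
      simp only [Set.mem_ofPred_eq, Set.mem_union, Set.mem_compl_iff, Set.mem_preimage]
      tauto
    rw [this]
    exact (measurableSet_le measurable_const
      (measurable_real_toNNReal.comp measurable_snd)).compl.union
        (((measurable_coord _).comp measurable_fst) hU.measurableSet)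
  have h2 : MeasurableSet {p : Path S × ℝ | coord p.2.toNNReal p.1 ∉ U} :=
    (measurable_coord_toNNReal_swap hU.measurableSet).compl
  have : missedExit U t n = (⋂ l, {p : Path S × ℝ | gridPoint t n l ≤ p.2.toNNReal →
      coord (gridPoint t n l) p.1 ∈ U}) ∩ {p : Path S × ℝ | coord p.2.toNNReal p.1 ∉ U} := by
    ext p
    simp [missedExit]
  rw [this]
  exact (MeasurableSet.iInter h1).inter h2

/-- If the path is outside the closed set U at some r < s, it stays outside for a moment by
right-continuity, and a fine grid has a point there before s. So s is eventually not missed. -/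
theorem tendsto_integral_missedExit {U : Set S} (hU : IsClosed U) (t : ℝ≥0) (ω : Path S) :
    Tendsto (fun n => ∫ s in Set.Ioc (0 : ℝ) t, (missedExit U t n).indicator (fun _ => (1 : ℝ))
      (ω, s)) atTop (𝓝 0) := by
  have h0 : ∫ s in Set.Ioc (0 : ℝ) t, (0 : ℝ) = 0 := by simp
  suffices h : Tendsto (fun n => ∫ s in Set.Ioc (0 : ℝ) t,
      (missedExit U t n).indicator (fun _ => (1 : ℝ)) (ω, s)) atTop
      (𝓝 (∫ s in Set.Ioc (0 : ℝ) t, (0 : ℝ))) by rwa [h0] at h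
  refine tendsto_integral_of_dominated_convergence (fun _ => 1) (fun n => ?_)
    (integrable_const _) (fun n => Eventually.of_forall fun s => ?_) ?_
  · exact ((measurable_const.indicator (measurableSet_missedExit hU t n)).comp
      (measurable_const.prodMk measurable_id)).aestronglyMeasurable
  · refine (norm_indicator_le_norm_self _ _).trans ?_
    simp
  -- The only time that fine grids may miss forever is the very first time outside U, a single
  -- point.
  · have hsub : {s : ℝ | 0 < s ∧ coord s.toNNReal ω ∉ U ∧
        ∀ r : ℝ≥0, (r : ℝ) < s → coord r ω ∈ U}.Subsingleton := by
      intro s hs s' hs'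
      rcases lt_trichotomy s s' with h | h | h
      · exact absurd (hs'.2.2 s.toNNReal (by rwa [Real.coe_toNNReal s hs.1.le])) hs.2.1
      · exact h
      · exact absurd (hs.2.2 s'.toNNReal (by rwa [Real.coe_toNNReal s' hs'.1.le])) hs'.2.1
    have hnull := hsub.measure_zero (volume : Measure ℝ)
    filter_upwards [ae_restrict_of_ae (measure_eq_zero_iff_ae_notMem.1 hnull),
      ae_restrict_mem measurableSet_Ioc] with s hs hst
    by_cases hsU : coord s.toNNReal ω ∈ U
    · refine tendsto_const_nhds.congr fun n => ?_
      rw [Set.indicator_of_notMem]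
      exact fun h => h.2 hsU
    · have hex : ∃ r : ℝ≥0, (r : ℝ) < s ∧ coord r ω ∉ U := by
        by_contra hcon
        push Not at hcon
        exact hs ⟨hst.1, hsU, hcon⟩
      obtain ⟨r, hrs, hr⟩ := hex
      refine tendsto_const_nhds.congr' ?_
      have h1 := (tendsto_coord_gridAbove r ω).eventually (hU.isOpen_compl.mem_nhds hr)
      have h2 : ∀ᶠ n in atTop, gridAbove n r < s.toNNReal :=
        ((tendsto_gridAbove r).mono_right nhdsWithin_le_nhds).eventually_lt_const
          (Real.lt_toNNReal_iff_coe_lt.2 hrs)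
      filter_upwards [h1, h2] with n hn1 hn2
      rw [Set.indicator_of_notMem]
      rintro ⟨h3, -⟩
      have hst' : s.toNNReal ≤ t := Real.toNNReal_le_iff_le_coe.2 hst.2
      have h4 : gridPoint t n (⌊r * (n + 1)⌋₊ + 1) = gridAbove n r := by
        rw [gridPoint, gridAbove]
        push_cast
        exact min_eq_left (hn2.le.trans hst')
      have h5 := h3 (⌊r * (n + 1)⌋₊ + 1)
      rw [h4] at h5
      exact hn1 (h5 hn2.le)

theorem tendsto_integral_integral_missedExit {U : Set S} (hU : IsClosed U) (t : ℝ≥0)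
    (P : Measure (Path S)) [IsProbabilityMeasure P] :
    Tendsto (fun n => ∫ ω, (∫ s in Set.Ioc (0 : ℝ) t,
      (missedExit U t n).indicator (fun _ => (1 : ℝ)) (ω, s)) ∂P) atTop (𝓝 0) := by
  have h0 : ∫ _ω, (0 : ℝ) ∂P = 0 := by simp
  suffices h : Tendsto (fun n => ∫ ω, (∫ s in Set.Ioc (0 : ℝ) t,
      (missedExit U t n).indicator (fun _ => (1 : ℝ)) (ω, s)) ∂P) atTop
      (𝓝 (∫ _ω, (0 : ℝ) ∂P)) by rwa [h0] at h
  refine tendsto_integral_of_dominated_convergence (fun _ => t) (fun n => ?_)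
    (integrable_const _) (fun n => Eventually.of_forall fun ω => ?_)
    (Eventually.of_forall fun ω => tendsto_integral_missedExit hU t ω)
  · exact (StronglyMeasurable.integral_prod_right' (measurable_const.indicator
      (measurableSet_missedExit hU t n)).stronglyMeasurable).aestronglyMeasurable
  · refine (norm_integral_le_of_norm_le_const (C := 1) (Eventually.of_forall fun s => ?_)).trans ?_
    · refine (norm_indicator_le_norm_self _ _).trans ?_
      simp
    · simp

end Lyapunov

/-! ### The localized Lyapunov estimate. -/

section LocalLyapunov

variable {S : Type*} [TopologicalSpace S] [MeasurableSpace S]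

/-- `F` is a bounded continuous test function for `L` such that `F = f` and `L F ≤ c f` on the
closed set `U`, `F` is nonnegative, and `L F` is bounded from above. -/
structure IsLyapunovOn (L : (S → ℝ) → S → ℝ) (f : S → ℝ) (c : ℝ) (U : Set S) (F : S → ℝ) :
    Prop where
  isClosed : IsClosed U
  continuous : Continuous F
  integrable : ∀ (t : ℝ≥0) (ω : Path S),
    IntervalIntegrable (fun s : ℝ => L F (coord s.toNNReal ω)) volume 0 t
  bounded : ∃ K, ∀ x, |F x| ≤ K
  nonneg : ∀ x, 0 ≤ F x
  eqOn : ∀ x ∈ U, F x = f x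
  map_le : ∀ x ∈ U, L F x ≤ c * f x
  map_bounded : ∃ C, ∀ x, L F x ≤ C

/-- The paths which visit `U` at all grid points up to time `t`. -/
def visitsGrid (U : Set S) (t : ℝ≥0) : Set (Path S) :=
  {ω | ∀ n l, coord (gridPoint t n l) ω ∈ U}

variable [TopologicalSpace.PseudoMetrizableSpace S] [BorelSpace S]

omit [TopologicalSpace.PseudoMetrizableSpace S] [BorelSpace S] in
theorem measurableSet_visitsGrid {U : Set S} (hU : MeasurableSet U) (t : ℝ≥0) :
    MeasurableSet (visitsGrid U t) := by
  have : visitsGrid U t = ⋂ n, ⋂ l, (coord (gridPoint t n l)) ⁻¹' U := by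
    ext ω
    simp [visitsGrid]
  rw [this]
  exact MeasurableSet.iInter fun n => MeasurableSet.iInter fun l => measurable_coord _ hU

-- Whether all grid points up to j were in U is known at time θ_j, so each retained martingale
-- increment has mean zero.
open scoped Classical in
omit [TopologicalSpace.PseudoMetrizableSpace S] [BorelSpace S] in
theorem integral_stopped_increments {P : Measure (Path S)} [IsProbabilityMeasure P]
    {N : ℝ≥0 → Path S → ℝ} (hN : Martingale N (pathFiltration S) P) {U : Set S}
    (hU : MeasurableSet U) {θ : ℕ → ℝ≥0} (hθ : Monotone θ) (m : ℕ) :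
    Integrable (fun ω => ∑ j ∈ Finset.range m,
      (if ∀ l ≤ j, coord (θ l) ω ∈ U then N (θ (j + 1)) ω - N (θ j) ω else 0)) P ∧
    ∫ ω, ∑ j ∈ Finset.range m,
      (if ∀ l ≤ j, coord (θ l) ω ∈ U then N (θ (j + 1)) ω - N (θ j) ω else 0) ∂P = 0 := by
  set B : ℕ → Set (Path S) := fun j => {ω | ∀ l ≤ j, coord (θ l) ω ∈ U} with hB
  have hBm : ∀ j, MeasurableSet[pathFiltration S (θ j)] (B j) := fun j => by
    have : B j = ⋂ l, ⋂ (_ : l ≤ j), (coord (θ l)) ⁻¹' U := by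
      ext ω
      simp [hB]
    rw [this]
    exact MeasurableSet.iInter fun l => MeasurableSet.iInter fun hl =>
      rawFiltration_le_pathFiltration _ _ (measurable_coord_rawFiltration (hθ hl) hU)
  have hBm' : ∀ j, MeasurableSet (B j) := fun j => (pathFiltration S).le _ _ (hBm j)
  have he : ∀ j, (fun ω => if ∀ l ≤ j, coord (θ l) ω ∈ U then N (θ (j + 1)) ω - N (θ j) ω else 0) =
      (B j).indicator fun ω => N (θ (j + 1)) ω - N (θ j) ω := fun j => by
    funext ω
    rw [Set.indicator_apply]
    rfl
  have hint : ∀ j, Integrable (fun ω =>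
      if ∀ l ≤ j, coord (θ l) ω ∈ U then N (θ (j + 1)) ω - N (θ j) ω else 0) P := fun j => by
    rw [he]
    exact ((hN.integrable _).sub (hN.integrable _)).indicator (hBm' j)
  refine ⟨integrable_finsetSum _ fun j _ => hint j, ?_⟩
  rw [integral_finsetSum _ fun j _ => hint j]
  refine Finset.sum_eq_zero fun j _ => ?_
  rw [he, integral_indicator (hBm' j), integral_sub (hN.integrable _).integrableOn
    (hN.integrable _).integrableOn, hN.setIntegral_eq (hθ (Nat.le_succ j)) (hBm j), sub_self]

theorem intervalIntegrable_comp_coord {f : S → ℝ} (hf : Measurable f) {K : ℝ}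
    (hK : ∀ x, |f x| ≤ K) (ω : Path S) (a b : ℝ) :
    IntervalIntegrable (fun s : ℝ => f (coord s.toNNReal ω)) volume a b :=
  (intervalIntegrable_const (c := K)).mono_fun (measurable_comp_coord hf ω).aestronglyMeasurable
    (Eventually.of_forall fun _ => (hK _).trans (le_abs_self K))

/-- Pathwise form of the estimate, read at the first grid time outside U (or at t). Before it, L F ≤
c f while the path is in U, and L F ≤ C during undetected excursions. On A no exit is seen and F = f
at time t; off A the bound F ≥ 0 is enough. -/
theorem IsLyapunovOn.increments_ge {L : (S → ℝ) → S → ℝ} {f F : S → ℝ} {c C : ℝ} {U : Set S}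
    (h : IsLyapunovOn L f c U F) (hf : Measurable f) {K : ℝ} (hK : ∀ x, |f x| ≤ K)
    (hf0 : ∀ x, 0 ≤ f x) (hc : 0 ≤ c) (hC : 0 ≤ C) (hLC : ∀ x, L F x ≤ C) (t : ℝ≥0) (n : ℕ)
    (A : Set (Path S)) (ω : Path S) (u : ℝ≥0 → ℝ≥0) (hu : ∀ s, u s ≤ s)
    (hA : ω ∈ A → ω ∈ visitsGrid U t ∧ u t = t) {θ : ℝ≥0} {J m : ℕ} (hm : gridPoint t n m = t)
    (hθ : θ = gridPoint t n J) (hJ : ∀ l < J, coord (gridPoint t n l) ω ∈ U)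
    (hJm : J = m ∨ coord (gridPoint t n J) ω ∉ U) :
    A.indicator (fun ω => f (coord t ω)) ω - F (coord 0 ω) -
      c * (∫ s in (0 : ℝ)..t, f (coord s.toNNReal ω)) -
      C * (∫ s in Set.Ioc (0 : ℝ) t, (missedExit U t n).indicator (fun _ => (1 : ℝ)) (ω, s)) ≤
    mpProcess L F (u θ) ω := by
  have hθt : θ ≤ t := hθ ▸ gridPoint_le t n J
  have hT : ((u θ : ℝ≥0) : ℝ) ≤ t := NNReal.coe_le_coe.2 ((hu θ).trans hθt)
  have h1 : A.indicator (fun ω => f (coord t ω)) ω ≤ F (coord (u θ) ω) := by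
    by_cases hω : ω ∈ A
    · obtain ⟨hv, hut⟩ := hA hω
      have hJ' : J = m := hJm.resolve_right fun hn => hn (hv n J)
      have hθ' : θ = t := by rw [hθ, hJ', hm]
      have hU : coord t ω ∈ U := by
        have := hv n m
        rwa [hm] at this
      rw [Set.indicator_of_mem hω, hθ', hut, h.eqOn _ hU]
    · rw [Set.indicator_of_notMem hω]
      exact h.nonneg _
  set r : ℝ → ℝ := fun s => (missedExit U t n).indicator (fun _ => (1 : ℝ)) (ω, s) with hr
  have hr0 : ∀ s, 0 ≤ r s := fun s => Set.indicator_nonneg (fun _ _ => zero_le_one) _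
  have hrm : Measurable r := (measurable_const.indicator
    (measurableSet_missedExit h.isClosed t n)).comp (measurable_const.prodMk measurable_id)
  have hri : ∀ a b, IntervalIntegrable r volume a b := fun a b => by
    refine (intervalIntegrable_const (c := (1 : ℝ))).mono_fun hrm.aestronglyMeasurable
      (Eventually.of_forall fun s => ?_)
    exact (norm_indicator_le_norm_self _ _)
  have hfi := fun a b => intervalIntegrable_comp_coord hf hK ω a b
  have hgi : ∀ a b, IntervalIntegrable (fun s => c * f (coord s.toNNReal ω) + C * r s) volume a b :=
    fun a b => ((hfi a b).const_mul c).add ((hri a b).const_mul C)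
  have h2 : ∫ s in (0 : ℝ)..(u θ), L F (coord s.toNNReal ω) ≤
      ∫ s in (0 : ℝ)..(u θ), (c * f (coord s.toNNReal ω) + C * r s) := by
    refine intervalIntegral.integral_mono_on_of_le_Ioo (u θ).coe_nonneg (h.integrable _ ω)
      (hgi _ _) fun s hs => ?_
    by_cases hsU : coord s.toNNReal ω ∈ U
    · exact (h.map_le _ hsU).trans (le_add_of_nonneg_right (mul_nonneg hC (hr0 s)))
    -- All grid points up to s precede the J-th one and hence lie in U, so being outside U at s is a
    -- missed exit.
    · have hmem : (ω, s) ∈ missedExit U t n := by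
        refine ⟨fun l hl => hJ l ?_, hsU⟩
        by_contra hcon
        have h3 : θ ≤ s.toNNReal := by
          rw [hθ]
          exact (gridPoint_mono t n (not_lt.1 hcon)).trans hl
        have h4 : s.toNNReal < u θ := (Real.toNNReal_lt_iff_lt_coe hs.1.le).2 hs.2
        exact absurd (h3.trans_lt h4) (not_lt.2 (hu θ))
      have : r s = 1 := Set.indicator_of_mem hmem _
      rw [this, mul_one]
      exact (hLC _).trans (le_add_of_nonneg_left (mul_nonneg hc (hf0 _)))
  have h3 : ∫ s in (0 : ℝ)..(u θ), (c * f (coord s.toNNReal ω) + C * r s) ≤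
      ∫ s in (0 : ℝ)..t, (c * f (coord s.toNNReal ω) + C * r s) :=
    intervalIntegral.integral_mono_interval le_rfl (u θ).coe_nonneg hT
      (Eventually.of_forall fun s => add_nonneg (mul_nonneg hc (hf0 _)) (mul_nonneg hC (hr0 s)))
      (hgi _ _)
  have h4 := intervalIntegral.integral_add ((hfi 0 t).const_mul c) ((hri 0 t).const_mul C)
  rw [intervalIntegral.integral_const_mul, intervalIntegral.integral_const_mul,
    intervalIntegral.integral_of_le (f := r) t.coe_nonneg] at h4
  unfold mpProcess
  linarith

theorem measurable_integral_comp_coord {f : S → ℝ} (hf : Measurable f) (P : Measure (Path S))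
    [IsProbabilityMeasure P] : Measurable fun s : ℝ => ∫ ω, f (coord s.toNNReal ω) ∂P :=
  (StronglyMeasurable.integral_prod_right' (f := fun p : ℝ × Path S => f (coord p.1.toNNReal p.2))
    (hf.comp measurable_coord_toNNReal).stronglyMeasurable).measurable

theorem integral_integral_comp_coord {f : S → ℝ} (hf : Measurable f) {K : ℝ}
    (hK : ∀ x, |f x| ≤ K) (P : Measure (Path S)) [IsProbabilityMeasure P] (t : ℝ≥0) :
    Integrable (fun ω => ∫ s in (0 : ℝ)..t, f (coord s.toNNReal ω)) P ∧
    ∫ ω, (∫ s in (0 : ℝ)..t, f (coord s.toNNReal ω)) ∂P =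
      ∫ s in (0 : ℝ)..t, ∫ ω, f (coord s.toNNReal ω) ∂P := by
  simp_rw [intervalIntegral.integral_of_le t.coe_nonneg]
  have hint : Integrable (fun p : Path S × ℝ => f (coord p.2.toNNReal p.1))
      (P.prod (volume.restrict (Set.Ioc (0 : ℝ) t))) :=
    Integrable.of_bound (hf.comp measurable_coord_toNNReal_swap).aestronglyMeasurable K
      (Eventually.of_forall fun p => hK _)
  exact ⟨hint.integral_prod_left, integral_integral_swap hint⟩

/-- Taking expectations in the pathwise bound makes the martingale part vanish. An upper bound on L
F suffices, and the localizing sequence supplies integrability; so L F may be unbounded below. -/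
theorem IsLyapunovOn.integral_le {L : (S → ℝ) → S → ℝ} {f F : S → ℝ} {c : ℝ} {U : Set S}
    (h : IsLyapunovOn L f c U F) (hf : Measurable f) {K : ℝ} (hK : ∀ x, |f x| ≤ K)
    (hf0 : ∀ x, 0 ≤ f x) (hc : 0 ≤ c) {P : Measure (Path S)} [IsProbabilityMeasure P]
    (hP : Locally (fun M : ℝ≥0 → Path S → ℝ => Martingale M (pathFiltration S) P)
      (pathFiltration S) (mpProcess L F) P) {x₀ : S} (hx₀ : ∀ᵐ ω ∂P, coord 0 ω = x₀) (t : ℝ≥0) :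
    ∫ ω, (visitsGrid U t).indicator (fun ω => f (coord t ω)) ω ∂P ≤
      F x₀ + c * ∫ s in (0 : ℝ)..t, ∫ ω, f (coord s.toNNReal ω) ∂P := by
  classical
  obtain ⟨τ, hτ, hM⟩ := hP
  obtain ⟨C', hC'⟩ := h.map_bounded
  obtain ⟨C, hC, hLC⟩ : ∃ C, 0 ≤ C ∧ ∀ x, L F x ≤ C :=
    ⟨max C' 0, le_max_right _ _, fun x => (hC' x).trans (le_max_left _ _)⟩
  obtain ⟨hIint, hIeq⟩ := integral_integral_comp_coord hf hK P t
  have hVm := measurableSet_visitsGrid h.isClosed.measurableSet t (S := S)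
  have hft : Measurable fun ω : Path S => f (coord t ω) := hf.comp (measurable_coord t)
  have hbd : ∀ (A : Set (Path S)) ω, ‖A.indicator (fun ω => f (coord t ω)) ω‖ ≤ K := fun A ω =>
    (norm_indicator_le_norm_self _ _).trans (hK _)
  have hτm : ∀ k, MeasurableSet {ω | (t : WithTop ℝ≥0) ≤ τ k ω} := fun k => by
    have h1 := (hτ.isStoppingTime k).measurableSet_lt t
    have h2 := ((pathFiltration S).le t _ h1).compl
    convert h2 using 1
    ext ω
    exact (not_lt (a := τ k ω) (b := (t : WithTop ℝ≥0))).symm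
  set A : ℕ → Set (Path S) := fun k => visitsGrid U t ∩ {ω | (t : WithTop ℝ≥0) ≤ τ k ω} with hAdef
  have hAm : ∀ k, MeasurableSet (A k) := fun k => hVm.inter (hτm k)
  have hFint : ∫ ω, F (coord 0 ω) ∂P = F x₀ := by
    have : (fun ω => F (coord 0 ω)) =ᵐ[P] fun _ => F x₀ := by
      filter_upwards [hx₀] with ω hω
      rw [hω]
    rw [integral_congr_ae this]
    simp
  obtain ⟨KF, hKF⟩ := h.bounded
  have hFi : Integrable (fun ω => F (coord 0 ω)) P :=
    Integrable.of_bound (h.continuous.measurable.comp (measurable_coord 0)).aestronglyMeasurable KF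
      (Eventually.of_forall fun ω => hKF _)
  have step : ∀ k n, ∫ ω, (A k).indicator (fun ω => f (coord t ω)) ω ∂P ≤
      F x₀ + c * (∫ s in (0 : ℝ)..t, ∫ ω, f (coord s.toNNReal ω) ∂P) +
      C * ∫ ω, (∫ s in Set.Ioc (0 : ℝ) t,
        (missedExit U t n).indicator (fun _ => (1 : ℝ)) (ω, s)) ∂P := by
    intro k n
    obtain ⟨hSi, hS0⟩ := integral_stopped_increments (hM k) h.isClosed.measurableSet
      (gridPoint_mono t n) (⌈t⌉₊ * (n + 1))
    have hRi : Integrable (fun ω => ∫ s in Set.Ioc (0 : ℝ) t,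
        (missedExit U t n).indicator (fun _ => (1 : ℝ)) (ω, s)) P := by
      refine Integrable.integral_prod_left (f := (missedExit U t n).indicator (fun _ => (1 : ℝ)))
        (Integrable.of_bound (measurable_const.indicator
          (measurableSet_missedExit h.isClosed t n)).aestronglyMeasurable 1
          (Eventually.of_forall fun p => ?_))
      refine (norm_indicator_le_norm_self _ _).trans ?_
      simp
    have hAi : Integrable ((A k).indicator fun ω => f (coord t ω)) P :=
      Integrable.of_bound (hft.indicator (hAm k)).aestronglyMeasurable K
        (Eventually.of_forall (hbd _))
    have hAF : Integrable (fun ω => (A k).indicator (fun ω => f (coord t ω)) ω - F (coord 0 ω)) P :=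
      hAi.sub hFi
    have hAFI : Integrable (fun ω => (A k).indicator (fun ω => f (coord t ω)) ω - F (coord 0 ω) -
        c * (∫ s in (0 : ℝ)..t, f (coord s.toNNReal ω))) P := hAF.sub (hIint.const_mul c)
    have hle := integral_mono (hAFI.sub (hRi.const_mul C)) hSi
      fun ω => by
        obtain ⟨u, hu1, hu2, hu3, hu4⟩ := exists_stoppedProcess_mp L F (τ k) ω
        obtain ⟨J, hJ, hJ1, hJ2, hJ3⟩ := exists_telescope
          (fun l => coord (gridPoint t n l) ω ∈ U)
          (fun j => stoppedProcess (fun i => {ω | ⊥ < τ k ω}.indicator (mpProcess L F i)) (τ k)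
            (gridPoint t n j) ω) (⌈t⌉₊ * (n + 1))
        refine le_trans ?_ hJ3.ge
        rw [hu4, hu4, gridPoint_zero, hu3, mpProcess_zero, sub_zero]
        exact h.increments_ge hf hK hf0 hc hC hLC t n (A k) ω u hu1
          (fun hω => ⟨hω.1, hu2 t hω.2⟩) (gridPoint_last t n) rfl hJ1 hJ2
    rw [hS0] at hle
    simp only [Pi.sub_apply] at hle
    rw [integral_sub hAFI (hRi.const_mul C), integral_sub hAF (hIint.const_mul c), integral_sub hAi hFi, hFint,
      integral_const_mul, integral_const_mul, hIeq] at hle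
    linarith
  have step2 : ∀ k, ∫ ω, (A k).indicator (fun ω => f (coord t ω)) ω ∂P ≤
      F x₀ + c * (∫ s in (0 : ℝ)..t, ∫ ω, f (coord s.toNNReal ω) ∂P) := by
    intro k
    -- The mesh goes to 0 with the localizing index k fixed; k goes to infinity afterwards.
    have hl := ((tendsto_integral_integral_missedExit h.isClosed t P).const_mul C).const_add
      (F x₀ + c * (∫ s in (0 : ℝ)..t, ∫ ω, f (coord s.toNNReal ω) ∂P))
    rw [mul_zero, add_zero] at hl
    exact ge_of_tendsto' hl (step k)
  refine le_of_tendsto' (f := fun k => ∫ ω, (A k).indicator (fun ω => f (coord t ω)) ω ∂P)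
    (x := atTop) ?_ step2
  refine tendsto_integral_of_dominated_convergence (fun _ => K)
    (fun k => (hft.indicator (hAm k)).aestronglyMeasurable) (integrable_const _)
    (fun k => Eventually.of_forall (hbd _)) ?_
  filter_upwards [hτ.tendsto_top] with ω hω
  refine tendsto_const_nhds.congr' ?_
  have : ∀ᶠ n in atTop, (t : WithTop ℝ≥0) < τ n ω :=
    Tendsto.eventually_const_lt (WithTop.coe_lt_top t) hω
  filter_upwards [this] with k hk
  by_cases hv : ω ∈ visitsGrid U t
  · rw [Set.indicator_of_mem hv, Set.indicator_of_mem (show ω ∈ A k from ⟨hv, hk.le⟩)]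
  · rw [Set.indicator_of_notMem hv, Set.indicator_of_notMem fun hA => hv hA.1]

/-- A localized Lyapunov estimate for solutions of martingale problems. -/
theorem integral_le_exp_mul {L : (S → ℝ) → S → ℝ} {f : S → ℝ} {c : ℝ} (hf : Measurable f) {K : ℝ}
    (hK : ∀ x, |f x| ≤ K) (hf0 : ∀ x, 0 ≤ f x) (hc : 0 ≤ c) {U : ℕ → Set S} {F : ℕ → S → ℝ}
    (h : ∀ n, IsLyapunovOn L f c (U n) (F n)) {P : Measure (Path S)} [IsProbabilityMeasure P]
    (hP : ∀ n, Locally (fun M : ℝ≥0 → Path S → ℝ => Martingale M (pathFiltration S) P)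
      (pathFiltration S) (mpProcess L (F n)) P) {x₀ : S} (hx₀ : ∀ᵐ ω ∂P, coord 0 ω = x₀)
    (hx₀U : ∀ᶠ n in atTop, x₀ ∈ U n)
    (hU : ∀ᵐ ω ∂P, ∀ t : ℝ≥0, ∀ᶠ n in atTop, ∀ s ≤ t, coord s ω ∈ U n) (t : ℝ≥0) :
    ∫ ω, f (coord t ω) ∂P ≤ f x₀ * Real.exp (c * t) := by
  have key : ∀ t : ℝ≥0, ∫ ω, f (coord t ω) ∂P ≤
      f x₀ + c * ∫ s in (0 : ℝ)..t, ∫ ω, f (coord s.toNNReal ω) ∂P := by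
    intro t
    have hlim : Tendsto (fun n => ∫ ω, (visitsGrid (U n) t).indicator (fun ω => f (coord t ω)) ω ∂P)
        atTop (𝓝 (∫ ω, f (coord t ω) ∂P)) := by
      refine tendsto_integral_of_dominated_convergence (fun _ => K)
        (fun n => ((hf.comp (measurable_coord t)).indicator (measurableSet_visitsGrid
          (h n).isClosed.measurableSet t)).aestronglyMeasurable) (integrable_const _)
        (fun n => Eventually.of_forall fun ω => (norm_indicator_le_norm_self _ _).trans (hK _)) ?_
      filter_upwards [hU] with ω hω
      refine tendsto_const_nhds.congr' ?_
      filter_upwards [hω t] with n hn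
      rw [Set.indicator_of_mem]
      exact fun k l => hn _ (gridPoint_le t k l)
    refine le_of_tendsto hlim ?_
    filter_upwards [hx₀U] with n hn
    rw [← (h n).eqOn x₀ hn]
    exact (h n).integral_le hf hK hf0 hc (hP n) hx₀ t
  have := le_mul_exp_of_le_add_integral (u := fun s => ∫ ω, f (coord s.toNNReal ω) ∂P)
    (measurable_integral_comp_coord hf P) (K := K)
    (fun s => by
      refine (norm_integral_le_of_norm_le_const (C := K)
        (f := fun ω => f (coord s.toNNReal ω)) (Eventually.of_forall fun ω => (hK (coord s.toNNReal ω)))).trans ?_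
      simp)
    hc (A := f x₀) (fun s hs => by
      have := key s.toNNReal
      rwa [Real.coe_toNNReal s hs] at this) t.coe_nonneg
  rwa [Real.toNNReal_coe] at this

end LocalLyapunov

/-! ### Calculus for functions of ‖x‖²/2. -/

section Radial

variable {d : ℕ}

/-- The inner product as a continuous bilinear map. -/
def innerCLM (d : ℕ) : EuclideanSpace ℝ (Fin d) →L[ℝ] EuclideanSpace ℝ (Fin d) →L[ℝ] ℝ := innerSL ℝ

theorem innerCLM_apply (x y : EuclideanSpace ℝ (Fin d)) : innerCLM d x y = inner ℝ x y := rfl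

theorem hasFDerivAt_half_norm_sq (x : EuclideanSpace ℝ (Fin d)) :
    HasFDerivAt (fun x : EuclideanSpace ℝ (Fin d) => ‖x‖ ^ 2 / 2) (innerCLM d x) x := by
  have h := ((hasStrictFDerivAt_norm_sq x).hasFDerivAt).mul_const (1 / 2 : ℝ)
  have e : (fun x : EuclideanSpace ℝ (Fin d) => ‖x‖ ^ 2 / 2) = fun x => ‖x‖ ^ 2 * (1 / 2) := by
    funext x
    ring
  rw [e]
  refine h.congr_fderiv ?_
  ext v
  simp [innerCLM_apply]

/-- `φ` is twice continuously differentiable on `(-1, ∞)` with derivatives `φ₁` and `φ₂`. -/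
structure IsProfile (φ φ₁ φ₂ : ℝ → ℝ) : Prop where
  hasDerivAt : ∀ r, -1 < r → HasDerivAt φ (φ₁ r) r
  hasDerivAt_deriv : ∀ r, -1 < r → HasDerivAt φ₁ (φ₂ r) r
  continuousOn : ContinuousOn φ₂ (Set.Ioi (-1))

variable {φ φ₁ φ₂ : ℝ → ℝ}

theorem neg_one_lt_half_norm_sq (x : EuclideanSpace ℝ (Fin d)) : -1 < ‖x‖ ^ 2 / 2 :=
  neg_one_lt_zero.trans_le (by positivity)

theorem IsProfile.hasFDerivAt (h : IsProfile φ φ₁ φ₂) (x : EuclideanSpace ℝ (Fin d)) :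
    HasFDerivAt (fun x : EuclideanSpace ℝ (Fin d) => φ (‖x‖ ^ 2 / 2))
      (φ₁ (‖x‖ ^ 2 / 2) • innerCLM d x) x :=
  (h.hasDerivAt _ (neg_one_lt_half_norm_sq x)).comp_hasFDerivAt x (hasFDerivAt_half_norm_sq x)

theorem IsProfile.hasFDerivAt_fderiv (h : IsProfile φ φ₁ φ₂) (x : EuclideanSpace ℝ (Fin d)) :
    HasFDerivAt (fun x : EuclideanSpace ℝ (Fin d) => φ₁ (‖x‖ ^ 2 / 2) • innerCLM d x)
      (φ₁ (‖x‖ ^ 2 / 2) • innerCLM d +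
        (φ₂ (‖x‖ ^ 2 / 2) • innerCLM d x).smulRight (innerCLM d x)) x :=
  ((h.hasDerivAt_deriv _ (neg_one_lt_half_norm_sq x)).comp_hasFDerivAt x
    (hasFDerivAt_half_norm_sq x)).smul (innerCLM d).hasFDerivAt

theorem IsProfile.fderiv_eq (h : IsProfile φ φ₁ φ₂) :
    fderiv ℝ (fun x : EuclideanSpace ℝ (Fin d) => φ (‖x‖ ^ 2 / 2)) =
      fun x => φ₁ (‖x‖ ^ 2 / 2) • innerCLM d x :=
  funext fun x => (h.hasFDerivAt x).fderiv

theorem IsProfile.continuous_snd (h : IsProfile φ φ₁ φ₂) :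
    Continuous fun x : EuclideanSpace ℝ (Fin d) => φ₂ (‖x‖ ^ 2 / 2) :=
  h.continuousOn.comp_continuous (by fun_prop) fun x => neg_one_lt_half_norm_sq x

theorem IsProfile.continuous_fst (h : IsProfile φ φ₁ φ₂) :
    Continuous fun x : EuclideanSpace ℝ (Fin d) => φ₁ (‖x‖ ^ 2 / 2) :=
  continuous_iff_continuousAt.2 fun x =>
    ((h.hasDerivAt_deriv _ (neg_one_lt_half_norm_sq x)).continuousAt.comp
      (f := fun x : EuclideanSpace ℝ (Fin d) => ‖x‖ ^ 2 / 2) (by fun_prop))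

theorem IsProfile.continuous (h : IsProfile φ φ₁ φ₂) :
    Continuous fun x : EuclideanSpace ℝ (Fin d) => φ (‖x‖ ^ 2 / 2) :=
  continuous_iff_continuousAt.2 fun x => (h.hasFDerivAt x).continuousAt

theorem exists_norm_le_of_eq_const {V : Type*} [NormedAddCommGroup V]
    {g : EuclideanSpace ℝ (Fin d) → V} (hg : Continuous g) (v : V) (R : ℝ)
    (h : ∀ x, R < ‖x‖ → g x = v) : ∃ M, ∀ x, ‖g x‖ ≤ M := by
  obtain ⟨C, hC⟩ := (isCompact_closedBall (0 : EuclideanSpace ℝ (Fin d)) R).exists_bound_of_continuousOn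
    hg.continuousOn
  refine ⟨max C ‖v‖, fun x => ?_⟩
  rcases le_or_gt ‖x‖ R with hx | hx
  · exact (hC x (by simpa using hx)).trans (le_max_left _ _)
  · rw [h x hx]; exact le_max_right _ _

set_option synthInstance.maxHeartbeats 200000 in
theorem IsProfile.mem_Cb2 (h : IsProfile φ φ₁ φ₂) {R : ℝ} (hR : 0 ≤ R)
    (h0 : ∀ r, R ≤ r → φ r = φ R) (h1 : ∀ r, R ≤ r → φ₁ r = 0) (h2 : ∀ r, R ≤ r → φ₂ r = 0) :
    (fun x : EuclideanSpace ℝ (Fin d) => φ (‖x‖ ^ 2 / 2)) ∈ Cb2 d := by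
  have hbig : ∀ x : EuclideanSpace ℝ (Fin d), 2 * R + 1 < ‖x‖ → R ≤ ‖x‖ ^ 2 / 2 := fun x hx => by
    nlinarith
  have hc1 : Continuous fun x : EuclideanSpace ℝ (Fin d) => φ₁ (‖x‖ ^ 2 / 2) • innerCLM d x :=
    continuous_iff_continuousAt.2 fun x => (h.hasFDerivAt_fderiv x).continuousAt
  have hc2 : Continuous fun x : EuclideanSpace ℝ (Fin d) => φ₁ (‖x‖ ^ 2 / 2) • innerCLM d +
        (φ₂ (‖x‖ ^ 2 / 2) • innerCLM d x).smulRight (innerCLM d x) := by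
    have e : Continuous fun x : EuclideanSpace ℝ (Fin d) => innerCLM d x := (innerCLM d).continuous
    exact (h.continuous_fst.smul continuous_const).add
      (((ContinuousLinearMap.smulRightL ℝ (EuclideanSpace ℝ (Fin d))
        (EuclideanSpace ℝ (Fin d) →L[ℝ] ℝ)).continuous.comp (h.continuous_snd.smul e)).clm_apply e)
  refine ⟨?_, ?_⟩
  · have e1 : ContDiff ℝ (0 + 1) fun x : EuclideanSpace ℝ (Fin d) =>
        φ₁ (‖x‖ ^ 2 / 2) • innerCLM d x :=
      contDiff_succ_iff_hasFDerivAt.2 ⟨_, contDiff_zero.2 hc2, h.hasFDerivAt_fderiv⟩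
    have e2 : ContDiff ℝ (1 + 1) fun x : EuclideanSpace ℝ (Fin d) => φ (‖x‖ ^ 2 / 2) :=
      contDiff_succ_iff_hasFDerivAt.2 ⟨_, by simpa using e1, h.hasFDerivAt⟩
    have e3 : (1 + 1 : WithTop ℕ∞) = 2 := one_add_one_eq_two
    rwa [e3] at e2
  · obtain ⟨M0, hM0⟩ := exists_norm_le_of_eq_const (h.continuous (d := d)) (φ R) (2 * R + 1)
      fun x hx => h0 _ (hbig x hx)
    obtain ⟨M1, hM1⟩ := exists_norm_le_of_eq_const hc1 0 (2 * R + 1)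
      fun x hx => by rw [h1 _ (hbig x hx), zero_smul]
    obtain ⟨M2, hM2⟩ := exists_norm_le_of_eq_const hc2
      (0 : EuclideanSpace ℝ (Fin d) →L[ℝ] EuclideanSpace ℝ (Fin d) →L[ℝ] ℝ) (2 * R + 1)
      fun x hx => by
        rw [h1 _ (hbig x hx), h2 _ (hbig x hx)]
        ext v w
        simp
    refine ⟨max M0 (max M1 M2), fun x => ⟨(hM0 x).trans (le_max_left _ _), ?_, ?_⟩⟩
    · rw [h.fderiv_eq]
      exact (hM1 x).trans ((le_max_left _ _).trans (le_max_right _ _))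
    · rw [h.fderiv_eq, (h.hasFDerivAt_fderiv x).fderiv]
      exact (hM2 x).trans ((le_max_right _ _).trans (le_max_right _ _))

variable {Sd : Type*}

/-- The gradient is φ' x and the Hessian is φ' I + φ'' x xᵀ. -/
theorem IsProfile.diffusionOp_eq (h : IsProfile φ φ₁ φ₂) (b : State d Sd → EuclideanSpace ℝ (Fin d))
    (a : State d Sd → Matrix (Fin d) (Fin d) ℝ) (z : State d Sd) :
    diffusionOp b a (fun z => φ (‖z.1‖ ^ 2 / 2)) z =
      φ₁ (‖z.1‖ ^ 2 / 2) * inner ℝ z.1 (b z) + 1 / 2 * (φ₁ (‖z.1‖ ^ 2 / 2) * (a z).trace +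
        φ₂ (‖z.1‖ ^ 2 / 2) * (z.1.ofLp ⬝ᵥ (a z).mulVec z.1.ofLp)) := by
  have hgrad : HasGradientAt (fun x : EuclideanSpace ℝ (Fin d) => φ (‖x‖ ^ 2 / 2))
      (φ₁ (‖z.1‖ ^ 2 / 2) • z.1) z.1 := by
    rw [hasGradientAt_iff_hasFDerivAt]
    refine (h.hasFDerivAt z.1).congr_fderiv ?_
    ext v
    simp [innerCLM_apply]
  have hhess : hessian (fun x : EuclideanSpace ℝ (Fin d) => φ (‖x‖ ^ 2 / 2)) z.1 =
      φ₁ (‖z.1‖ ^ 2 / 2) • (1 : Matrix (Fin d) (Fin d) ℝ) +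
        φ₂ (‖z.1‖ ^ 2 / 2) • Matrix.vecMulVec z.1.ofLp z.1.ofLp := by
    refine Matrix.ext fun k l => ?_
    rw [hessian, Matrix.of_apply, h.fderiv_eq, (h.hasFDerivAt_fderiv z.1).fderiv]
    simp [Matrix.one_apply, Matrix.vecMulVec_apply, EuclideanSpace.inner_single_right, innerCLM_apply]
    rw [mul_assoc]
    congr 1
    exact if_congr eq_comm rfl rfl
  rw [diffusionOp, hgrad.gradient, hhess, inner_smul_left, add_mul, Matrix.trace_add,
    Matrix.smul_mul, Matrix.smul_mul, one_mul, Matrix.trace_smul, Matrix.trace_smul]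
  have : (Matrix.vecMulVec z.1.ofLp z.1.ofLp * a z).trace =
      z.1.ofLp ⬝ᵥ (a z).mulVec z.1.ofLp := by
    simp only [Matrix.trace, Matrix.diag, Matrix.mul_apply, Matrix.vecMulVec_apply, dotProduct,
      Matrix.mulVec, Finset.mul_sum]
    rw [Finset.sum_comm]
    refine Finset.sum_congr rfl fun k _ => Finset.sum_congr rfl fun l _ => ?_
    ring
  rw [this]
  simp

theorem switchingOp_comp_fst {b : State d Sd → EuclideanSpace ℝ (Fin d)}
    {a : State d Sd → Matrix (Fin d) (Fin d) ℝ} {Q : EuclideanSpace ℝ (Fin d) → Sd → Sd → ℝ}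
    (hQ : ∀ x, IsConservativeQMatrix (Q x)) (f : EuclideanSpace ℝ (Fin d) → ℝ) (z : State d Sd) :
    switchingOp b a Q (fun z => f z.1) z = diffusionOp b a (fun z => f z.1) z := by
  have h : ∑' j, Q z.1 z.2 j * f z.1 = 0 := by
    rw [tsum_mul_right, ((hQ z.1).hasSum_row z.2).tsum_eq, zero_mul]
  rw [switchingOp, h, add_zero]

theorem switchingOp_comp_snd (b : State d Sd → EuclideanSpace ℝ (Fin d))
    (a : State d Sd → Matrix (Fin d) (Fin d) ℝ) (Q : EuclideanSpace ℝ (Fin d) → Sd → Sd → ℝ)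
    (g : Sd → ℝ) (z : State d Sd) :
    switchingOp b a Q (fun z => g z.2) z = matrixOp (Q z.1) g z.2 := by
  have h1 : gradient (fun _ : EuclideanSpace ℝ (Fin d) => g z.2) z.1 = 0 := by simp
  have h2 : hessian (fun _ : EuclideanSpace ℝ (Fin d) => g z.2) z.1 = 0 := by
    ext k l
    simp [hessian]
  rw [switchingOp, diffusionOp, h1, h2]
  simp [matrixOp]

end Radial

/-! ### Cutting off the derivative of a profile. -/

section Truncation

variable {φ φ₁ φ₂ : ℝ → ℝ}

/-- A smooth cutoff function: equal to `1` below `n` and to `0` above `n + 1`. -/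
def cutoff (n r : ℝ) : ℝ := Real.smoothTransition (n + 1 - r)

/-- The derivative of the cutoff function. -/
def cutoffDeriv (n r : ℝ) : ℝ := -deriv Real.smoothTransition (n + 1 - r)

theorem hasDerivAt_cutoff (n r : ℝ) : HasDerivAt (cutoff n) (cutoffDeriv n r) r := by
  have h1 : HasDerivAt Real.smoothTransition (deriv Real.smoothTransition (n + 1 - r))
      (n + 1 - r) :=
    ((Real.smoothTransition.contDiff (n := 1)).differentiable one_ne_zero _).hasDerivAt
  have h2 : HasDerivAt (fun r => n + 1 - r) (-1) r := by
    simpa using (hasDerivAt_id r).const_sub (n + 1)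
  refine (h1.comp r h2).congr_deriv ?_
  rw [cutoffDeriv]
  ring

theorem continuous_cutoff (n : ℝ) : Continuous (cutoff n) :=
  continuous_iff_continuousAt.2 fun r => (hasDerivAt_cutoff n r).continuousAt

theorem continuous_cutoffDeriv (n : ℝ) : Continuous (cutoffDeriv n) :=
  (((Real.smoothTransition.contDiff (n := 1)).continuous_deriv le_rfl).comp
    (continuous_const.sub continuous_id)).neg

theorem cutoff_nonneg (n r : ℝ) : 0 ≤ cutoff n r := Real.smoothTransition.nonneg _

theorem cutoff_le_one (n r : ℝ) : cutoff n r ≤ 1 := Real.smoothTransition.le_one _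

theorem cutoff_of_le {n r : ℝ} (h : r ≤ n) : cutoff n r = 1 :=
  Real.smoothTransition.one_of_one_le (by linarith)

theorem cutoff_of_ge {n r : ℝ} (h : n + 1 ≤ r) : cutoff n r = 0 :=
  Real.smoothTransition.zero_of_nonpos (by linarith)

theorem cutoffDeriv_of_gt {n r : ℝ} (h : n + 1 < r) : cutoffDeriv n r = 0 := by
  have : cutoff n =ᶠ[𝓝 r] fun _ => 0 := by
    filter_upwards [Ioi_mem_nhds h] with s hs
    exact cutoff_of_ge (le_of_lt hs)
  exact (hasDerivAt_cutoff n r).unique ((hasDerivAt_const r (0 : ℝ)).congr_of_eventuallyEq this)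

theorem cutoffDeriv_of_lt {n r : ℝ} (h : r < n) : cutoffDeriv n r = 0 := by
  have : cutoff n =ᶠ[𝓝 r] fun _ => 1 := by
    filter_upwards [Iio_mem_nhds h] with s hs
    exact cutoff_of_le (le_of_lt hs)
  exact (hasDerivAt_cutoff n r).unique ((hasDerivAt_const r (1 : ℝ)).congr_of_eventuallyEq this)

/-- The endpoint, reached by continuity, matters: the set on which the truncated profile must behave
like φ is closed. -/
theorem cutoffDeriv_of_le {n r : ℝ} (h : r ≤ n) : cutoffDeriv n r = 0 := by
  rcases h.lt_or_eq with h | rfl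
  · exact cutoffDeriv_of_lt h
  · refine tendsto_nhds_unique (((continuous_cutoffDeriv r).tendsto r).mono_left
      (nhdsWithin_le_nhds (s := Set.Iio r))) (tendsto_const_nhds.congr' ?_)
    filter_upwards [self_mem_nhdsWithin] with s hs
    exact (cutoffDeriv_of_lt hs).symm

theorem cutoffDeriv_of_ge {n r : ℝ} (h : n + 1 ≤ r) : cutoffDeriv n r = 0 := by
  rcases h.lt_or_eq with h | rfl
  · exact cutoffDeriv_of_gt h
  · refine tendsto_nhds_unique (((continuous_cutoffDeriv n).tendsto (n + 1)).mono_left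
      (nhdsWithin_le_nhds (s := Set.Ioi (n + 1)))) (tendsto_const_nhds.congr' ?_)
    filter_upwards [self_mem_nhdsWithin] with s hs
    exact (cutoffDeriv_of_gt hs).symm

/-- The profile whose derivative is cut off beyond `n`. -/
def truncated (φ φ₁ : ℝ → ℝ) (n r : ℝ) : ℝ := φ 0 + ∫ s in (0 : ℝ)..r, cutoff n s * φ₁ s

theorem IsProfile.continuousOn_deriv (h : IsProfile φ φ₁ φ₂) : ContinuousOn φ₁ (Set.Ioi (-1)) :=
  fun r hr => (h.hasDerivAt_deriv r hr).continuousAt.continuousWithinAt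

theorem IsProfile.intervalIntegrable_cutoff (h : IsProfile φ φ₁ φ₂) (n : ℝ) {r s : ℝ}
    (hr : -1 < r) (hs : -1 < s) :
    IntervalIntegrable (fun s => cutoff n s * φ₁ s) volume r s := by
  refine ContinuousOn.intervalIntegrable ?_
  refine ((continuous_cutoff n).continuousOn.mul h.continuousOn_deriv).mono fun x hx => ?_
  exact lt_of_lt_of_le (lt_min hr hs) hx.1

theorem IsProfile.intervalIntegrable (h : IsProfile φ φ₁ φ₂) {r s : ℝ}
    (hr : -1 < r) (hs : -1 < s) : IntervalIntegrable φ₁ volume r s :=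
  ContinuousOn.intervalIntegrable
    (h.continuousOn_deriv.mono fun _ hx => lt_of_lt_of_le (lt_min hr hs) hx.1)

theorem IsProfile.integral_deriv (h : IsProfile φ φ₁ φ₂) {r s : ℝ} (hr : -1 < r) (hs : -1 < s) :
    ∫ x in r..s, φ₁ x = φ s - φ r :=
  intervalIntegral.integral_eq_sub_of_hasDerivAt
    (fun x hx => h.hasDerivAt x (lt_of_lt_of_le (lt_min hr hs) hx.1)) (h.intervalIntegrable hr hs)

theorem IsProfile.isProfile_truncated (h : IsProfile φ φ₁ φ₂) (n : ℝ) :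
    IsProfile (truncated φ φ₁ n) (fun r => cutoff n r * φ₁ r)
      (fun r => cutoffDeriv n r * φ₁ r + cutoff n r * φ₂ r) where
  hasDerivAt r hr := by
    have hc : ContinuousOn (fun s => cutoff n s * φ₁ s) (Set.Ioi (-1)) :=
      (continuous_cutoff n).continuousOn.mul h.continuousOn_deriv
    exact (intervalIntegral.integral_hasDerivAt_right
      (h.intervalIntegrable_cutoff n neg_one_lt_zero hr)
      (hc.stronglyMeasurableAtFilter isOpen_Ioi r hr)
      (hc.continuousAt (Ioi_mem_nhds hr))).const_add (φ 0)
  hasDerivAt_deriv r hr := (hasDerivAt_cutoff n r).mul (h.hasDerivAt_deriv r hr)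
  continuousOn := ((continuous_cutoffDeriv n).continuousOn.mul h.continuousOn_deriv).add
    ((continuous_cutoff n).continuousOn.mul h.continuousOn)

theorem IsProfile.truncated_of_le (h : IsProfile φ φ₁ φ₂) {n r : ℝ} (hr : 0 ≤ r) (hrn : r ≤ n) :
    truncated φ φ₁ n r = φ r := by
  have h1 : -1 < r := neg_one_lt_zero.trans_le hr
  rw [truncated, intervalIntegral.integral_congr (g := φ₁), h.integral_deriv neg_one_lt_zero h1]
  · ring
  · intro s hs
    rw [Set.uIcc_of_le hr] at hs
    simp only
    rw [cutoff_of_le (hs.2.trans hrn), one_mul]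

theorem IsProfile.truncated_of_ge (h : IsProfile φ φ₁ φ₂) {n r : ℝ} (hn : 0 ≤ n)
    (hr : n + 1 ≤ r) : truncated φ φ₁ n r = truncated φ φ₁ n (n + 1) := by
  have h1 : -1 < r := by linarith
  have h2 : -1 < n + 1 := by linarith
  rw [truncated, truncated, ← intervalIntegral.integral_add_adjacent_intervals
    (h.intervalIntegrable_cutoff n neg_one_lt_zero h2) (h.intervalIntegrable_cutoff n h2 h1),
    intervalIntegral.integral_congr (a := n + 1) (g := fun _ => 0)]
  · simp
  · intro s hs
    rw [Set.uIcc_of_le hr] at hs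
    simp only
    rw [cutoff_of_ge hs.1, zero_mul]

/-- Damping a nonpositive derivative can only raise the function. Truncating φ' instead of φ thus
keeps the truncation positive and decreasing. -/
theorem IsProfile.le_truncated (h : IsProfile φ φ₁ φ₂) (hneg : ∀ r, 0 ≤ r → φ₁ r ≤ 0) (n : ℝ)
    {r : ℝ} (hr : 0 ≤ r) : φ r ≤ truncated φ φ₁ n r := by
  have h1 : -1 < r := neg_one_lt_zero.trans_le hr
  have h2 := h.integral_deriv neg_one_lt_zero h1
  have h3 : ∫ x in (0 : ℝ)..r, φ₁ x ≤ ∫ x in (0 : ℝ)..r, cutoff n x * φ₁ x :=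
    intervalIntegral.integral_mono_on hr (h.intervalIntegrable neg_one_lt_zero h1)
      (h.intervalIntegrable_cutoff n neg_one_lt_zero h1) fun x hx => by
        nlinarith [hneg x hx.1, cutoff_le_one n x]
  rw [truncated]
  linarith

theorem IsProfile.antitoneOn (h : IsProfile φ φ₁ φ₂) (hneg : ∀ r, 0 ≤ r → φ₁ r ≤ 0) :
    AntitoneOn φ (Set.Ici 0) := by
  intro r hr s hs hrs
  have h1 := h.integral_deriv (neg_one_lt_zero.trans_le hr) (neg_one_lt_zero.trans_le hs)
  have h2 : ∫ x in r..s, φ₁ x ≤ 0 := by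
    have := intervalIntegral.integral_mono_on hrs
      (h.intervalIntegrable (neg_one_lt_zero.trans_le hr) (neg_one_lt_zero.trans_le hs))
      (intervalIntegrable_const (c := (0 : ℝ))) fun x hx => hneg x (le_trans hr hx.1)
    simpa using this
  linarith

end Truncation

/-! ### The Lyapunov estimate for the continuous component. -/

section RadialEstimate

variable {d : ℕ} {Sd : Type*}

/-- A positive decreasing profile `φ`, vanishing at infinity, such that `f(x) = φ(‖x‖² / 2)`
satisfies `𝓚 f ≤ c f`. -/
structure IsLyapunovProfile (b : State d Sd → EuclideanSpace ℝ (Fin d))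
    (a : State d Sd → Matrix (Fin d) (Fin d) ℝ) (c : ℝ) (φ φ₁ φ₂ : ℝ → ℝ) : Prop where
  isProfile : IsProfile φ φ₁ φ₂
  pos : ∀ r, 0 ≤ r → 0 < φ r
  deriv_nonpos : ∀ r, 0 ≤ r → φ₁ r ≤ 0
  tendsto : Tendsto φ atTop (𝓝 0)
  nonneg_const : 0 ≤ c
  map_le : ∀ z : State d Sd, φ₁ (‖z.1‖ ^ 2 / 2) * inner ℝ z.1 (b z) +
    1 / 2 * (φ₁ (‖z.1‖ ^ 2 / 2) * (a z).trace +
      φ₂ (‖z.1‖ ^ 2 / 2) * (z.1.ofLp ⬝ᵥ (a z).mulVec z.1.ofLp)) ≤ c * φ (‖z.1‖ ^ 2 / 2)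
  radial_bound : ∀ R : ℝ, ∃ A, ∀ z : State d Sd, ‖z.1‖ ≤ R →
    |z.1.ofLp ⬝ᵥ (a z).mulVec z.1.ofLp| ≤ A

variable [Countable Sd] [TopologicalSpace Sd] [DiscreteTopology Sd] [MeasurableSpace Sd]
  [BorelSpace Sd] {b : State d Sd → EuclideanSpace ℝ (Fin d)}
  {a : State d Sd → Matrix (Fin d) (Fin d) ℝ} {Q : EuclideanSpace ℝ (Fin d) → Sd → Sd → ℝ}
  {D : Set (State d Sd → ℝ)} {c : ℝ} {φ φ₁ φ₂ : ℝ → ℝ}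

theorem IsProfile.truncated_mem_Cb2 (h : IsProfile φ φ₁ φ₂) {n : ℝ} (hn : 0 ≤ n) :
    (fun x : EuclideanSpace ℝ (Fin d) => truncated φ φ₁ n (‖x‖ ^ 2 / 2)) ∈ Cb2 d :=
  (h.isProfile_truncated n).mem_Cb2 (R := n + 1) (by linarith)
    (fun r hr => h.truncated_of_ge hn hr) (fun r hr => by rw [cutoff_of_ge hr, zero_mul])
    (fun r hr => by rw [cutoff_of_ge hr, cutoffDeriv_of_ge hr, zero_mul, zero_mul, add_zero])

-- With χ the cutoff, 𝓛F is χ times 𝓚 of the full profile, which is at most c φ(0), plus ½ χ' φ' ⟨x,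
-- a x⟩. The last term lives on a bounded range of ‖x‖ and is bounded uniformly in i by
-- `radial_bound`. Drift and trace may still be unbounded in i, so only an upper bound is available.
omit [Countable Sd] [DiscreteTopology Sd] [BorelSpace Sd] in
theorem IsLyapunovProfile.isLyapunovOn (h : IsLyapunovProfile b a c φ φ₁ φ₂)
    (hQ : ∀ x, IsConservativeQMatrix (Q x)) (hD : IsTestSet b a Q D) {n : ℝ} (hn : 0 ≤ n) :
    IsLyapunovOn (switchingOp b a Q) (fun z : State d Sd => φ (‖z.1‖ ^ 2 / 2)) c
      {z | ‖z.1‖ ^ 2 / 2 ≤ n} (fun z => truncated φ φ₁ n (‖z.1‖ ^ 2 / 2)) := by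
  have hmem := hD.left_mem _ (h.isProfile.truncated_mem_Cb2 (d := d) hn)
  have hp := h.isProfile.isProfile_truncated n
  have hop : ∀ z : State d Sd, switchingOp b a Q
      (fun z => truncated φ φ₁ n (‖z.1‖ ^ 2 / 2)) z = cutoff n (‖z.1‖ ^ 2 / 2) *
        (φ₁ (‖z.1‖ ^ 2 / 2) * inner ℝ z.1 (b z) + 1 / 2 * (φ₁ (‖z.1‖ ^ 2 / 2) * (a z).trace +
          φ₂ (‖z.1‖ ^ 2 / 2) * (z.1.ofLp ⬝ᵥ (a z).mulVec z.1.ofLp))) +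
        1 / 2 * (cutoffDeriv n (‖z.1‖ ^ 2 / 2) * φ₁ (‖z.1‖ ^ 2 / 2) *
          (z.1.ofLp ⬝ᵥ (a z).mulVec z.1.ofLp)) := fun z => by
    rw [switchingOp_comp_fst hQ (fun x => truncated φ φ₁ n (‖x‖ ^ 2 / 2)), hp.diffusionOp_eq]
    ring
  have hq : ∀ z : State d Sd, 0 ≤ ‖z.1‖ ^ 2 / 2 := fun z => by positivity
  refine ⟨isClosed_le (by fun_prop) continuous_const, hD.isInputData.continuous _ hmem,
    hD.isInputData.integrable _ hmem, ?_, fun z => ?_,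
    fun z hz => h.isProfile.truncated_of_le (hq z) hz, fun z hz => ?_, ?_⟩
  · obtain ⟨M, hM⟩ := (h.isProfile.truncated_mem_Cb2 (d := d) hn).2
    exact ⟨M, fun z => (hM z.1).1⟩
  · exact (h.pos _ (hq z)).le.trans (h.isProfile.le_truncated h.deriv_nonpos n (hq z))
  · rw [hop, cutoff_of_le hz, cutoffDeriv_of_le hz, one_mul]
    simpa using h.map_le z
  · obtain ⟨A, hA⟩ := h.radial_bound (2 * (n + 1))
    obtain ⟨B, hB⟩ := (isCompact_Icc (a := (0 : ℝ)) (b := n + 1)).exists_bound_of_continuousOn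
      ((continuous_cutoffDeriv n).continuousOn.mul (h.isProfile.continuousOn_deriv.mono
        fun x hx => lt_of_lt_of_le neg_one_lt_zero hx.1))
    refine ⟨c * φ 0 + 1 / 2 * (B * A), fun z => ?_⟩
    rw [hop]
    have h0 : φ (‖z.1‖ ^ 2 / 2) ≤ φ 0 := h.isProfile.antitoneOn h.deriv_nonpos
      (Set.mem_Ici.2 le_rfl) (Set.mem_Ici.2 (hq z)) (hq z)
    have hc := h.nonneg_const
    have h1 : cutoff n (‖z.1‖ ^ 2 / 2) * (φ₁ (‖z.1‖ ^ 2 / 2) * inner ℝ z.1 (b z) +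
        1 / 2 * (φ₁ (‖z.1‖ ^ 2 / 2) * (a z).trace +
          φ₂ (‖z.1‖ ^ 2 / 2) * (z.1.ofLp ⬝ᵥ (a z).mulVec z.1.ofLp))) ≤ c * φ 0 := by
      refine (mul_le_mul_of_nonneg_left ((h.map_le z).trans (mul_le_mul_of_nonneg_left h0 hc))
        (cutoff_nonneg n _)).trans ?_
      exact mul_le_of_le_one_left (mul_nonneg hc (h.pos 0 le_rfl).le) (cutoff_le_one n _)
    have hB0 : 0 ≤ B := (norm_nonneg _).trans (hB 0 ⟨le_rfl, by linarith⟩)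
    have h2 : cutoffDeriv n (‖z.1‖ ^ 2 / 2) * φ₁ (‖z.1‖ ^ 2 / 2) *
        (z.1.ofLp ⬝ᵥ (a z).mulVec z.1.ofLp) ≤ B * A := by
      have hA0 : 0 ≤ A := (abs_nonneg _).trans (hA (0, z.2) (by simp; linarith))
      rcases le_or_gt (‖z.1‖ ^ 2 / 2) (n + 1) with hz | hz
      · have hz' : ‖z.1‖ ≤ 2 * (n + 1) := by
          by_contra hcon
          nlinarith [not_le.1 hcon]
        refine (le_abs_self _).trans ?_
        rw [abs_mul]
        exact mul_le_mul (hB _ ⟨hq z, hz⟩) (hA z hz') (abs_nonneg _) hB0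
      · rw [cutoffDeriv_of_gt hz, zero_mul, zero_mul]
        exact mul_nonneg hB0 hA0
    linarith

omit [Countable Sd] [DiscreteTopology Sd] [MeasurableSpace Sd] [BorelSpace Sd] in
theorem eventually_half_norm_sq_le {ω : Path (State d Sd)} (hω : ω ∈ continuousFst d Sd) (t : ℝ≥0) :
    ∀ᶠ n : ℕ in atTop, ∀ s ≤ t, ‖(coord s ω).1‖ ^ 2 / 2 ≤ n := by
  have hc : Continuous fun s => (coord s ω).1 := hω
  obtain ⟨C, hC⟩ := (isCompact_Icc (a := (0 : ℝ≥0)) (b := t)).exists_bound_of_continuousOn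
    (f := fun s => ‖(coord s ω).1‖ ^ 2 / 2) ((hc.norm.pow 2).div_const 2).continuousOn
  filter_upwards [eventually_ge_atTop ⌈C⌉₊] with n hn s hs
  exact (le_abs_self _).trans ((hC s ⟨zero_le, hs⟩).trans (Nat.ceil_le.1 hn))

theorem ae_coord_zero_eq {S : Type*} [TopologicalSpace S] [MeasurableSpace S]
    [MeasurableSingletonClass S] {P : Measure (Path S)} {x : S}
    (h : P.map (coord 0) = Measure.dirac x) : ∀ᵐ ω ∂P, coord 0 ω = x := by
  have : ∀ᵐ y ∂(P.map (coord 0)), y = x := by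
    rw [h, ae_dirac_eq]
    rfl
  exact ae_of_ae_map (measurable_coord 0).aemeasurable this

/-- The full profile need not be in C_b^2, but its truncations are. Continuity of the first
component keeps the path, up to any fixed time, inside one of the sets ‖x‖²/2 ≤ n. -/
theorem IsLyapunovProfile.integral_le (h : IsLyapunovProfile b a c φ φ₁ φ₂)
    (hQ : ∀ x, IsConservativeQMatrix (Q x)) (hD : IsTestSet b a Q D) {z : State d Sd}
    {P : Measure (Path (State d Sd))}
    (hP : IsSolution D (switchingOp b a Q) (continuousFst d Sd) (Measure.dirac z) P) (t : ℝ≥0) :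
    ∫ ω, φ (‖(coord t ω).1‖ ^ 2 / 2) ∂P ≤ φ (‖z.1‖ ^ 2 / 2) * Real.exp (c * t) := by
  have := hP.isProbabilityMeasure
  have hq : ∀ z : State d Sd, 0 ≤ ‖z.1‖ ^ 2 / 2 := fun z => by positivity
  have hcont : Continuous fun z : State d Sd => φ (‖z.1‖ ^ 2 / 2) :=
    h.isProfile.continuous.comp continuous_fst
  refine integral_le_exp_mul (f := fun z : State d Sd => φ (‖z.1‖ ^ 2 / 2)) hcont.measurable
    (K := φ 0) (fun z => ?_) (fun z => (h.pos _ (hq z)).le) h.nonneg_const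
    (fun n : ℕ => h.isLyapunovOn hQ hD (n := n) n.cast_nonneg)
    (fun n => hP.localMartingale _ (hD.left_mem _
      (h.isProfile.truncated_mem_Cb2 (d := d) (n := n) n.cast_nonneg)))
    (ae_coord_zero_eq hP.initial) ?_ ?_ t
  · rw [abs_of_pos (h.pos _ (hq z))]
    exact h.isProfile.antitoneOn h.deriv_nonpos (Set.mem_Ici.2 le_rfl) (Set.mem_Ici.2 (hq z)) (hq z)
  · filter_upwards [eventually_ge_atTop ⌈‖z.1‖ ^ 2 / 2⌉₊] with n hn
    exact Nat.ceil_le.1 hn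
  · filter_upwards [hP.ae_mem] with ω hω t
    exact eventually_half_norm_sq_le hω t

end RadialEstimate

/-! ### Positive semidefinite forms. -/

section QuadraticForm

variable {d : ℕ}

theorem quadraticForm_nonneg {A : Matrix (Fin d) (Fin d) ℝ} (hA : A.PosSemidef)
    (x : EuclideanSpace ℝ (Fin d)) : 0 ≤ x.ofLp ⬝ᵥ A.mulVec x.ofLp := by
  simpa using hA.dotProduct_mulVec_nonneg x.ofLp

theorem trace_nonneg_of_posSemidef {A : Matrix (Fin d) (Fin d) ℝ} (hA : A.PosSemidef) :
    0 ≤ A.trace := hA.trace_nonneg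

-- Write A = BᵀB and apply Cauchy-Schwarz to each row of B.
open scoped Matrix MatrixOrder Matrix.Norms.L2Operator in
theorem quadraticForm_le_trace_mul {A : Matrix (Fin d) (Fin d) ℝ} (hA : A.PosSemidef)
    (x : EuclideanSpace ℝ (Fin d)) : x.ofLp ⬝ᵥ A.mulVec x.ofLp ≤ A.trace * ‖x‖ ^ 2 := by
  obtain ⟨B, rfl⟩ : ∃ B : Matrix (Fin d) (Fin d) ℝ, A = Bᵀ * B := by
    obtain ⟨B, hB⟩ := CStarAlgebra.nonneg_iff_eq_star_mul_self.1 hA.nonneg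
    exact ⟨B, by simpa [Matrix.star_eq_conjTranspose] using hB⟩
  have h1 : x.ofLp ⬝ᵥ (Bᵀ * B).mulVec x.ofLp = ∑ k, (∑ l, B k l * x l) ^ 2 := by
    rw [← Matrix.mulVec_mulVec, Matrix.dotProduct_mulVec, Matrix.vecMul_transpose]
    simp only [dotProduct, Matrix.mulVec, sq]
  have h2 : (Bᵀ * B).trace = ∑ k, ∑ l, B k l ^ 2 := by
    simp only [Matrix.trace, Matrix.diag, Matrix.mul_apply, Matrix.transpose_apply, sq]
    exact Finset.sum_comm
  rw [h1, h2, Finset.sum_mul, EuclideanSpace.real_norm_sq_eq]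
  exact Finset.sum_le_sum fun k _ => Finset.sum_mul_sq_le_sq_mul_sq _ _ _

end QuadraticForm

/-! ### The profile 1/(1+r) under linear growth. -/

section LinearGrowth

variable {d : ℕ} {Sd : Type*} {b : State d Sd → EuclideanSpace ℝ (Fin d)}
  {a : State d Sd → Matrix (Fin d) (Fin d) ℝ}

theorem LinearGrowthCondition.exists_isLyapunovProfile (ha : ∀ z, (a z).PosSemidef)
    (h : LinearGrowthCondition b a) : ∃ c φ φ₁ φ₂, IsLyapunovProfile b a c φ φ₁ φ₂ := by
  obtain ⟨β, hβ, h⟩ := h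
  have hpos : ∀ r : ℝ, -1 < r → (0 : ℝ) < 1 + r := fun r hr => by linarith
  -- The constant is 4β + 4β: the first-order terms and the second-order term each contribute at
  -- most 4β/(1+r) with r = ‖x‖²/2.
  refine ⟨8 * β, fun r => (1 + r)⁻¹, fun r => -((1 + r) ^ 2)⁻¹, fun r => 2 * ((1 + r) ^ 3)⁻¹,
    ⟨fun r hr => ?_, fun r hr => ?_, ?_⟩, fun r hr => by positivity,
    fun r hr => by simp only [Left.neg_nonpos_iff]; positivity, ?_, by positivity, fun z => ?_, fun R => ?_⟩
  · have := ((hasDerivAt_id r).const_add 1).inv (hpos r hr).ne'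
    refine this.congr_deriv ?_
    simp [div_eq_mul_inv]
  · have := ((((hasDerivAt_id r).const_add 1).pow 2).inv (pow_pos (hpos r hr) 2).ne').neg
    refine this.congr_deriv ?_
    have := (hpos r hr).ne'
    simp
    field_simp
  · refine continuousOn_const.mul (ContinuousOn.inv₀ (by fun_prop) fun r hr => ?_)
    exact (pow_pos (hpos r hr) 3).ne'
  · exact tendsto_inv_atTop_zero.comp (tendsto_atTop_add_const_left _ _ tendsto_id)
  · obtain ⟨h1, h2⟩ := h z.1 z.2
    have h3 := quadraticForm_le_trace_mul (ha z) z.1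
    have h4 := trace_nonneg_of_posSemidef (ha z)
    have h5 : -(β * (1 + ‖z.1‖) * ‖z.1‖) ≤ inner ℝ z.1 (b z) := by
      have := abs_real_inner_le_norm z.1 (b z)
      have h6 : ‖z.1‖ * ‖b z‖ ≤ ‖z.1‖ * (β * (1 + ‖z.1‖)) :=
        mul_le_mul_of_nonneg_left h1 (norm_nonneg _)
      have := (abs_le.1 this).1
      linarith
    have h6 : z.1.ofLp ⬝ᵥ (a z).mulVec z.1.ofLp ≤ β * (1 + ‖z.1‖ ^ 2) * ‖z.1‖ ^ 2 :=
      h3.trans (mul_le_mul_of_nonneg_right h2 (by positivity))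
    generalize z.1.ofLp ⬝ᵥ (a z).mulVec z.1.ofLp = A at *
    generalize inner ℝ z.1 (b z) = B at *
    generalize (a z).trace = T at *
    generalize ‖z.1‖ = x at *
    have hu : 0 < 1 + x ^ 2 / 2 := by positivity
    have e1 : -(B + 1 / 2 * T) ≤ 4 * β * (1 + x ^ 2 / 2) := by
      nlinarith [mul_nonneg hβ.le (sq_nonneg (x - 1))]
    have e2 : A ≤ 4 * β * (1 + x ^ 2 / 2) ^ 2 := by
      nlinarith [mul_nonneg hβ.le (sq_nonneg x)]
    have e3 : -((1 + x ^ 2 / 2) ^ 2)⁻¹ * B + 1 / 2 * (-((1 + x ^ 2 / 2) ^ 2)⁻¹ * T +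
        2 * ((1 + x ^ 2 / 2) ^ 3)⁻¹ * A) = ((1 + x ^ 2 / 2) ^ 2)⁻¹ * (-(B + 1 / 2 * T)) +
        ((1 + x ^ 2 / 2) ^ 3)⁻¹ * A := by ring
    rw [e3]
    refine (add_le_add (mul_le_mul_of_nonneg_left e1 (by positivity))
      (mul_le_mul_of_nonneg_left e2 (by positivity))).trans (le_of_eq ?_)
    field_simp
    ring
  · refine ⟨β * (1 + R ^ 2) * R ^ 2, fun z hz => ?_⟩
    rw [abs_of_nonneg (quadraticForm_nonneg (ha z) z.1)]
    have h2 : ‖z.1‖ ^ 2 ≤ R ^ 2 := pow_le_pow_left₀ (norm_nonneg _) hz 2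
    refine (quadraticForm_le_trace_mul (ha z) z.1).trans (mul_le_mul ((h z.1 z.2).2.trans ?_) h2
      (by positivity) (by positivity))
    gcongr

end LinearGrowth

/-! ### One-dimensional analysis: solutions of φ'' + βφ' ≤ wφ. -/

section RadialProfile

variable {β w φ φ₁ φ₂ : ℝ → ℝ}

theorem scaleDensity_pos (β : ℝ → ℝ) (r : ℝ) : 0 < scaleDensity β r := Real.exp_pos _

theorem hasDerivAt_scaleDensity (hβ : Continuous β) (r : ℝ) :
    HasDerivAt (scaleDensity β) (-(β r * scaleDensity β r)) r := by
  refine ((hβ.integral_hasStrictDerivAt 1 r).hasDerivAt.neg.exp).congr_deriv ?_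
  simp only [scaleDensity, Pi.neg_apply]
  ring

theorem continuous_scaleDensity (hβ : Continuous β) : Continuous (scaleDensity β) :=
  continuous_iff_continuousAt.2 fun r => (hasDerivAt_scaleDensity hβ r).continuousAt

/-- A positive decreasing profile vanishing at infinity with `φ'' + β φ' ≤ w φ`. -/
structure IsRadialProfile (β w φ φ₁ φ₂ : ℝ → ℝ) : Prop where
  isProfile : IsProfile φ φ₁ φ₂
  pos : ∀ r, 0 ≤ r → 0 < φ r
  deriv_nonpos : ∀ r, 0 ≤ r → φ₁ r ≤ 0
  tendsto : Tendsto φ atTop (𝓝 0)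
  map_le : ∀ r, 0 ≤ r → φ₂ r + β r * φ₁ r ≤ w r * φ r

theorem strictMono_scale (hβ : Continuous β) : StrictMono (scale β) :=
  strictMono_of_hasDerivAt_pos
    (fun r => ((continuous_scaleDensity hβ).integral_hasStrictDerivAt 1 r).hasDerivAt)
    fun r => scaleDensity_pos β r

/-- The scale function satisfies p'' + βp' = 0, so l - p is harmonic, positive and decreasing to 0;
the term wφ is simply nonnegative. -/
theorem isRadialProfile_of_tendsto (hβ : Continuous β) (hw : ∀ r, 0 ≤ w r) {l : ℝ}
    (hl : Tendsto (scale β) atTop (𝓝 l)) :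
    IsRadialProfile β w (fun r => l - scale β r) (fun r => -scaleDensity β r)
      (fun r => β r * scaleDensity β r) := by
  have hlt : ∀ r, scale β r < l := fun r =>
    (strictMono_scale hβ (lt_add_one r)).trans_le ((strictMono_scale hβ).monotone.ge_of_tendsto hl _)
  refine ⟨⟨fun r _ => ?_, fun r _ => ?_, ?_⟩, fun r _ => sub_pos.2 (hlt r), fun r _ => ?_, ?_,
    fun r _ => ?_⟩
  · exact (((continuous_scaleDensity hβ).integral_hasStrictDerivAt 1 r).hasDerivAt).const_sub l
  · exact (hasDerivAt_scaleDensity hβ r).neg.congr_deriv (neg_neg _)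
  · exact (hβ.mul (continuous_scaleDensity hβ)).continuousOn
  · exact neg_nonpos.2 (scaleDensity_pos β r).le
  · simpa using hl.const_sub l
  · have := mul_nonneg (hw r) (sub_pos.2 (hlt r)).le
    linarith

/-- `1 + ∫_{-1}^r p'`. -/
def scaleFrom (β : ℝ → ℝ) (r : ℝ) : ℝ := 1 + ∫ y in (-1 : ℝ)..r, scaleDensity β y

/-- `1 + ∫_{-1}^r (1 + p) w / p'`. -/
def speedFrom (β w : ℝ → ℝ) (r : ℝ) : ℝ :=
  1 + ∫ y in (-1 : ℝ)..r, scaleFrom β y * w y / scaleDensity β y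

/-- `1 + ∫_{-1}^r p' N` with `N` the function `speedFrom`. -/
def growing (β w : ℝ → ℝ) (r : ℝ) : ℝ :=
  1 + ∫ y in (-1 : ℝ)..r, scaleDensity β y * speedFrom β w y

/-- `∫_{-1}^r p' / u²` with `u` the function `growing`. -/
def wronskian (β w : ℝ → ℝ) (r : ℝ) : ℝ :=
  ∫ y in (-1 : ℝ)..r, scaleDensity β y / (max (growing β w y) 1) ^ 2

theorem hasDerivAt_scaleFrom (hβ : Continuous β) (r : ℝ) :
    HasDerivAt (scaleFrom β) (scaleDensity β r) r :=
  ((continuous_scaleDensity hβ).integral_hasStrictDerivAt _ r).hasDerivAt.const_add 1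

theorem continuous_scaleFrom (hβ : Continuous β) : Continuous (scaleFrom β) :=
  continuous_iff_continuousAt.2 fun r => (hasDerivAt_scaleFrom hβ r).continuousAt

theorem continuous_speedDensity (hβ : Continuous β) (hw : Continuous w) :
    Continuous fun y => scaleFrom β y * w y / scaleDensity β y :=
  ((continuous_scaleFrom hβ).mul hw).div (continuous_scaleDensity hβ)
    fun r => (scaleDensity_pos β r).ne'

theorem hasDerivAt_speedFrom (hβ : Continuous β) (hw : Continuous w) (r : ℝ) :
    HasDerivAt (speedFrom β w) (scaleFrom β r * w r / scaleDensity β r) r :=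
  ((continuous_speedDensity hβ hw).integral_hasStrictDerivAt _ r).hasDerivAt.const_add 1

theorem continuous_speedFrom (hβ : Continuous β) (hw : Continuous w) :
    Continuous (speedFrom β w) :=
  continuous_iff_continuousAt.2 fun r => (hasDerivAt_speedFrom hβ hw r).continuousAt

theorem hasDerivAt_growing (hβ : Continuous β) (hw : Continuous w) (r : ℝ) :
    HasDerivAt (growing β w) (scaleDensity β r * speedFrom β w r) r :=
  (((continuous_scaleDensity hβ).mul (continuous_speedFrom hβ hw)).integral_hasStrictDerivAt _
    r).hasDerivAt.const_add 1

theorem continuous_growing (hβ : Continuous β) (hw : Continuous w) : Continuous (growing β w) :=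
  continuous_iff_continuousAt.2 fun r => (hasDerivAt_growing hβ hw r).continuousAt

theorem one_le_scaleFrom {r : ℝ} (hr : -1 ≤ r) : 1 ≤ scaleFrom β r :=
  le_add_of_nonneg_right (intervalIntegral.integral_nonneg hr fun y _ => (scaleDensity_pos β y).le)

theorem speedDensity_nonneg (hw0 : ∀ r, 0 ≤ w r) {r : ℝ} (hr : -1 ≤ r) :
    0 ≤ scaleFrom β r * w r / scaleDensity β r :=
  div_nonneg (mul_nonneg (zero_le_one.trans (one_le_scaleFrom hr)) (hw0 r)) (scaleDensity_pos β r).le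

theorem monotoneOn_speedFrom (hβ : Continuous β) (hw : Continuous w) (hw0 : ∀ r, 0 ≤ w r) :
    MonotoneOn (speedFrom β w) (Set.Ici (-1)) :=
  monotoneOn_of_hasDerivWithinAt_nonneg (convex_Ici _) (continuous_speedFrom hβ hw).continuousOn
    (fun r _ => (hasDerivAt_speedFrom hβ hw r).hasDerivWithinAt) fun r hr => by
      rw [interior_Ici] at hr
      exact speedDensity_nonneg hw0 (le_of_lt hr)

theorem one_le_speedFrom (hw0 : ∀ r, 0 ≤ w r) {r : ℝ} (hr : -1 ≤ r) : 1 ≤ speedFrom β w r :=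
  le_add_of_nonneg_right (intervalIntegral.integral_nonneg hr fun _ hy =>
    speedDensity_nonneg hw0 hy.1)

theorem one_le_growing (hw0 : ∀ r, 0 ≤ w r) {r : ℝ} (hr : -1 ≤ r) : 1 ≤ growing β w r :=
  le_add_of_nonneg_right (intervalIntegral.integral_nonneg hr fun y hy =>
    mul_nonneg (scaleDensity_pos β y).le (zero_le_one.trans (one_le_speedFrom hw0 hy.1)))

theorem scaleFrom_le_growing (hβ : Continuous β) (hw : Continuous w) (hw0 : ∀ r, 0 ≤ w r) {r : ℝ}
    (hr : -1 ≤ r) : scaleFrom β r ≤ growing β w r := by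
  refine add_le_add_right (intervalIntegral.integral_mono_on hr
    ((continuous_scaleDensity hβ).intervalIntegrable _ _)
    (((continuous_scaleDensity hβ).mul (continuous_speedFrom hβ hw)).intervalIntegrable _ _)
    fun y hy => ?_) 1
  exact le_mul_of_one_le_right (scaleDensity_pos β y).le (one_le_speedFrom hw0 hy.1)

theorem hasDerivAt_wronskian (hβ : Continuous β) (hw : Continuous w) (hw0 : ∀ r, 0 ≤ w r) {r : ℝ}
    (hr : -1 ≤ r) :
    HasDerivAt (wronskian β w) (scaleDensity β r / growing β w r ^ 2) r := by
  -- The maximum with 1 makes the integrand continuous on the whole line; on [-1, ∞) it has no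
  -- effect because u ≥ 1 there.
  have hc : Continuous fun y => scaleDensity β y / (max (growing β w y) 1) ^ 2 :=
    (continuous_scaleDensity hβ).div (((continuous_growing hβ hw).max continuous_const).pow 2)
      fun y => (pow_pos (lt_max_of_lt_right one_pos) 2).ne'
  have := (hc.integral_hasStrictDerivAt (-1) r).hasDerivAt
  rwa [max_eq_left (one_le_growing hw0 hr)] at this

/-- On [r, ∞) the function G + 1/(N(r) u) is decreasing: its derivative is (p'/u²)(1 - N(x)/N(r)),
and N increases. Hence the tail ∫_r^∞ p'/u² is at most 1/(N(r) u(r)). -/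
theorem wronskian_le (hβ : Continuous β) (hw : Continuous w) (hw0 : ∀ r, 0 ≤ w r) {r s : ℝ}
    (hr : -1 ≤ r) (hrs : r ≤ s) :
    wronskian β w s ≤ wronskian β w r + (speedFrom β w r * growing β w r)⁻¹ := by
  have hN := one_le_speedFrom (β := β) hw0 hr
  have hd : ∀ x, r ≤ x → HasDerivAt
      (fun x => wronskian β w x + (speedFrom β w r)⁻¹ * (growing β w x)⁻¹)
      (scaleDensity β x / growing β w x ^ 2 + (speedFrom β w r)⁻¹ *
        (-(scaleDensity β x * speedFrom β w x) / growing β w x ^ 2)) x := fun x hx => by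
    have hu := one_le_growing (β := β) hw0 (hr.trans hx)
    exact (hasDerivAt_wronskian hβ hw hw0 (hr.trans hx)).add
      (((hasDerivAt_growing hβ hw x).inv (zero_lt_one.trans_le hu).ne').const_mul _)
  have hanti : AntitoneOn (fun x => wronskian β w x + (speedFrom β w r)⁻¹ * (growing β w x)⁻¹)
      (Set.Ici r) := by
    refine antitoneOn_of_hasDerivWithinAt_nonpos (convex_Ici _)
      (fun x hx => (hd x hx).continuousAt.continuousWithinAt)
      (fun x hx => (hd x (interior_subset hx)).hasDerivWithinAt) fun x hx => ?_
    have hx' : r ≤ x := interior_subset hx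
    have h1 := monotoneOn_speedFrom hβ hw hw0 (Set.mem_Ici.2 hr) (Set.mem_Ici.2 (hr.trans hx')) hx'
    have h2 : 1 ≤ (speedFrom β w r)⁻¹ * speedFrom β w x := by
      rw [← div_eq_inv_mul, one_le_div (zero_lt_one.trans_le hN)]
      exact h1
    have h3 : 0 ≤ scaleDensity β x / growing β w x ^ 2 :=
      div_nonneg (scaleDensity_pos β x).le (sq_nonneg _)
    have h4 : scaleDensity β x / growing β w x ^ 2 + (speedFrom β w r)⁻¹ *
        (-(scaleDensity β x * speedFrom β w x) / growing β w x ^ 2) =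
        (scaleDensity β x / growing β w x ^ 2) *
          (1 - (speedFrom β w r)⁻¹ * speedFrom β w x) := by ring
    rw [h4]
    exact mul_nonpos_of_nonneg_of_nonpos h3 (by linarith)
  have h1 := hanti (Set.mem_Ici.2 le_rfl) (Set.mem_Ici.2 hrs) hrs
  have h2 : 0 ≤ (speedFrom β w r)⁻¹ * (growing β w s)⁻¹ :=
    mul_nonneg (inv_nonneg.2 (zero_le_one.trans hN))
      (inv_nonneg.2 (zero_le_one.trans (one_le_growing hw0 (hr.trans hrs))))
  simp only at h1
  rw [mul_inv]
  linarith

theorem strictMonoOn_wronskian (hβ : Continuous β) (hw : Continuous w) (hw0 : ∀ r, 0 ≤ w r) :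
    StrictMonoOn (wronskian β w) (Set.Ici (-1)) :=
  strictMonoOn_of_hasDerivWithinAt_pos (convex_Ici _)
    (fun _ hr => (hasDerivAt_wronskian hβ hw hw0 hr).continuousAt.continuousWithinAt)
    (fun _ hr => (hasDerivAt_wronskian hβ hw hw0 (interior_subset hr)).hasDerivWithinAt)
    fun r hr => div_pos (scaleDensity_pos β r)
      (pow_pos (zero_lt_one.trans_le (one_le_growing hw0 (interior_subset hr))) 2)

/-- Reduction of order: with u' = p'N and G' = p'/u², the function φ = u(l - G) satisfies φ'' + βφ'
= P w (l - G), where P is `scaleFrom`; this is at most wφ since P ≤ u. The tail bound l - G ≤ 1/(Nu)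
gives both φ' ≤ 0 and φ ≤ 1/N, which tends to 0. -/
theorem exists_isRadialProfile_of_tendsto_speedFrom (hβ : Continuous β) (hw : Continuous w)
    (hw0 : ∀ r, 0 ≤ w r) (hN : Tendsto (speedFrom β w) atTop atTop) :
    ∃ φ φ₁ φ₂, IsRadialProfile β w φ φ₁ φ₂ := by
  set G := wronskian β w with hG
  set u := growing β w with hu
  set N := speedFrom β w with hNdef
  set s := scaleDensity β with hs
  have hu1 : ∀ r, -1 ≤ r → 1 ≤ u r := fun r hr => one_le_growing hw0 hr
  have hu0 : ∀ r, -1 ≤ r → 0 < u r := fun r hr => zero_lt_one.trans_le (hu1 r hr)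
  have hN0 : ∀ r, -1 ≤ r → 0 < N r := fun r hr => zero_lt_one.trans_le (one_le_speedFrom hw0 hr)
  have hmono := strictMonoOn_wronskian hβ hw hw0
  set l := sSup (G '' Set.Ici (-1)) with hl
  have hbdd : BddAbove (G '' Set.Ici (-1)) := by
    refine ⟨G (-1) + (N (-1) * u (-1))⁻¹, ?_⟩
    rintro _ ⟨r, hr, rfl⟩
    exact wronskian_le hβ hw hw0 le_rfl hr
  have hlt : ∀ r, -1 ≤ r → G r < l := fun r hr =>
    (hmono (Set.mem_Ici.2 hr) (Set.mem_Ici.2 (by linarith)) (lt_add_one r)).trans_le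
      (le_csSup hbdd ⟨r + 1, Set.mem_Ici.2 (by linarith), rfl⟩)
  have hle : ∀ r, -1 ≤ r → l - G r ≤ (N r * u r)⁻¹ := fun r hr => by
    have : l ≤ G r + (N r * u r)⁻¹ := by
      refine csSup_le ⟨_, ⟨r, hr, rfl⟩⟩ ?_
      rintro _ ⟨x, hx, rfl⟩
      rcases le_total r x with h | h
      · exact wronskian_le hβ hw hw0 hr h
      · exact (hmono.monotoneOn hx hr h).trans
          (le_add_of_nonneg_right (inv_nonneg.2 (mul_pos (hN0 r hr) (hu0 r hr)).le))
    linarith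
  refine ⟨fun r => u r * (l - G r), fun r => s r * (N r * (l - G r) - (u r)⁻¹),
    fun r => -(β r * s r) * (N r * (l - G r) - (u r)⁻¹) + scaleFrom β r * w r * (l - G r),
    ⟨fun r hr => ?_, fun r hr => ?_, ?_⟩, fun r hr => ?_, fun r hr => ?_, ?_, fun r hr => ?_⟩
  · have h0 := (hu0 r hr.le).ne'
    refine ((hasDerivAt_growing hβ hw r).mul
      ((hasDerivAt_wronskian hβ hw hw0 hr.le).const_sub l)).congr_deriv ?_
    simp only [← hu, ← hG, ← hNdef, ← hs]
    field_simp
    ring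
  · have h0 := (hu0 r hr.le).ne'
    have hs0 : s r ≠ 0 := (scaleDensity_pos β r).ne'
    refine ((hasDerivAt_scaleDensity hβ r).mul (((hasDerivAt_speedFrom hβ hw r).mul
      ((hasDerivAt_wronskian hβ hw hw0 hr.le).const_sub l)).sub
      ((hasDerivAt_growing hβ hw r).inv h0))).congr_deriv ?_
    simp only [← hu, ← hG, ← hNdef, ← hs, Pi.mul_apply, Pi.sub_apply, Pi.inv_apply]
    field_simp
    ring
  · have c1 : ContinuousOn G (Set.Ioi (-1)) := fun r hr =>
      (hasDerivAt_wronskian hβ hw hw0 (le_of_lt hr)).continuousAt.continuousWithinAt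
    have c2 : ContinuousOn (fun r => (u r)⁻¹) (Set.Ioi (-1)) :=
      (continuous_growing hβ hw).continuousOn.inv₀ fun r hr => (hu0 r (le_of_lt hr)).ne'
    have c3 : ContinuousOn (fun r => l - G r) (Set.Ioi (-1)) := continuousOn_const.sub c1
    exact ((hβ.mul (continuous_scaleDensity hβ)).neg.continuousOn.mul
      (((continuous_speedFrom hβ hw).continuousOn.mul c3).sub c2)).add
      (((continuous_scaleFrom hβ).mul hw).continuousOn.mul c3)
  · exact mul_pos (hu0 r (by linarith)) (sub_pos.2 (hlt r (by linarith)))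
  · refine mul_nonpos_of_nonneg_of_nonpos (scaleDensity_pos β r).le (sub_nonpos.2 ?_)
    have h1 := mul_le_mul_of_nonneg_left (hle r (by linarith)) (hN0 r (by linarith)).le
    rwa [mul_inv, mul_inv_cancel_left₀ (hN0 r (by linarith)).ne'] at h1
  · refine squeeze_zero' (g := fun r => (N r)⁻¹) ?_ ?_ (tendsto_inv_atTop_zero.comp hN)
    · filter_upwards [eventually_ge_atTop 0] with r hr
      exact (mul_pos (hu0 r (by linarith)) (sub_pos.2 (hlt r (by linarith)))).le
    · filter_upwards [eventually_ge_atTop 0] with r hr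
      have h1 := mul_le_mul_of_nonneg_left (hle r (by linarith)) (hu0 r (by linarith)).le
      rwa [mul_comm (N r), mul_inv, mul_inv_cancel_left₀ (hu0 r (by linarith)).ne'] at h1
  · have h1 : scaleFrom β r ≤ u r := scaleFrom_le_growing hβ hw hw0 (by linarith)
    have h2 := mul_nonneg (hw0 r) (sub_pos.2 (hlt r (by linarith))).le
    have h3 := mul_le_mul_of_nonneg_right h1 h2
    linarith

/-- By Tonelli the inner integral becomes the integral of p' over (1, z), which is at most
`scaleFrom β z`. -/
theorem lintegral_lintegral_le_lintegral_speedDensity (hβ : Continuous β) (hw : Continuous w)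
    (hw0 : ∀ r, 0 ≤ w r) :
    ∫⁻ y in Set.Ioi (1 : ℝ), ENNReal.ofReal (scaleDensity β y) *
      ∫⁻ z in Set.Ioi y, ENNReal.ofReal (w z / scaleDensity β z) ≤
    ∫⁻ z in Set.Ioi (1 : ℝ), ENNReal.ofReal (scaleFrom β z * w z / scaleDensity β z) := by
  have hm1 : Measurable fun y => ENNReal.ofReal (scaleDensity β y) :=
    (continuous_scaleDensity hβ).measurable.ennreal_ofReal
  have hm2 : Measurable fun z => ENNReal.ofReal (w z / scaleDensity β z) :=
    (hw.measurable.div (continuous_scaleDensity hβ).measurable).ennreal_ofReal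
  have h1 : ∀ y ∈ Set.Ioi (1 : ℝ), ENNReal.ofReal (scaleDensity β y) *
      ∫⁻ z in Set.Ioi y, ENNReal.ofReal (w z / scaleDensity β z) =
      ∫⁻ z in Set.Ioi (1 : ℝ), {p : ℝ × ℝ | p.1 < p.2}.indicator (fun p =>
        ENNReal.ofReal (scaleDensity β p.1) * ENNReal.ofReal (w p.2 / scaleDensity β p.2)) (y, z) := by
    intro y hy
    rw [← lintegral_const_mul _ hm2, ← lintegral_indicator measurableSet_Ioi,
      ← lintegral_indicator measurableSet_Ioi]
    refine lintegral_congr fun z => ?_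
    by_cases hz : y < z
    · have hz1 : (1 : ℝ) < z := lt_trans hy hz
      simp [Set.indicator, hz, hz1]
    · simp [Set.indicator, hz]
  rw [setLIntegral_congr_fun measurableSet_Ioi h1, lintegral_lintegral_swap]
  · refine setLIntegral_mono ((continuous_speedDensity hβ hw).measurable.ennreal_ofReal)
      fun z hz => ?_
    have hz : (1 : ℝ) < z := hz
    have h2 : ∀ y ∈ Set.Ioi (1 : ℝ), {p : ℝ × ℝ | p.1 < p.2}.indicator (fun p =>
        ENNReal.ofReal (scaleDensity β p.1) * ENNReal.ofReal (w p.2 / scaleDensity β p.2)) (y, z) ≤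
        (Set.Ioc (-1) z).indicator (fun y => ENNReal.ofReal (scaleDensity β y) *
          ENNReal.ofReal (w z / scaleDensity β z)) y := by
      intro y hy
      have hy : (1 : ℝ) < y := hy
      by_cases hyz : y < z
      · have : y ∈ Set.Ioc (-1) z := ⟨by linarith, hyz.le⟩
        rw [Set.indicator_of_mem (show (y, z) ∈ {p : ℝ × ℝ | p.1 < p.2} from hyz),
          Set.indicator_of_mem this]
      · rw [Set.indicator_of_notMem (show (y, z) ∉ {p : ℝ × ℝ | p.1 < p.2} from hyz)]
        exact zero_le
    refine (setLIntegral_mono' measurableSet_Ioi h2).trans ((setLIntegral_le_lintegral _ _).trans ?_)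
    rw [lintegral_indicator measurableSet_Ioc, lintegral_mul_const _ hm1,
      ← ofReal_integral_eq_lintegral_ofReal
        (((continuous_scaleDensity hβ).intervalIntegrable (-1) z).1)
        (ae_of_all _ fun y => (scaleDensity_pos β y).le),
      ← intervalIntegral.integral_of_le (by linarith), ← ENNReal.ofReal_mul
        (intervalIntegral.integral_nonneg (by linarith) fun y _ => (scaleDensity_pos β y).le),
      mul_div_assoc]
    refine ENNReal.ofReal_le_ofReal (mul_le_mul_of_nonneg_right ?_
      (div_nonneg (hw0 z) (scaleDensity_pos β z).le))
    rw [scaleFrom]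
    linarith
  · refine Measurable.aemeasurable (Measurable.indicator ?_ (measurableSet_lt measurable_fst
      measurable_snd))
    exact (hm1.comp measurable_fst).mul (hm2.comp measurable_snd)

/-- If this monotone function were bounded, its density would be integrable, and the double integral
would be finite. -/
theorem tendsto_speedFrom (hβ : Continuous β) (hw : Continuous w) (hw0 : ∀ r, 0 ≤ w r)
    (h : ∫⁻ y in Set.Ioi (1 : ℝ), ENNReal.ofReal (scaleDensity β y) *
      ∫⁻ z in Set.Ioi y, ENNReal.ofReal (w z / scaleDensity β z) = ⊤) :
    Tendsto (speedFrom β w) atTop atTop := by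
  have hmono := monotoneOn_speedFrom hβ hw hw0
  have hunb : ∀ C, ∃ r, -1 ≤ r ∧ C ≤ speedFrom β w r := by
    by_contra hcon
    push Not at hcon
    obtain ⟨C, hC⟩ := hcon
    have hint : IntegrableOn (fun z => scaleFrom β z * w z / scaleDensity β z)
        (Set.Ioi (-1)) := by
      refine integrableOn_Ioi_of_intervalIntegral_norm_bounded (l := atTop) (b := id) C (-1)
        (fun r => ((continuous_speedDensity hβ hw).intervalIntegrable (-1) r).1) tendsto_id ?_
      filter_upwards [eventually_ge_atTop (-1)] with r hr
      have h1 := hC r hr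
      rw [speedFrom] at h1
      rw [intervalIntegral.integral_congr (g := fun z => scaleFrom β z * w z / scaleDensity β z)]
      · simp only [id]
        linarith
      · intro y hy
        rw [id, Set.uIcc_of_le hr] at hy
        exact Real.norm_of_nonneg (speedDensity_nonneg hw0 hy.1)
    have h2 := (hint.mono_set (Set.Ioi_subset_Ioi (by norm_num : (-1 : ℝ) ≤ 1))).lintegral_lt_top
    have h3 := lintegral_lintegral_le_lintegral_speedDensity hβ hw hw0
    rw [h] at h3
    exact absurd (h3.trans_lt h2) (lt_irrefl _)
  refine tendsto_atTop.2 fun C => ?_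
  obtain ⟨r, hr, hC⟩ := hunb C
  filter_upwards [eventually_ge_atTop r] with x hx
  exact hC.trans (hmono (Set.mem_Ici.2 hr) (Set.mem_Ici.2 (hr.trans hx)) hx)

end RadialProfile

/-! ### The Lyapunov profile under the radial condition. -/

section RadialCondition

theorem LocallyHolderOn.continuousOn {f : ℝ → ℝ} {s : Set ℝ} (h : LocallyHolderOn f s) :
    ContinuousOn f s := by
  intro x hx
  obtain ⟨U, hU, C, r, hr, -, hf⟩ := h x hx
  exact (hf.continuousOn hr x (mem_of_mem_nhdsWithin hx hU)).mono_of_mem_nhdsWithin hU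

/-- The extension of a function on `[1/2, ∞)` by a constant. -/
def extendHalf (f : ℝ → ℝ) (r : ℝ) : ℝ := f (max r (1 / 2))

theorem extendHalf_of_le (f : ℝ → ℝ) {r : ℝ} (hr : 1 / 2 ≤ r) : extendHalf f r = f r := by
  rw [extendHalf, max_eq_left hr]

theorem continuous_extendHalf {f : ℝ → ℝ} (hf : ContinuousOn f (Set.Ici (1 / 2))) :
    Continuous (extendHalf f) :=
  hf.comp_continuous (continuous_id.max continuous_const) fun _ => Set.mem_Ici.2 (le_max_right _ _)

theorem scaleDensity_extendHalf (f : ℝ → ℝ) {r : ℝ} (hr : 1 ≤ r) :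
    scaleDensity (extendHalf f) r = scaleDensity f r := by
  rw [scaleDensity, scaleDensity, intervalIntegral.integral_congr (g := f)]
  intro y hy
  rw [Set.uIcc_of_le hr] at hy
  exact extendHalf_of_le f (by linarith [hy.1])

theorem scale_extendHalf (f : ℝ → ℝ) {r : ℝ} (hr : 1 ≤ r) :
    scale (extendHalf f) r = scale f r := by
  rw [scale, scale]
  refine intervalIntegral.integral_congr fun y hy => ?_
  rw [Set.uIcc_of_le hr] at hy
  exact scaleDensity_extendHalf f hy.1

variable {d : ℕ} {Sd : Type*} {b : State d Sd → EuclideanSpace ℝ (Fin d)}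
  {a : State d Sd → Matrix (Fin d) (Fin d) ℝ}

/-- For ‖x‖ ≥ 1, as φ' ≤ 0, the generator is at most ½⟨x, a x⟩(φ'' + βφ') ≤ ½⟨x, a x⟩ wφ ≤ ½φ. On
the unit ball everything is bounded uniformly in i. -/
theorem IsRadialProfile.exists_isLyapunovProfile {β w α φ φ₁ φ₂ : ℝ → ℝ}
    (h : IsRadialProfile β w φ φ₁ φ₂) (ha : ∀ z, (a z).PosSemidef)
    (hα : ContinuousOn α (Set.Ici (1 / 2))) (hαw : ∀ r, 1 / 2 ≤ r → 0 < α r ∧ w r = (α r)⁻¹)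
    (hradial : ∀ (x : EuclideanSpace ℝ (Fin d)) (i : Sd), 1 ≤ ‖x‖ →
      x.ofLp ⬝ᵥ (a (x, i)).mulVec x.ofLp ≤ α (‖x‖ ^ 2 / 2) ∧
      β (‖x‖ ^ 2 / 2) * (x.ofLp ⬝ᵥ (a (x, i)).mulVec x.ofLp)
        ≤ (a (x, i)).trace + 2 * inner ℝ x (b (x, i)))
    {M : ℝ} (hM : ∀ (x : EuclideanSpace ℝ (Fin d)) (j : Sd), ‖x‖ ≤ 1 →
      ‖b (x, j)‖ + (a (x, j)).trace ≤ M) :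
    ∃ c, IsLyapunovProfile b a c φ φ₁ φ₂ := by
  have hsub : Set.Icc (0 : ℝ) (1 / 2) ⊆ Set.Ioi (-1) := fun r hr =>
    lt_of_lt_of_le neg_one_lt_zero hr.1
  obtain ⟨B₁, hB₁⟩ := (isCompact_Icc (a := (0 : ℝ)) (b := 1 / 2)).exists_bound_of_continuousOn
    (h.isProfile.continuousOn_deriv.mono hsub)
  obtain ⟨B₂, hB₂⟩ := (isCompact_Icc (a := (0 : ℝ)) (b := 1 / 2)).exists_bound_of_continuousOn
    (h.isProfile.continuousOn.mono hsub)
  have hB₁0 : 0 ≤ B₁ := (norm_nonneg _).trans (hB₁ 0 ⟨le_rfl, by norm_num⟩)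
  have hB₂0 : 0 ≤ B₂ := (norm_nonneg _).trans (hB₂ 0 ⟨le_rfl, by norm_num⟩)
  have hhalf := h.pos (1 / 2) (by norm_num)
  have hin : ∀ z : State d Sd, ‖z.1‖ ≤ 1 →
      z.1.ofLp ⬝ᵥ (a z).mulVec z.1.ofLp ≤ M ∧ |inner ℝ z.1 (b z)| ≤ M ∧ 0 ≤ M := by
    intro z hz
    have h1 := hM z.1 z.2 hz
    have h2 := trace_nonneg_of_posSemidef (ha z)
    have h3 := norm_nonneg (b z)
    have h1 : ‖b z‖ + (a z).trace ≤ M := h1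
    have h4 : ‖z.1‖ ^ 2 ≤ 1 := pow_le_one₀ (norm_nonneg _) hz
    refine ⟨?_, ?_, by linarith⟩
    · refine (quadraticForm_le_trace_mul (ha z) z.1).trans ?_
      nlinarith
    · refine (abs_real_inner_le_norm _ _).trans ?_
      nlinarith
  -- The first summand handles ‖x‖ ≥ 1. The second handles the unit ball, where φ(‖x‖²/2) ≥ φ(1/2)
  -- turns an absolute bound into a multiple of φ.
  refine ⟨1 / 2 + (B₁ + B₂) * |M| / φ (1 / 2), h.isProfile, h.pos, h.deriv_nonpos, h.tendsto,
    by positivity, fun z => ?_, fun R => ?_⟩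
  · have hq : 0 ≤ ‖z.1‖ ^ 2 / 2 := by positivity
    have hA := quadraticForm_nonneg (ha z) z.1
    have hT := trace_nonneg_of_posSemidef (ha z)
    have hφ := h.pos _ hq
    have hφ₁ := h.deriv_nonpos _ hq
    rcases le_total 1 ‖z.1‖ with hz | hz
    · have hq1 : 1 / 2 ≤ ‖z.1‖ ^ 2 / 2 := by nlinarith
      obtain ⟨h1, h2⟩ := hradial z.1 z.2 hz
      obtain ⟨h3, h4⟩ := hαw _ hq1
      have h5 := h.map_le _ hq
      rw [h4] at h5
      have h1 : z.1.ofLp ⬝ᵥ (a z).mulVec z.1.ofLp ≤ α (‖z.1‖ ^ 2 / 2) := h1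
      have h2 : β (‖z.1‖ ^ 2 / 2) * (z.1.ofLp ⬝ᵥ (a z).mulVec z.1.ofLp) ≤
        (a z).trace + 2 * inner ℝ z.1 (b z) := h2
      have h6 : 0 ≤ (B₁ + B₂) * |M| / φ (1 / 2) * φ (‖z.1‖ ^ 2 / 2) := by positivity
      have h7 : (z.1.ofLp ⬝ᵥ (a z).mulVec z.1.ofLp) * (α (‖z.1‖ ^ 2 / 2))⁻¹ ≤ 1 := by
        rw [← div_eq_mul_inv]
        exact (div_le_one h3).2 h1
      have h8 := mul_le_mul_of_nonneg_left h5 hA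
      have h9 := mul_le_mul_of_nonneg_right h7 hφ.le
      have h10 := mul_le_mul_of_nonpos_left h2 hφ₁
      linarith
    · have hq1 : ‖z.1‖ ^ 2 / 2 ≤ 1 / 2 := by
        have := pow_le_one₀ (n := 2) (norm_nonneg _) hz
        linarith
      obtain ⟨h1, h2, h3⟩ := hin z hz
      have h4 := hB₁ _ ⟨hq, hq1⟩
      have h5 := hB₂ _ ⟨hq, hq1⟩
      have h6 : φ (1 / 2) ≤ φ (‖z.1‖ ^ 2 / 2) :=
        h.isProfile.antitoneOn h.deriv_nonpos hq (by norm_num : (0 : ℝ) ≤ 1 / 2) hq1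
      have h7 : φ₁ (‖z.1‖ ^ 2 / 2) * inner ℝ z.1 (b z) ≤ B₁ * M :=
        (le_abs_self _).trans (by
          rw [abs_mul]
          exact mul_le_mul h4 h2 (abs_nonneg _) hB₁0)
      have h8 : φ₁ (‖z.1‖ ^ 2 / 2) * (a z).trace ≤ 0 := mul_nonpos_of_nonpos_of_nonneg hφ₁ hT
      have h9 : φ₂ (‖z.1‖ ^ 2 / 2) * (z.1.ofLp ⬝ᵥ (a z).mulVec z.1.ofLp) ≤ B₂ * M :=
        mul_le_mul ((le_abs_self _).trans h5) h1 hA hB₂0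
      have h10 : (B₁ + B₂) * M ≤ (B₁ + B₂) * |M| / φ (1 / 2) * φ (‖z.1‖ ^ 2 / 2) := by
        rw [abs_of_nonneg h3, div_mul_eq_mul_div, le_div_iff₀ hhalf]
        exact mul_le_mul_of_nonneg_left h6 (by positivity)
      nlinarith
  · obtain ⟨A, hA⟩ := (isCompact_Icc (a := (1 / 2 : ℝ)) (b := R ^ 2 / 2)).exists_bound_of_continuousOn
      (hα.mono Set.Icc_subset_Ici_self)
    refine ⟨max A M, fun z hz => ?_⟩
    rw [abs_of_nonneg (quadraticForm_nonneg (ha z) z.1)]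
    rcases le_total 1 ‖z.1‖ with hz1 | hz1
    · refine (hradial z.1 z.2 hz1).1.trans ((le_abs_self _).trans ((hA _ ⟨?_, ?_⟩).trans
        (le_max_left _ _)))
      · nlinarith
      · have := pow_le_pow_left₀ (norm_nonneg _) hz 2
        linarith
    · exact (hin z hz1).1.trans (le_max_right _ _)

theorem RadialCondition.exists_isLyapunovProfile (ha : ∀ z, (a z).PosSemidef)
    (h : RadialCondition b a) : ∃ c φ φ₁ φ₂, IsLyapunovProfile b a c φ φ₁ φ₂ := by
  obtain ⟨⟨ad, bd, had, hbd, hpos, hradial, hcase⟩, M, hM⟩ := h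
  have hβ := continuous_extendHalf hbd.continuousOn
  have hα := continuous_extendHalf had.continuousOn
  have hα0 : ∀ r, 0 < extendHalf ad r := fun r => hpos _ (Set.mem_Ici.2 (le_max_right _ _))
  have hw : Continuous fun r => (extendHalf ad r)⁻¹ := hα.inv₀ fun r => (hα0 r).ne'
  have hw0 : ∀ r, 0 ≤ (extendHalf ad r)⁻¹ := fun r => inv_nonneg.2 (hα0 r).le
  obtain ⟨φ, φ₁, φ₂, hφ⟩ : ∃ φ φ₁ φ₂,
      IsRadialProfile (extendHalf bd) (fun r => (extendHalf ad r)⁻¹) φ φ₁ φ₂ := by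
    rcases hcase with ⟨l, hl⟩ | ⟨-, htop⟩
    · refine ⟨_, _, _, isRadialProfile_of_tendsto hβ hw0 (hl.congr' ?_)⟩
      filter_upwards [eventually_ge_atTop 1] with r hr
      exact (scale_extendHalf bd hr).symm
    · refine exists_isRadialProfile_of_tendsto_speedFrom hβ hw hw0
        (tendsto_speedFrom hβ hw hw0 (Eq.trans ?_ htop))
      refine setLIntegral_congr_fun measurableSet_Ioi fun y hy => ?_
      have hy : (1 : ℝ) < y := hy
      rw [scaleDensity_extendHalf bd hy.le]
      congr 1
      refine setLIntegral_congr_fun measurableSet_Ioi fun z hz => ?_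
      have hz : (1 : ℝ) < z := hy.trans hz
      rw [scaleDensity_extendHalf bd hz.le, extendHalf_of_le ad (by linarith), one_div, mul_inv,
        div_eq_mul_inv]
  obtain ⟨c, hc⟩ := hφ.exists_isLyapunovProfile (b := b) ha had.continuousOn
    (fun r hr => ⟨hpos r hr, by rw [extendHalf_of_le ad hr]⟩) (fun x i hx => by
      rw [extendHalf_of_le bd (by nlinarith)]
      exact hradial x i hx) hM
  exact ⟨c, φ, φ₁, φ₂, hc⟩

end RadialCondition

/-! ### Comparing Q(x) with the dominating matrix. -/

section Domination

variable {E I : Type*} {Q : E → I → I → ℝ}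

theorem IsDominated.le_qbar (h : IsDominated Q) (x : E) {i j : I} (hij : i ≠ j) :
    Q x i j ≤ qbar Q i j := by
  rw [qbar, if_neg hij]
  exact le_ciSup (h.bddAbove i j hij) x

theorem IsDominated.isConservativeQMatrix_qbar (h : IsDominated Q)
    (hQ : ∀ x, IsConservativeQMatrix (Q x)) : IsConservativeQMatrix (qbar Q) where
  nonneg i j hij := by
    rw [qbar, if_neg hij]
    exact Real.iSup_nonneg fun x => (hQ x).nonneg i j hij
  hasSum i := by
    have h1 : -qbar Q i i = ∑' k, (open scoped Classical in if k = i then 0 else ⨆ x, Q x i k) := by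
      rw [qbar, if_pos rfl, neg_neg]
    rw [h1]
    convert (h.summable i).hasSum using 1
    funext j
    split_ifs with hj
    · rfl
    · rw [qbar, if_neg (Ne.symm hj)]

/-- Since g ≥ 0, the off-diagonal terms compare entry by entry, and the diagonal costs at most M
g(i). -/
theorem matrixOp_le_add {q q' : I → I → ℝ} (hq : IsConservativeQMatrix q)
    (hq' : IsConservativeQMatrix q') {g : I → ℝ} (hg : ∀ j, 0 ≤ g j) {K M : ℝ} (hK : ∀ j, g j ≤ K)
    {i : I} (hij : ∀ j, i ≠ j → q i j ≤ q' i j) (hM : q i i - q' i i ≤ M) :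
    matrixOp q g i ≤ matrixOp q' g i + M * g i := by
  classical
  have hb : ∀ j, |g j| ≤ K := fun j => by
    rw [abs_of_nonneg (hg j)]
    exact hK j
  have h1 := (hq.summable_mul i hb).hasSum
  have h2 := (hq'.summable_mul i hb).hasSum.add (hasSum_ite_eq i (M * g i))
  refine hasSum_le (fun j => ?_) h1 h2
  split_ifs with hj
  · subst hj
    have := mul_le_mul_of_nonneg_right hM (hg j)
    linarith
  · rw [add_zero]
    exact mul_le_mul_of_nonneg_right (hij j (Ne.symm hj)) (hg j)

end Domination

/-! ### Conclusion: T_t f vanishes at infinity. -/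

section FellerDynkin

/-- Here K contains every point with |f| ≥ ε/2, and g ≥ δ > 0 on K. Hence |f| ≤ ε/2 + (|B|/δ) g
everywhere, and the bound on the mean of g carries this over to T_t f. -/
theorem tendsto_semigroup {S : Type*} [TopologicalSpace S] [T2Space S] [MeasurableSpace S]
    [BorelSpace S] {P : S → Measure (Path S)} (hP : ∀ z, IsProbabilityMeasure (P z)) {t : ℝ≥0}
    {l : Filter S}
    (h : ∀ K : Set S, IsCompact K → ∃ (g : S → ℝ) (A C : ℝ), Continuous g ∧ (∀ z, 0 ≤ g z) ∧
      (∀ z, g z ≤ A) ∧ (∀ z ∈ K, 0 < g z) ∧ Tendsto g l (𝓝 0) ∧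
      ∀ z, ∫ ω, g (coord t ω) ∂P z ≤ C * g z)
    (f : C₀(S, ℝ)) : Tendsto (semigroup P t f) l (𝓝 0) := by
  rw [Metric.tendsto_nhds]
  intro ε hε
  have hf : ∀ᶠ z in cocompact S, |f z| < ε / 2 := by
    have := Metric.tendsto_nhds.1 f.zero_at_infty' (ε / 2) (half_pos hε)
    simpa using this
  obtain ⟨K, hK, hfK⟩ := mem_cocompact.1 hf
  obtain ⟨B, hB⟩ := exists_abs_le_of_zeroAtInfty f
  obtain ⟨g, A, C, hg, hg0, hgA, hgK, hgl, hgC⟩ := h K hK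
  obtain ⟨δ, hδ, hδK⟩ := hK.exists_forall_le' hg.continuousOn hgK
  have hbound : ∀ z, |f z| ≤ ε / 2 + |B| / δ * g z := fun z => by
    by_cases hz : z ∈ K
    · have h1 : |B| ≤ |B| / δ * g z := by
        rw [div_mul_eq_mul_div, le_div_iff₀ hδ]
        exact mul_le_mul_of_nonneg_left (hδK z hz) (abs_nonneg B)
      linarith [hB z, le_abs_self B]
    · have h1 : |f z| < ε / 2 := hfK hz
      have h2 : 0 ≤ |B| / δ * g z := mul_nonneg (by positivity) (hg0 z)
      linarith
  have hlim : Tendsto (fun z => |B| / δ * (C * g z)) l (𝓝 0) := by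
    simpa using (hgl.const_mul C).const_mul (|B| / δ)
  filter_upwards [hlim.eventually (gt_mem_nhds (half_pos hε))] with z hz
  have := hP z
  have hgi : Integrable (fun ω => g (coord t ω)) (P z) :=
    Integrable.of_bound (hg.measurable.comp (measurable_coord t)).aestronglyMeasurable A
      (ae_of_all _ fun ω => by rw [Real.norm_of_nonneg (hg0 _)]; exact hgA _)
  have h1 : ‖semigroup P t f z‖ ≤ ∫ ω, (ε / 2 + |B| / δ * g (coord t ω)) ∂P z :=
    norm_integral_le_of_norm_le ((integrable_const _).add (hgi.const_mul _))
      (ae_of_all _ fun ω => hbound _)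
  rw [integral_add (integrable_const _) (hgi.const_mul _), integral_const_mul] at h1
  have h2 := mul_le_mul_of_nonneg_left (hgC z) (show 0 ≤ |B| / δ by positivity)
  rw [dist_zero_right]
  simp only [integral_const, probReal_univ, one_smul] at h1
  linarith

variable {d : ℕ} {Sd : Type*} [Countable Sd] [TopologicalSpace Sd] [DiscreteTopology Sd]
  [MeasurableSpace Sd] [BorelSpace Sd] {b : State d Sd → EuclideanSpace ℝ (Fin d)}
  {a : State d Sd → Matrix (Fin d) (Fin d) ℝ} {Q : EuclideanSpace ℝ (Fin d) → Sd → Sd → ℝ}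
  {D : Set (State d Sd → ℝ)}

/-- A function of the second coordinate alone is already a test function and satisfies the
inequality everywhere, so no localization is needed: U is the whole space. -/
theorem integral_snd_le_exp_mul (hQ : ∀ x, IsConservativeQMatrix (Q x)) (hdom : IsDominated Q)
    (hD : IsTestSet b a Q D) {g : Sd → ℝ} (hg : g ∈ chainDomain (qbar Q)) (hg0 : ∀ j, 0 ≤ g j)
    (hgle : ∀ j, matrixOp (qbar Q) g j ≤ g j) :
    ∃ c : ℝ, ∀ (z : State d Sd) (P : Measure (Path (State d Sd))),
      IsSolution D (switchingOp b a Q) (continuousFst d Sd) (Measure.dirac z) P →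
      ∀ t : ℝ≥0, ∫ ω, g (coord t ω).2 ∂P ≤ g z.2 * Real.exp (c * t) := by
  obtain ⟨M, hM⟩ := hdom.diag
  obtain ⟨⟨u, hu⟩, -⟩ := id hg
  obtain ⟨K, hK⟩ := exists_abs_le_of_zeroAtInfty u
  rw [hu] at hK
  have hmem := hD.right_mem g hg
  have hle : ∀ z : State d Sd, switchingOp b a Q (fun z => g z.2) z ≤ (1 + |M|) * g z.2 := fun z => by
    rw [switchingOp_comp_snd]
    have := matrixOp_le_add (hQ z.1) (hdom.isConservativeQMatrix_qbar hQ) hg0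
      (fun j => (le_abs_self _).trans (hK j)) (i := z.2) (fun j hij => hdom.le_qbar z.1 hij)
      ((le_abs_self _).trans ((hM z.2 z.1).trans (le_abs_self M)))
    linarith [hgle z.2]
  refine ⟨1 + |M|, fun z P hP t => ?_⟩
  have := hP.isProbabilityMeasure
  refine integral_le_exp_mul (f := fun z : State d Sd => g z.2) (U := fun _ => Set.univ)
    (F := fun _ z => g z.2) (hD.isInputData.continuous _ hmem).measurable (fun z => hK z.2)
    (fun z => hg0 z.2) (by positivity) (fun _ => ?_) (fun _ => hP.localMartingale _ hmem)
    (ae_coord_zero_eq hP.initial) (Eventually.of_forall fun _ => Set.mem_univ _)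
    (ae_of_all _ fun _ _ => Eventually.of_forall fun _ _ _ => Set.mem_univ _) t
  exact ⟨isClosed_univ, hD.isInputData.continuous _ hmem,
    hD.isInputData.integrable _ hmem, ⟨K, fun z => hK z.2⟩, fun z => hg0 z.2, fun _ _ => rfl,
    fun z _ => hle z, ⟨(1 + |M|) * K, fun z => (hle z).trans
      (mul_le_mul_of_nonneg_left ((le_abs_self _).trans (hK z.2)) (by positivity))⟩⟩

theorem IsCbFeller.isFellerDynkin_of_isLyapunovProfile (hQ : ∀ x, IsConservativeQMatrix (Q x))
    (hdom : IsDominated Q) (hchain : HasUniqueFellerDynkinChain (qbar Q)) (hD : IsTestSet b a Q D)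
    {P : State d Sd → Measure (Path (State d Sd))}
    (hP : ∀ z, IsSolution D (switchingOp b a Q) (continuousFst d Sd) (Measure.dirac z) (P z))
    (hFeller : IsCbFeller P) {c : ℝ} {φ φ₁ φ₂ : ℝ → ℝ} (hφ : IsLyapunovProfile b a c φ φ₁ φ₂) :
    IsFellerDynkin P := by
  refine ⟨hFeller, fun t f => ?_⟩
  obtain ⟨g, hg⟩ := hFeller.map_Cb t f.toBCF
  have hprob : ∀ z, IsProbabilityMeasure (P z) := fun z => (hP z).isProbabilityMeasure
  have hg' : ⇑g = semigroup P t f := funext hg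
  have hq : ∀ z : State d Sd, 0 ≤ ‖z.1‖ ^ 2 / 2 := fun z => by positivity
  suffices Tendsto g (cocompact (State d Sd)) (𝓝 0) from ⟨⟨⟨g, g.continuous⟩, this⟩, hg⟩
  -- Leaving compact sets of the product means leaving them in one of the two coordinates. The
  -- radial function is positive everywhere and serves every K; the chain function is chosen for the
  -- projection of K to S_d, which is compact in a discrete space and hence finite.
  rw [hg', ← coprod_cocompact, Filter.coprod, tendsto_sup]
  refine ⟨tendsto_semigroup hprob (fun K _ => ⟨fun z => φ (‖z.1‖ ^ 2 / 2), φ 0, Real.exp (c * t),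
    hφ.isProfile.continuous.comp continuous_fst, fun z => (hφ.pos _ (hq z)).le, fun z => ?_,
    fun z _ => hφ.pos _ (hq z), ?_, fun z => ?_⟩) f, tendsto_semigroup hprob (fun K hK => ?_) f⟩
  · exact hφ.isProfile.antitoneOn hφ.deriv_nonpos (Set.mem_Ici.2 le_rfl) (Set.mem_Ici.2 (hq z)) (hq z)
  · refine hφ.tendsto.comp (Tendsto.comp (g := fun x : EuclideanSpace ℝ (Fin d) => ‖x‖ ^ 2 / 2) ?_
      tendsto_comap)
    exact ((tendsto_pow_atTop two_ne_zero).comp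
      (tendsto_norm_cocompact_atTop (E := EuclideanSpace ℝ (Fin d)))).atTop_div_const two_pos
  · rw [mul_comm]
    exact hφ.integral_le hQ hD (hP z) t
  · obtain ⟨g, hgC, hg0, hgF, hgle⟩ := exists_chain_lyapunov
      (hdom.isConservativeQMatrix_qbar hQ) hchain (hK.image continuous_snd).finite_of_discrete
    obtain ⟨c', hc'⟩ := integral_snd_le_exp_mul hQ hdom hD hgC hg0 hgle
    obtain ⟨⟨u, hu⟩, -⟩ := id hgC
    obtain ⟨A, hA⟩ := exists_abs_le_of_zeroAtInfty u
    rw [hu] at hA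
    refine ⟨fun z => g z.2, A, Real.exp (c' * t), hD.isInputData.continuous _ (hD.right_mem g hgC),
      fun z => hg0 z.2, fun z => (le_abs_self _).trans (hA z.2), fun z hz => hgF _ ⟨z, hz, rfl⟩, ?_,
      fun z => ?_⟩
    · have := u.zero_at_infty'
      rw [show u.toFun = g from hu] at this
      exact this.comp tendsto_comap
    · rw [mul_comm]
      exact hc' z (P z) (hP z) t

end FellerDynkin

end SwitchingDiffusion

end

theorem proposition4 (d : ℕ) {Sd : Type*} [Countable Sd] [TopologicalSpace Sd] [DiscreteTopology Sd]
    [MeasurableSpace Sd] [BorelSpace Sd]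
    (b : SwitchingDiffusion.State d Sd → EuclideanSpace ℝ (Fin d))
    (a : SwitchingDiffusion.State d Sd → Matrix (Fin d) (Fin d) ℝ)
    (Q : EuclideanSpace ℝ (Fin d) → Sd → Sd → ℝ)
    (hcoef : SwitchingDiffusion.IsCoefficients b a Q)
    (hdom : SwitchingDiffusion.IsDominated Q)
    (hchain : SwitchingDiffusion.HasUniqueFellerDynkinChain (SwitchingDiffusion.qbar Q))
    (D : Set (SwitchingDiffusion.State d Sd → ℝ))
    (hD : SwitchingDiffusion.IsTestSet b a Q D)
    (P : SwitchingDiffusion.State d Sd → Measure (SwitchingDiffusion.Path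
      (SwitchingDiffusion.State d Sd)))
    (hP : ∀ z, SwitchingDiffusion.IsSolution D (SwitchingDiffusion.switchingOp b a Q)
      (SwitchingDiffusion.continuousFst d Sd) (Measure.dirac z) (P z))
    (hFeller : SwitchingDiffusion.IsCbFeller P)
    (hcond : SwitchingDiffusion.RadialCondition b a ∨
      SwitchingDiffusion.LinearGrowthCondition b a) :
    SwitchingDiffusion.IsFellerDynkin P := by
  have hprofile : ∃ c φ φ₁ φ₂, SwitchingDiffusion.IsLyapunovProfile b a c φ φ₁ φ₂ :=
    hcond.elim (fun h => h.exists_isLyapunovProfile hcoef.posSemidef_a)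
      fun h => h.exists_isLyapunovProfile hcoef.posSemidef_a
  obtain ⟨c, φ, φ₁, φ₂, hφ⟩ := hprofile
  exact hFeller.isFellerDynkin_of_isLyapunovProfile hcoef.isQMatrix hdom hchain hD hP hφ
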